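/- Let $H$ be a Hopf algebra over a field $k$, with comultiplication $\Delta$, counit $\varepsilon$ and bijective antipode. A *right coideal subalgebra* of $H$ is a subalgebra $A\subseteq H$ with $\Delta(A)\subseteq A\otimes H$; put $A^+=A\cap\operatorname{Ker}\varepsilon$. A *left $H$-module factor coalgebra* of $H$ is a quotient $C=H/I$, where $I$ is both a left ideal and a coideal of $H$; let $\pi:H\to C$ be the canonical surjection. If $A$ is a right coideal subalgebra, then $H/HA^+$ is a left $H$-module factor coalgebra, and if $C$ is a left $H$-module factor coalgebra, then $${}^{\mathrm{co}\,C}H=\{h\in H\mid(\pi\otimes\mathrm{id})\Delta(h)=\pi(1)\otimes h\}$$ is a right coideal subalgebra. View $H$ as a left and as a right $A$-module by multiplication, and as a left and as a right $C$-comodule by $(\pi\otimes\mathrm{id})\Delta$ and $(\mathrm{id}\otimes\pi)\Delta$. One says that $H$ is *left* (respectively, *right*) *faithfully flat* over $A$ if the functor $N\mapsto N\otimes_AH$ on right $A$-modules (respectively, $N\mapsto H\otimes_AN$ on left $A$-modules) is exact and takes nonzero modules to nonzero spaces, and that $H$ is *left* (respectively, *right*) *faithfully coflat* over $C$ if the cotensor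 product functor $V\mapsto V\,\square_C\,H$ on right $C$-comodules (respectively, $V\mapsto H\,\square_C\,V$ on left $C$-comodules) is exact and takes nonzero comodules to nonzero spaces. **Theorem 1.7.** The assignments $A\mapsto H/HA^+$ and $C\mapsto{}^{\mathrm{co}\,C}H$ restrict to mutually inverse bijections between the set of right coideal subalgebras $A$ of $H$ over which $H$ is left faithfully flat and the set of left $H$-module factor coalgebras $C$ of $H$ over which $H$ is left faithfully coflat. They likewise restrict to mutually inverse bijections between the set of right coideal subalgebras of $H$ over which $H$ is right faithfully flat and the set of left $H$-module factor coalgebras of $H$ over which $H$ is right faithfully coflat. -/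

import Mathlib

open scoped TensorProduct MulOpposite

universe u v w

namespace Takeuchi

/-! ### Faithful flatness over a (noncommutative) algebra -/

section Flatness

variable (k : Type u) (A : Type v) [Field k] [Ring A] [Algebra k A]

section TensorOver

variable (N : Type*) [AddCommGroup N] [Module k N] [Module Aᵐᵒᵖ N]
  (M : Type*) [AddCommGroup M] [Module k M] [Module A M]

/-- The subspace of `N ⊗ M` spanned by the elements `n a ⊗ m - n ⊗ a m`. -/
def balancedRel : Submodule k (N ⊗[k] M) :=
  Submodule.span k {t | ∃ (n : N) (a : A) (m : M),
    t = (MulOpposite.op a • n) ⊗ₜ[k] m - n ⊗ₜ[k] (a • m)}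

/-- The tensor product `N ⊗_A M` of a right `A`-module `N` and a left `A`-module `M`. -/
abbrev TensorOver : Type _ := (N ⊗[k] M) ⧸ balancedRel k A N M

end TensorOver

section Maps

variable {k A}
variable {N : Type*} [AddCommGroup N] [Module k N] [Module Aᵐᵒᵖ N] [IsScalarTower k Aᵐᵒᵖ N]
  {N' : Type*} [AddCommGroup N'] [Module k N'] [Module Aᵐᵒᵖ N'] [IsScalarTower k Aᵐᵒᵖ N']
  {M : Type*} [AddCommGroup M] [Module k M] [Module A M] [IsScalarTower k A M]
  {M' : Type*} [AddCommGroup M'] [Module k M'] [Module A M'] [IsScalarTower k A M']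

variable (k) in
/-- The map `f ⊗_A id : N ⊗_A M → N' ⊗_A M` induced by a right `A`-linear map `f`. -/
def TensorOver.mapLeft (M : Type*) [AddCommGroup M] [Module k M] [Module A M]
    (f : N →ₗ[Aᵐᵒᵖ] N') : TensorOver k A N M →ₗ[k] TensorOver k A N' M :=
  Submodule.mapQ _ _ ((f.restrictScalars k).rTensor M) (by
    refine Submodule.span_le.2 ?_
    rintro _ ⟨n, a, m, rfl⟩
    refine Submodule.subset_span ⟨f n, a, m, ?_⟩
    simp)

variable (k) in
/-- The map `id ⊗_A f : N ⊗_A M → N ⊗_A M'` induced by a left `A`-linear map `f`. -/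
def TensorOver.mapRight (N : Type*) [AddCommGroup N] [Module k N] [Module Aᵐᵒᵖ N]
    (f : M →ₗ[A] M') : TensorOver k A N M →ₗ[k] TensorOver k A N M' :=
  Submodule.mapQ _ _ ((f.restrictScalars k).lTensor N) (by
    refine Submodule.span_le.2 ?_
    rintro _ ⟨n, a, m, rfl⟩
    refine Submodule.subset_span ⟨n, a, f m, ?_⟩
    simp)

end Maps

/-- The left `A`-module `M` is faithfully flat: the functor `N ↦ N ⊗_A M` on right `A`-modules
is exact and annihilates no nonzero module. -/
structure LeftFaithfullyFlat (M : Type v) [AddCommGroup M] [Module k M] [Module A M] :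
    Prop where
  exact : ∀ (N₁ N₂ N₃ : Type v) [AddCommGroup N₁] [Module k N₁] [Module Aᵐᵒᵖ N₁]
    [IsScalarTower k Aᵐᵒᵖ N₁] [AddCommGroup N₂] [Module k N₂] [Module Aᵐᵒᵖ N₂]
    [IsScalarTower k Aᵐᵒᵖ N₂] [AddCommGroup N₃] [Module k N₃] [Module Aᵐᵒᵖ N₃]
    [IsScalarTower k Aᵐᵒᵖ N₃] (f : N₁ →ₗ[Aᵐᵒᵖ] N₂) (g : N₂ →ₗ[Aᵐᵒᵖ] N₃),
    Function.Exact f g →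
      Function.Exact (TensorOver.mapLeft k M f) (TensorOver.mapLeft k M g)
  nontrivial : ∀ (N : Type v) [AddCommGroup N] [Module k N] [Module Aᵐᵒᵖ N]
    [IsScalarTower k Aᵐᵒᵖ N], Nontrivial N → Nontrivial (TensorOver k A N M)

/-- The right `A`-module `N` is faithfully flat: the functor `M ↦ N ⊗_A M` on left `A`-modules
is exact and annihilates no nonzero module. -/
structure RightFaithfullyFlat (N : Type v) [AddCommGroup N] [Module k N] [Module Aᵐᵒᵖ N] :
    Prop where
  exact : ∀ (M₁ M₂ M₃ : Type v) [AddCommGroup M₁] [Module k M₁] [Module A M₁]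
    [IsScalarTower k A M₁] [AddCommGroup M₂] [Module k M₂] [Module A M₂]
    [IsScalarTower k A M₂] [AddCommGroup M₃] [Module k M₃] [Module A M₃]
    [IsScalarTower k A M₃] (f : M₁ →ₗ[A] M₂) (g : M₂ →ₗ[A] M₃),
    Function.Exact f g →
      Function.Exact (TensorOver.mapRight k N f) (TensorOver.mapRight k N g)
  nontrivial : ∀ (M : Type v) [AddCommGroup M] [Module k M] [Module A M]
    [IsScalarTower k A M], Nontrivial M → Nontrivial (TensorOver k A N M)

end Flatness

/-! ### Comodules, cotensor products and faithful coflatness -/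

section Comodules

variable (k : Type u) (C : Type v) [Field k] [AddCommGroup C] [Module k C] [Coalgebra k C]

/-- The structure of a right `C`-comodule on the vector space `V`. -/
structure RightComodule (V : Type w) [AddCommGroup V] [Module k V] where
  coact : V →ₗ[k] V ⊗[k] C
  coassoc : (TensorProduct.assoc k V C C).toLinearMap ∘ₗ coact.rTensor C ∘ₗ coact =
    (Coalgebra.comul (R := k) (A := C)).lTensor V ∘ₗ coact
  counit : (TensorProduct.rid k V).toLinearMap ∘ₗ
    (Coalgebra.counit (R := k) (A := C)).lTensor V ∘ₗ coact = LinearMap.id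

/-- The structure of a left `C`-comodule on the vector space `V`. -/
structure LeftComodule (V : Type w) [AddCommGroup V] [Module k V] where
  coact : V →ₗ[k] C ⊗[k] V
  coassoc : (TensorProduct.assoc k C C V).toLinearMap ∘ₗ
    (Coalgebra.comul (R := k) (A := C)).rTensor V ∘ₗ coact = coact.lTensor C ∘ₗ coact
  counit : (TensorProduct.lid k V).toLinearMap ∘ₗ
    (Coalgebra.counit (R := k) (A := C)).rTensor V ∘ₗ coact = LinearMap.id

variable {k C}
variable {V : Type*} [AddCommGroup V] [Module k V] {W : Type*} [AddCommGroup W] [Module k W]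
  {M : Type*} [AddCommGroup M] [Module k M]

/-- The linear map `f` is a morphism of right comodules. -/
def RightComodule.IsColinear (ρ : RightComodule k C V) (σ : RightComodule k C W)
    (f : V →ₗ[k] W) : Prop :=
  σ.coact ∘ₗ f = f.rTensor C ∘ₗ ρ.coact

/-- The linear map `f` is a morphism of left comodules. -/
def LeftComodule.IsColinear (ρ : LeftComodule k C V) (σ : LeftComodule k C W)
    (f : V →ₗ[k] W) : Prop :=
  σ.coact ∘ₗ f = f.lTensor C ∘ₗ ρ.coact

/-- The cotensor product `V □_C W` of a right comodule `V` and a left comodule `W`: the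
equalizer of `ρ ⊗ id` and `id ⊗ σ` in `V ⊗ W`. -/
def cotensor (ρ : RightComodule k C V) (σ : LeftComodule k C W) : Submodule k (V ⊗[k] W) :=
  LinearMap.eqLocus
    ((TensorProduct.assoc k V C W).toLinearMap ∘ₗ ρ.coact.rTensor W) (σ.coact.lTensor V)

/-- The map `f □ id : V □_C M → W □_C M` induced by a morphism `f` of right comodules. -/
def cotensorMapLeft {ρ : RightComodule k C V} {σ : RightComodule k C W}
    (τ : LeftComodule k C M) (f : V →ₗ[k] W) (hf : ρ.IsColinear σ f) :
    cotensor ρ τ →ₗ[k] cotensor σ τ :=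
  (f.rTensor M).restrict (by
    intro x hx
    have hx' : TensorProduct.assoc k V C M (ρ.coact.rTensor M x) = τ.coact.lTensor V x := hx
    change TensorProduct.assoc k W C M (σ.coact.rTensor M (f.rTensor M x)) =
      τ.coact.lTensor W (f.rTensor M x)
    have h1 : τ.coact.lTensor W (f.rTensor M x) =
        f.rTensor (C ⊗[k] M) (τ.coact.lTensor V x) := by
      simp only [← LinearMap.comp_apply, LinearMap.lTensor_comp_rTensor,
        LinearMap.rTensor_comp_lTensor]
    rw [h1, ← hx', ← LinearMap.comp_apply, ← LinearMap.rTensor_comp, hf,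
      LinearMap.rTensor_comp, LinearMap.comp_apply]
    have h2 : (TensorProduct.assoc k W C M).toLinearMap ∘ₗ (f.rTensor C).rTensor M =
        f.rTensor (C ⊗[k] M) ∘ₗ (TensorProduct.assoc k V C M).toLinearMap :=
      TensorProduct.ext_threefold fun _ _ _ => rfl
    exact LinearMap.congr_fun h2 _)

/-- The map `id □ f : M □_C V → M □_C W` induced by a morphism `f` of left comodules. -/
def cotensorMapRight {ρ : LeftComodule k C V} {σ : LeftComodule k C W}
    (τ : RightComodule k C M) (f : V →ₗ[k] W) (hf : ρ.IsColinear σ f) :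
    cotensor τ ρ →ₗ[k] cotensor τ σ :=
  (f.lTensor M).restrict (by
    intro x hx
    have hx' : TensorProduct.assoc k M C V (τ.coact.rTensor V x) = ρ.coact.lTensor M x := hx
    change TensorProduct.assoc k M C W (τ.coact.rTensor W (f.lTensor M x)) =
      σ.coact.lTensor M (f.lTensor M x)
    rw [← LinearMap.comp_apply (σ.coact.lTensor M), ← LinearMap.lTensor_comp, hf,
      LinearMap.lTensor_comp, LinearMap.comp_apply, ← hx']
    have h1 : τ.coact.rTensor W (f.lTensor M x) =
        f.lTensor (M ⊗[k] C) (τ.coact.rTensor V x) := by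
      simp only [← LinearMap.comp_apply, LinearMap.lTensor_comp_rTensor,
        LinearMap.rTensor_comp_lTensor]
    rw [h1]
    have h2 : (TensorProduct.assoc k M C W).toLinearMap ∘ₗ f.lTensor (M ⊗[k] C) =
        (f.lTensor C).lTensor M ∘ₗ (TensorProduct.assoc k M C V).toLinearMap :=
      TensorProduct.ext_threefold fun _ _ _ => rfl
    exact LinearMap.congr_fun h2 _)

/-- The left comodule `M` is faithfully coflat: the functor `V ↦ V □_C M` on right comodules
is exact and annihilates no nonzero comodule. -/
structure LeftComodule.FaithfullyCoflat {M : Type v} [AddCommGroup M] [Module k M]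
    (τ : LeftComodule k C M) : Prop where
  exact : ∀ (V₁ V₂ V₃ : Type v) [AddCommGroup V₁] [Module k V₁] [AddCommGroup V₂] [Module k V₂]
    [AddCommGroup V₃] [Module k V₃] (ρ₁ : RightComodule k C V₁) (ρ₂ : RightComodule k C V₂)
    (ρ₃ : RightComodule k C V₃) (f : V₁ →ₗ[k] V₂) (g : V₂ →ₗ[k] V₃)
    (hf : ρ₁.IsColinear ρ₂ f) (hg : ρ₂.IsColinear ρ₃ g), Function.Exact f g →
      Function.Exact (cotensorMapLeft τ f hf) (cotensorMapLeft τ g hg)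
  nontrivial : ∀ (V : Type v) [AddCommGroup V] [Module k V] (ρ : RightComodule k C V),
    Nontrivial V → Nontrivial (cotensor ρ τ)

/-- The right comodule `M` is faithfully coflat: the functor `V ↦ M □_C V` on left comodules
is exact and annihilates no nonzero comodule. -/
structure RightComodule.FaithfullyCoflat {M : Type v} [AddCommGroup M] [Module k M]
    (τ : RightComodule k C M) : Prop where
  exact : ∀ (V₁ V₂ V₃ : Type v) [AddCommGroup V₁] [Module k V₁] [AddCommGroup V₂] [Module k V₂]
    [AddCommGroup V₃] [Module k V₃] (ρ₁ : LeftComodule k C V₁) (ρ₂ : LeftComodule k C V₂)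
    (ρ₃ : LeftComodule k C V₃) (f : V₁ →ₗ[k] V₂) (g : V₂ →ₗ[k] V₃)
    (hf : ρ₁.IsColinear ρ₂ f) (hg : ρ₂.IsColinear ρ₃ g), Function.Exact f g →
      Function.Exact (cotensorMapRight τ f hf) (cotensorMapRight τ g hg)
  nontrivial : ∀ (V : Type v) [AddCommGroup V] [Module k V] (ρ : LeftComodule k C V),
    Nontrivial V → Nontrivial (cotensor τ ρ)

variable {D : Type*} [AddCommGroup D] [Module k D] [Coalgebra k D]

/-- Along a coalgebra map `π : D → C`, the coalgebra `D` is a left `C`-comodule with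
coaction `(π ⊗ id) Δ`. -/
def LeftComodule.ofCoalgHom (π : D →ₗc[k] C) : LeftComodule k C D where
  coact := π.toLinearMap.rTensor D ∘ₗ Coalgebra.comul
  coassoc := by
    simp only [coassoc_simps, ← π.map_comp_comul]
  counit := by
    ext x
    have h : (Coalgebra.counit (R := k) (A := C)).rTensor D
        (π.toLinearMap.rTensor D (Coalgebra.comul x)) =
        (Coalgebra.counit (R := k) (A := D)).rTensor D (Coalgebra.comul x) := by
      rw [← LinearMap.rTensor_comp_apply, π.counit_comp]
    change TensorProduct.lid k D ((Coalgebra.counit (R := k) (A := C)).rTensor D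
      (π.toLinearMap.rTensor D (Coalgebra.comul x))) = x
    rw [h]
    simp

/-- Along a coalgebra map `π : D → C`, the coalgebra `D` is a right `C`-comodule with
coaction `(id ⊗ π) Δ`. -/
def RightComodule.ofCoalgHom (π : D →ₗc[k] C) : RightComodule k C D where
  coact := π.toLinearMap.lTensor D ∘ₗ Coalgebra.comul
  coassoc := by
    simp only [coassoc_simps, ← π.map_comp_comul]
  counit := by
    ext x
    have h : (Coalgebra.counit (R := k) (A := C)).lTensor D
        (π.toLinearMap.lTensor D (Coalgebra.comul x)) =
        (Coalgebra.counit (R := k) (A := D)).lTensor D (Coalgebra.comul x) := by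
      rw [← LinearMap.lTensor_comp_apply, π.counit_comp]
    change TensorProduct.rid k D ((Coalgebra.counit (R := k) (A := C)).lTensor D
      (π.toLinearMap.lTensor D (Coalgebra.comul x))) = x
    rw [h]
    simp

end Comodules

/-! ### Auxiliary facts on left ideals and coideals -/

section Aux

variable {k : Type u} {H : Type v} [Field k] [Ring H] [HopfAlgebra k H]

theorem mul_mem_range_rTensor (I : Ideal H) (t z : H ⊗[k] H)
    (hz : z ∈ LinearMap.range ((I.restrictScalars k).subtype.rTensor H)) :
    t * z ∈ LinearMap.range ((I.restrictScalars k).subtype.rTensor H) := by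
  obtain ⟨w, rfl⟩ := hz
  induction w with
  | zero => simp
  | add a b ha hb => simpa [mul_add] using add_mem ha hb
  | tmul i c =>
    induction t with
    | zero => simp
    | add a b ha hb => simpa [add_mul] using add_mem ha hb
    | tmul a b =>
      exact ⟨(⟨a * i, I.mul_mem_left a i.2⟩ : I.restrictScalars k) ⊗ₜ (b * c), by simp⟩

theorem mul_mem_range_lTensor (I : Ideal H) (t z : H ⊗[k] H)
    (hz : z ∈ LinearMap.range ((I.restrictScalars k).subtype.lTensor H)) :
    t * z ∈ LinearMap.range ((I.restrictScalars k).subtype.lTensor H) := by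
  obtain ⟨w, rfl⟩ := hz
  induction w with
  | zero => simp
  | add a b ha hb => simpa [mul_add] using add_mem ha hb
  | tmul c i =>
    induction t with
    | zero => simp
    | add a b ha hb => simpa [add_mul] using add_mem ha hb
    | tmul a b =>
      exact ⟨(a * c) ⊗ₜ (⟨b * i, I.mul_mem_left b i.2⟩ : I.restrictScalars k), by simp⟩

theorem range_rTensor_mul_mem (I : Ideal H) (y : H) (z : H ⊗[k] H)
    (hz : z ∈ LinearMap.range ((I.restrictScalars k).subtype.rTensor H)) :
    z * (1 ⊗ₜ[k] y) ∈ LinearMap.range ((I.restrictScalars k).subtype.rTensor H) := by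
  obtain ⟨w, rfl⟩ := hz
  induction w with
  | zero => simp
  | add a b ha hb => simpa [add_mul] using add_mem ha hb
  | tmul i c => exact ⟨i ⊗ₜ (c * y), by simp⟩

theorem rTensor_mkQ_eq_iff (I : Ideal H) (z w : H ⊗[k] H) :
    (I.restrictScalars k).mkQ.rTensor H z = (I.restrictScalars k).mkQ.rTensor H w ↔
      z - w ∈ LinearMap.range ((I.restrictScalars k).subtype.rTensor H) := by
  rw [← sub_eq_zero, ← map_sub]
  exact rTensor_exact H (LinearMap.exact_subtype_mkQ _) (Submodule.mkQ_surjective _) _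

theorem isCoideal_span (A : Subalgebra k H) (hA : ∀ a ∈ A, Coalgebra.comul (R := k) a ∈
    LinearMap.range (A.toSubmodule.subtype.rTensor H)) :
    ((Ideal.span {a | a ∈ A ∧ Coalgebra.counit (R := k) a = 0}).restrictScalars k).IsCoideal := by
  rw [Submodule.isCoideal_iff_comul_mem]
  set I := Ideal.span {a | a ∈ A ∧ Coalgebra.counit (R := k) a = 0} with hI
  constructor
  · intro x hx
    replace hx : x ∈ I := hx
    induction hx using Submodule.span_induction with
    | mem x hx => exact hx.2
    | zero => simp
    | add x y _ _ hx hy => simp [hx, hy]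
    | smul a x _ hx => simp [hx]
  · intro x hx
    replace hx : x ∈ I := hx
    induction hx using Submodule.span_induction with
    | mem x hx =>
      have key : ∀ z : A.toSubmodule ⊗[k] H,
          A.toSubmodule.subtype.rTensor H z - 1 ⊗ₜ[k] (TensorProduct.lid k H
            ((Coalgebra.counit (R := k) (A := H)).rTensor H
              (A.toSubmodule.subtype.rTensor H z))) ∈
            LinearMap.range ((I.restrictScalars k).subtype.rTensor H) := by
        intro z
        induction z with
        | zero => simp
        | add a b ha hb =>
          have := add_mem ha hb
          simp only [map_add, TensorProduct.tmul_add]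
          convert this using 1
          abel
        | tmul a h =>
          have ha : (a : H) - algebraMap k H (Coalgebra.counit (R := k) (a : H)) ∈ I :=
            Ideal.subset_span ⟨A.sub_mem a.2 (A.algebraMap_mem _), by simp⟩
          refine ⟨(⟨_, ha⟩ : I.restrictScalars k) ⊗ₜ h, ?_⟩
          simp [TensorProduct.sub_tmul, Algebra.algebraMap_eq_smul_one, TensorProduct.smul_tmul]
      obtain ⟨z, hz⟩ := hA x hx.1
      have h1 := key z
      rw [hz] at h1
      have h2 : TensorProduct.lid k H ((Coalgebra.counit (R := k) (A := H)).rTensor H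
          (Coalgebra.comul (R := k) x)) = x := by simp
      rw [h2] at h1
      rw [← sub_add_cancel (Coalgebra.comul (R := k) x) (1 ⊗ₜ[k] x)]
      refine add_mem (Submodule.mem_sup_right h1) (Submodule.mem_sup_left ?_)
      exact ⟨1 ⊗ₜ (⟨x, Ideal.subset_span hx⟩ : I.restrictScalars k), by simp⟩
    | zero => simp
    | add x y _ _ hx hy => simpa using add_mem hx hy
    | smul a x _ hx =>
      rw [smul_eq_mul, Bialgebra.comul_mul]
      obtain ⟨y, hy, z, hz, h⟩ := Submodule.mem_sup.1 hx
      rw [← h, mul_add]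
      exact add_mem (Submodule.mem_sup_left (mul_mem_range_lTensor I _ _ hy))
        (Submodule.mem_sup_right (mul_mem_range_rTensor I _ _ hz))

theorem coinv_mul (I : Ideal H) {x y : H}
    (hx : (I.restrictScalars k).mkQ.rTensor H (Coalgebra.comul x) = (I.restrictScalars k).mkQ 1 ⊗ₜ[k] x)
    (hy : (I.restrictScalars k).mkQ.rTensor H (Coalgebra.comul y) = (I.restrictScalars k).mkQ 1 ⊗ₜ[k] y) :
    (I.restrictScalars k).mkQ.rTensor H (Coalgebra.comul (x * y)) =
      (I.restrictScalars k).mkQ 1 ⊗ₜ[k] (x * y) := by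
  rw [← LinearMap.rTensor_tmul, rTensor_mkQ_eq_iff] at *
  have h1 := mul_mem_range_rTensor I (Coalgebra.comul (R := k) x) _ hy
  have h2 := range_rTensor_mul_mem I y _ hx
  have h := add_mem h1 h2
  convert h using 1
  simp [mul_sub, sub_mul]

theorem coinv_comul (I : Ideal H) (A : Submodule k H)
    (hA : ∀ h, h ∈ A ↔ (I.restrictScalars k).mkQ.rTensor H (Coalgebra.comul h) =
      (I.restrictScalars k).mkQ 1 ⊗ₜ[k] h) {a : H} (ha : a ∈ A) :
    Coalgebra.comul (R := k) a ∈ LinearMap.range (A.subtype.rTensor H) := by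
  set q := (I.restrictScalars k).mkQ
  let f : H →ₗ[k] (H ⧸ I.restrictScalars k) ⊗[k] H :=
    q.rTensor H ∘ₗ Coalgebra.comul - TensorProduct.mk k _ _ (q 1)
  have hf : ∀ h, h ∈ A ↔ f h = 0 := fun h => by
    rw [hA]; simp [f, sub_eq_zero]
  have hex : Function.Exact A.subtype f := fun h => by
    rw [← hf]; simp
  have hex' := Module.Flat.rTensor_exact (R := k) H hex
  refine (hex' _).1 ?_
  apply (TensorProduct.assoc k _ H H).injective
  have h1 : (TensorProduct.assoc k _ H H).toLinearMap ∘ₗ f.rTensor H ∘ₗ Coalgebra.comul =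
      (Coalgebra.comul (R := k) (A := H)).lTensor _ ∘ₗ f := by
    have e1 : (TensorProduct.assoc k _ H H).toLinearMap ∘ₗ
        (q.rTensor H ∘ₗ Coalgebra.comul).rTensor H ∘ₗ Coalgebra.comul =
        (Coalgebra.comul (R := k) (A := H)).lTensor _ ∘ₗ (q.rTensor H ∘ₗ Coalgebra.comul) := by
      simp only [coassoc_simps]
    have e2 : (TensorProduct.assoc k _ H H).toLinearMap ∘ₗ
        (TensorProduct.mk k (H ⧸ I.restrictScalars k) H (q 1)).rTensor H =
        TensorProduct.mk k _ _ (q 1) := by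
      ext; rfl
    ext h
    have e1' := LinearMap.congr_fun e1 h
    have e2' := LinearMap.congr_fun e2 (Coalgebra.comul h)
    simp only [LinearMap.comp_apply, LinearEquiv.coe_coe] at e1' e2'
    have e3 : f.rTensor H (Coalgebra.comul h) =
        (q.rTensor H ∘ₗ Coalgebra.comul).rTensor H (Coalgebra.comul h) -
          (TensorProduct.mk k (H ⧸ I.restrictScalars k) H (q 1)).rTensor H
            (Coalgebra.comul h) := by
      rw [LinearMap.rTensor_sub]; rfl
    have e4 : f h = q.rTensor H (Coalgebra.comul h) - q 1 ⊗ₜ[k] h := rfl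
    simp only [LinearMap.comp_apply, LinearEquiv.coe_coe]
    rw [e3, e4, map_sub, map_sub, e1', e2']
    rfl
  have h2 := LinearMap.congr_fun h1 a
  simp only [LinearMap.comp_apply, (hf a).1 ha, map_zero] at h2
  rw [map_zero]
  exact h2

end Aux

/-! ### The correspondence -/

section Hopf

variable (k : Type u) (H : Type v) [Field k] [Ring H] [HopfAlgebra k H]

/-- A right coideal subalgebra of `H`: a subalgebra `A` such that `Δ(A) ⊆ A ⊗ H`. -/
@[ext]
structure RightCoidealSubalgebra where
  carrier : Subalgebra k H
  comul_mem : ∀ a ∈ carrier, Coalgebra.comul (R := k) a ∈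
    LinearMap.range (carrier.toSubmodule.subtype.rTensor H)

/-- A left `H`-module factor coalgebra `H ⧸ I` of `H`, given by its kernel `I`, which is
simultaneously a left ideal and a coideal of `H`. -/
@[ext]
structure LeftModuleFactorCoalgebra where
  ker : Ideal H
  isCoideal : (ker.restrictScalars k).IsCoideal

variable {k H}

namespace LeftModuleFactorCoalgebra

variable (C : LeftModuleFactorCoalgebra k H)

instance : (C.ker.restrictScalars k).IsCoideal := C.isCoideal

/-- The coalgebra `H ⧸ I` itself. -/
abbrev Quot : Type v := H ⧸ C.ker.restrictScalars k

/-- The canonical surjection `π : H → H ⧸ I`. -/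
noncomputable abbrev proj : H →ₗc[k] C.Quot :=
  Coalgebra.Quotient.mkQCoalgHom (C.ker.restrictScalars k)

/-- `H` as a left comodule over its factor coalgebra. -/
noncomputable def leftComodule : LeftComodule k C.Quot H := LeftComodule.ofCoalgHom C.proj

/-- `H` as a right comodule over its factor coalgebra. -/
noncomputable def rightComodule : RightComodule k C.Quot H := RightComodule.ofCoalgHom C.proj

/-- The invariants `{h | (π ⊗ id) Δ(h) = π(1) ⊗ h}` of the left coaction of `C` on `H`. -/
noncomputable def coinvariants : RightCoidealSubalgebra k H where
  carrier :=
    { carrier := {h | C.leftComodule.coact h = C.proj 1 ⊗ₜ[k] h}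
      mul_mem' := fun hx hy => coinv_mul C.ker hx hy
      add_mem' := fun {x y} hx hy => by
        simp only [Set.mem_ofPred_eq] at hx hy ⊢
        rw [map_add, hx, hy, TensorProduct.tmul_add]
      algebraMap_mem' := fun r => by
        change (C.ker.restrictScalars k).mkQ.rTensor H (Coalgebra.comul (algebraMap k H r)) =
          (C.ker.restrictScalars k).mkQ 1 ⊗ₜ[k] algebraMap k H r
        simp [Algebra.algebraMap_eq_smul_one, Algebra.TensorProduct.one_def] }
  comul_mem := fun _ ha => coinv_comul C.ker _ (fun _ => Iff.rfl) ha

end LeftModuleFactorCoalgebra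

namespace RightCoidealSubalgebra

variable (A : RightCoidealSubalgebra k H)

/-- `H` is faithfully flat as a left `A`-module under multiplication. -/
def IsLeftFaithfullyFlat : Prop := LeftFaithfullyFlat k A.carrier H

/-- `H` as a right `A`-module under multiplication. -/
abbrev rightModule : Module (A.carrier)ᵐᵒᵖ H :=
  Module.compHom H (AlgHom.op A.carrier.val).toRingHom

/-- `H` is faithfully flat as a right `A`-module under multiplication. -/
def IsRightFaithfullyFlat : Prop :=
  letI := A.rightModule
  RightFaithfullyFlat k A.carrier H

/-- The left ideal `HA⁺`, where `A⁺ = {a ∈ A | ε(a) = 0}`. -/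
def idealSpan : Ideal H :=
  Ideal.span {a | a ∈ A.carrier ∧ Coalgebra.counit (R := k) a = 0}

/-- The left `H`-module factor coalgebra `H ⧸ HA⁺`. -/
def factor : LeftModuleFactorCoalgebra k H where
  ker := A.idealSpan
  isCoideal := isCoideal_span A.carrier A.comul_mem

end RightCoidealSubalgebra

namespace LeftModuleFactorCoalgebra

variable (C : LeftModuleFactorCoalgebra k H)

/-- `H` is faithfully coflat as a left comodule over `C`. -/
def IsLeftFaithfullyCoflat : Prop := C.leftComodule.FaithfullyCoflat

/-- `H` is faithfully coflat as a right comodule over `C`. -/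
def IsRightFaithfullyCoflat : Prop := C.rightComodule.FaithfullyCoflat

end LeftModuleFactorCoalgebra

end Hopf

end Takeuchi

open scoped TensorProduct MulOpposite

/-! Write `C = H/HA⁺`, `π : H → C`, and `S` for the antipode. Everything rests on two comparison
maps, one starting from `A` and one starting from `C`.

From `A`: the bijection `x ⊗ y ↦ x₁ ⊗ x₂y` of `H ⊗ H` carries the relations `xa ⊗ y - x ⊗ ay`
exactly onto `HA⁺ ⊗ H`, so it induces the Galois isomorphism `H ⊗_A H ≅ C ⊗ H`
(`mem_relations_of_galois_eq_zero`, `galois_eq_zero_of_mem_relations`). If `b` is coinvariant, then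
`b ⊗ 1` and `1 ⊗ b` have the same Galois image, hence agree in `H ⊗_A H`. The class of `b` in `H/A`
therefore dies after `- ⊗_A H`, and faithful flatness gives `b ∈ A` (`coinvariants_factor`).
Flatness and the Galois isomorphism also give `(V □_C H) ⊗_A H ≅ V ⊗ H` for every right `C`-comodule
`V` (`cotensorMul_injective`, `cotensorMul_surjective`). The right side is exact and faithful in
`V`, and `- ⊗_A H` reflects exactness, so `H` is left faithfully coflat over `C`
(`factor_isLeftFaithfullyCoflat`).

From `C`, with `A` its coinvariants: the map `x ⊗ g ↦ S(x)g₁ ⊗ g₂` embeds `H □_C H` into `A ⊗ H`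
(`galLeft_mem_of_mem_cotensor`). Put `D = H/HA⁺`. Coflatness makes `H □_C H → D □_C H` surjective,
and the embedding shows that every element of `D □_C H` is the image of some `Δ(x)`. Hence the
canonical map `D → C` is injective after `- □_C H`, and so is injective (`factor_coinvariants`). For
flatness, give `H` the right `C`-coaction transported along `S`, which is left `A`-linear. Then `N
⊗_A H` is a right `C`-comodule for every right `A`-module `N`, and `n ⊗ g ↦ [n ⊗ S(g₁)] ⊗ g₂`
identifies `N ⊗ H` with `(N ⊗_A H) □_C H`. Since `N ⊗ H` is exact and faithful in `N`, and `- □_C H`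
reflects injectivity, `H` is left faithfully flat over `A` (`coinvariants_isLeftFaithfullyFlat`).

The right-handed statement is the left-handed one for the co-opposite Hopf algebra, whose antipode
is `S⁻¹`. There `A` is replaced by `S⁻¹(A)` and the left ideal defining `C` is kept as it is; left
and right are exchanged both for modules and for comodules, and both assignments of the theorem
commute with this passage (`coinvariants_coop`, `factor_coop`). -/

namespace Takeuchi

open Coalgebra TensorProduct HopfAlgebra

/-! ### Antipode identities and the canonical bijections of `H ⊗ H`. -/

section Sweedler

variable {k : Type u} {H : Type v} [Field k] [Ring H] [HopfAlgebra k H]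

/-- The antipode is anti-comultiplicative. -/
theorem comul_comp_antipode :
    comul ∘ₗ antipode k (A := H) =
      TensorProduct.map (antipode k) (antipode k) ∘ₗ (TensorProduct.comm k H H).toLinearMap ∘ₗ
        comul := by
  symm
  apply WithConv.toConv_injective
  -- Both maps are convolution inverses of `comul` among linear maps `H → H ⊗ H`. What remains is
  -- that `S(x₂)x₃ ⊗ S(x₁)x₄` equals `ε(x) 1 ⊗ 1`: the inner product `S(x₂)x₃` collapses (`h4`),
  -- then the outer one (`h6`, `hm`).
  refine left_inv_eq_right_inv (a := WithConv.toConv (comul (R := k) (A := H))) ?_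
    LinearMap.comul_right_inv
  apply WithConv.ext
  rw [LinearMap.convMul_def, LinearMap.convOne_def]
  let m : H ⊗[k] H →ₗ[k] H := LinearMap.mul' k H ∘ₗ (antipode k).rTensor H
  have hm : m ∘ₗ comul = Algebra.linearMap k H ∘ₗ counit := mul_antipode_rTensor_comul
  let Ψ : H ⊗[k] (H ⊗[k] H) →ₗ[k] H ⊗[k] H :=
    m.lTensor H ∘ₗ (TensorProduct.leftComm k H H H).toLinearMap
  have h1 : LinearMap.mul' k (H ⊗[k] H) ∘ₗ TensorProduct.map
        (TensorProduct.map (antipode k) (antipode k) ∘ₗ (TensorProduct.comm k H H).toLinearMap)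
        LinearMap.id =
      Ψ ∘ₗ (m.rTensor H ∘ₗ (TensorProduct.assoc k H H H).symm.toLinearMap).lTensor H ∘ₗ
        (TensorProduct.assoc k H H (H ⊗[k] H)).toLinearMap := by
    ext a b c d
    simp [Ψ, m]
  have h2 : (TensorProduct.assoc k H H (H ⊗[k] H)).toLinearMap ∘ₗ
      TensorProduct.map comul comul ∘ₗ comul (R := k) (A := H) =
      ((TensorProduct.assoc k H H H).toLinearMap ∘ₗ comul.rTensor H ∘ₗ comul).lTensor H ∘ₗ
        comul := by
    simp only [coassoc_simps]
  have h3 : TensorProduct.map (TensorProduct.map (antipode k) (antipode k) ∘ₗ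
      (TensorProduct.comm k H H).toLinearMap ∘ₗ comul) (comul (R := k) (A := H)) =
      TensorProduct.map
        (TensorProduct.map (antipode k) (antipode k) ∘ₗ (TensorProduct.comm k H H).toLinearMap)
        LinearMap.id ∘ₗ TensorProduct.map comul comul := by
    ext; simp
  have h4 : m.rTensor H ∘ₗ comul.rTensor H ∘ₗ comul = TensorProduct.mk k H H 1 := by
    ext x
    simp only [LinearMap.comp_apply, ← LinearMap.rTensor_comp_apply, hm]
    rw [LinearMap.rTensor_comp_apply]
    simp
  have h5 : m.rTensor H ∘ₗ (TensorProduct.assoc k H H H).symm.toLinearMap ∘ₗ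
      (TensorProduct.assoc k H H H).toLinearMap ∘ₗ comul.rTensor H ∘ₗ comul =
      TensorProduct.mk k H H 1 := by
    rw [← h4]; ext; simp
  have h6 : Ψ ∘ₗ (TensorProduct.mk k H H 1).lTensor H = TensorProduct.mk k H H 1 ∘ₗ m := by
    ext; simp [Ψ]
  rw [h3]
  ext x
  have e1 := LinearMap.congr_fun h1 (TensorProduct.map comul comul (comul (R := k) x))
  have e2 := LinearMap.congr_fun h2 x
  have e6 := LinearMap.congr_fun h6 (comul x)
  have em := LinearMap.congr_fun hm x
  simp only [LinearMap.comp_apply, LinearEquiv.coe_coe] at e1 e2 e6 em ⊢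
  rw [e1, e2, ← LinearMap.lTensor_comp_apply, LinearMap.comp_assoc, h5, e6, em]
  simp [Algebra.algebraMap_eq_smul_one, Algebra.TensorProduct.one_def]

theorem comul_antipode_apply (x : H) :
    comul (antipode k x) = TensorProduct.map (antipode k) (antipode k)
      (TensorProduct.comm k H H (comul x)) :=
  LinearMap.congr_fun comul_comp_antipode x

variable (k H) in
/-- The map `x ⊗ y ↦ x₁ ⊗ x₂ y`. -/
noncomputable def gal : H ⊗[k] H →ₗ[k] H ⊗[k] H :=
  (LinearMap.mul' k H).lTensor H ∘ₗ (TensorProduct.assoc k H H H).toLinearMap ∘ₗ comul.rTensor H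

variable (k H) in
/-- The map `x ⊗ y ↦ x₁ ⊗ S(x₂) y`. -/
noncomputable def galInv : H ⊗[k] H →ₗ[k] H ⊗[k] H :=
  (LinearMap.mul' k H ∘ₗ (antipode k).rTensor H).lTensor H ∘ₗ
    (TensorProduct.assoc k H H H).toLinearMap ∘ₗ comul.rTensor H

theorem gal_tmul (x y : H) : gal k H (x ⊗ₜ y) = comul x * (1 ⊗ₜ y) := by
  simp only [gal, LinearMap.comp_apply, LinearEquiv.coe_coe, LinearMap.rTensor_tmul]
  induction comul (R := k) x with
  | zero => simp
  | add a b ha hb => simp [TensorProduct.add_tmul, add_mul, ha, hb]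
  | tmul a b => simp

theorem galInv_tmul (x y : H) :
    galInv k H (x ⊗ₜ y) = (antipode k).lTensor H (comul x) * (1 ⊗ₜ y) := by
  simp only [galInv, LinearMap.comp_apply, LinearEquiv.coe_coe, LinearMap.rTensor_tmul]
  induction comul (R := k) x with
  | zero => simp
  | add a b ha hb => simp [TensorProduct.add_tmul, add_mul, ha, hb]
  | tmul a b => simp

/-- Linearity over right multiplication in the second factor; the inversion identities for `gal` and
`galInv` then need checking only on elements `x ⊗ 1`. -/
theorem gal_mul_right (z : H ⊗[k] H) (y : H) : gal k H (z * (1 ⊗ₜ y)) = gal k H z * (1 ⊗ₜ y) := by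
  induction z with
  | zero => simp
  | add a b ha hb => simp only [add_mul, map_add, ha, hb]
  | tmul a b => simp [gal_tmul, mul_assoc]

theorem galInv_mul_right (z : H ⊗[k] H) (y : H) :
    galInv k H (z * (1 ⊗ₜ y)) = galInv k H z * (1 ⊗ₜ y) := by
  induction z with
  | zero => simp
  | add a b ha hb => simp only [add_mul, map_add, ha, hb]
  | tmul a b => simp [galInv_tmul, mul_assoc]

/-- By coassociativity the left side is `x₁ ⊗ S(x₂)x₃`, and the antipode axiom removes the last two
factors. -/
theorem galInv_comul (x : H) : galInv k H (comul x) = x ⊗ₜ 1 := by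
  simp only [galInv, LinearMap.comp_apply, LinearEquiv.coe_coe, coassoc_apply]
  rw [← LinearMap.lTensor_comp_apply, LinearMap.comp_assoc, mul_antipode_rTensor_comul,
    LinearMap.lTensor_comp_apply]
  simp

theorem gal_lTensor_antipode_comul (x : H) :
    gal k H ((antipode k).lTensor H (comul x)) = x ⊗ₜ 1 := by
  have h : ∀ z : H ⊗[k] H, gal k H ((antipode k).lTensor H z) =
      (LinearMap.mul' k H ∘ₗ (antipode k).lTensor H).lTensor H
        (TensorProduct.assoc k H H H (comul.rTensor H z)) := by
    intro z
    have : gal k H ∘ₗ (antipode k).lTensor H =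
        (LinearMap.mul' k H ∘ₗ (antipode k).lTensor H).lTensor H ∘ₗ
        (TensorProduct.assoc k H H H).toLinearMap ∘ₗ comul.rTensor H := by
      simp only [gal, coassoc_simps]
    exact LinearMap.congr_fun this z
  rw [h, coassoc_apply, ← LinearMap.lTensor_comp_apply, LinearMap.comp_assoc,
    mul_antipode_lTensor_comul, LinearMap.lTensor_comp_apply]
  simp

theorem galInv_gal (t : H ⊗[k] H) : galInv k H (gal k H t) = t := by
  induction t with
  | zero => simp
  | add a b ha hb => simp only [map_add, ha, hb]
  | tmul x y => simp [gal_tmul, galInv_mul_right, galInv_comul]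

theorem gal_galInv (t : H ⊗[k] H) : gal k H (galInv k H t) = t := by
  induction t with
  | zero => simp
  | add a b ha hb => simp only [map_add, ha, hb]
  | tmul x y => simp [galInv_tmul, gal_mul_right, gal_lTensor_antipode_comul]

variable (k H) in
/-- The map `x ⊗ y ↦ x y₁ ⊗ y₂`. -/
noncomputable def galLeft : H ⊗[k] H →ₗ[k] H ⊗[k] H :=
  (LinearMap.mul' k H).rTensor H ∘ₗ (TensorProduct.assoc k H H H).symm.toLinearMap ∘ₗ
    comul.lTensor H

variable (k H) in
/-- The map `x ⊗ y ↦ x S(y₁) ⊗ y₂`. -/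
noncomputable def galLeftInv : H ⊗[k] H →ₗ[k] H ⊗[k] H :=
  (LinearMap.mul' k H ∘ₗ (antipode k).lTensor H).rTensor H ∘ₗ
    (TensorProduct.assoc k H H H).symm.toLinearMap ∘ₗ comul.lTensor H

theorem galLeft_tmul (x y : H) : galLeft k H (x ⊗ₜ y) = (x ⊗ₜ 1) * comul y := by
  simp only [galLeft, LinearMap.comp_apply, LinearEquiv.coe_coe, LinearMap.lTensor_tmul]
  induction comul (R := k) y with
  | zero => simp
  | add a b ha hb => simp [TensorProduct.tmul_add, mul_add, ha, hb]
  | tmul a b => simp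

theorem galLeftInv_tmul (x y : H) :
    galLeftInv k H (x ⊗ₜ y) = (x ⊗ₜ 1) * (antipode k).rTensor H (comul y) := by
  simp only [galLeftInv, LinearMap.comp_apply, LinearEquiv.coe_coe, LinearMap.lTensor_tmul]
  induction comul (R := k) y with
  | zero => simp
  | add a b ha hb => simp [TensorProduct.tmul_add, mul_add, ha, hb]
  | tmul a b => simp

theorem galLeft_mul_left (x : H) (z : H ⊗[k] H) :
    galLeft k H ((x ⊗ₜ 1) * z) = (x ⊗ₜ 1) * galLeft k H z := by
  induction z with
  | zero => simp
  | add a b ha hb => simp only [mul_add, map_add, ha, hb]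
  | tmul a b => simp [galLeft_tmul, ← mul_assoc]

theorem galLeftInv_mul_left (x : H) (z : H ⊗[k] H) :
    galLeftInv k H ((x ⊗ₜ 1) * z) = (x ⊗ₜ 1) * galLeftInv k H z := by
  induction z with
  | zero => simp
  | add a b ha hb => simp only [mul_add, map_add, ha, hb]
  | tmul a b => simp [galLeftInv_tmul, ← mul_assoc]

theorem galLeftInv_comul (y : H) : galLeftInv k H (comul y) = 1 ⊗ₜ y := by
  simp only [galLeftInv, LinearMap.comp_apply, LinearEquiv.coe_coe, coassoc_symm_apply]
  rw [← LinearMap.rTensor_comp_apply, LinearMap.comp_assoc, mul_antipode_lTensor_comul,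
    LinearMap.rTensor_comp_apply]
  simp

theorem galLeft_rTensor_antipode_comul (y : H) :
    galLeft k H ((antipode k).rTensor H (comul y)) = 1 ⊗ₜ y := by
  have h : ∀ z : H ⊗[k] H, galLeft k H ((antipode k).rTensor H z) =
      (LinearMap.mul' k H ∘ₗ (antipode k).rTensor H).rTensor H
        ((TensorProduct.assoc k H H H).symm (comul.lTensor H z)) := by
    intro z
    have : galLeft k H ∘ₗ (antipode k).rTensor H =
        (LinearMap.mul' k H ∘ₗ (antipode k).rTensor H).rTensor H ∘ₗ
        (TensorProduct.assoc k H H H).symm.toLinearMap ∘ₗ comul.lTensor H := by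
      simp only [galLeft, coassoc_simps]
    exact LinearMap.congr_fun this z
  rw [h, coassoc_symm_apply, ← LinearMap.rTensor_comp_apply, LinearMap.comp_assoc,
    mul_antipode_rTensor_comul, LinearMap.rTensor_comp_apply]
  simp

theorem galLeftInv_galLeft (t : H ⊗[k] H) : galLeftInv k H (galLeft k H t) = t := by
  induction t with
  | zero => simp
  | add a b ha hb => simp only [map_add, ha, hb]
  | tmul x y => simp [galLeft_tmul, galLeftInv_mul_left, galLeftInv_comul]

end Sweedler

/-! ### Generators and relations of `N ⊗_A M`. -/

section TensorOver

variable {k : Type u} {A : Type v} [Field k] [Ring A]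
  {N : Type*} [AddCommGroup N] [Module k N] [Module Aᵐᵒᵖ N]
  {M : Type*} [AddCommGroup M] [Module k M] [Module A M]

variable (k A) in
/-- The class of `n ⊗ m` in `N ⊗_A M`. -/
def TensorOver.tmul (n : N) (m : M) : TensorOver k A N M :=
  (balancedRel k A N M).mkQ (n ⊗ₜ m)

theorem TensorOver.induction_on {P : TensorOver k A N M → Prop} (t : TensorOver k A N M)
    (tmul : ∀ n m, P (TensorOver.tmul k A n m)) (add : ∀ x y, P x → P y → P (x + y)) : P t := by
  obtain ⟨z, rfl⟩ := (balancedRel k A N M).mkQ_surjective t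
  induction z with
  | zero => simpa [TensorOver.tmul] using tmul 0 0
  | add a b ha hb => simpa using add _ _ ha hb
  | tmul n m => exact tmul n m

theorem TensorOver.smul_tmul (n : N) (a : A) (m : M) :
    TensorOver.tmul k A (MulOpposite.op a • n) m = TensorOver.tmul k A n (a • m) := by
  rw [← sub_eq_zero]
  unfold TensorOver.tmul
  rw [← map_sub, ← LinearMap.mem_ker, Submodule.ker_mkQ]
  exact Submodule.subset_span ⟨n, a, m, rfl⟩

@[simp]
theorem TensorOver.zero_tmul (m : M) : TensorOver.tmul k A (0 : N) m = 0 := by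
  simp [TensorOver.tmul]

theorem TensorOver.add_tmul (n n' : N) (m : M) :
    TensorOver.tmul k A (n + n') m = TensorOver.tmul k A n m + TensorOver.tmul k A n' m := by
  simp only [TensorOver.tmul, TensorProduct.add_tmul, map_add]

theorem TensorOver.sub_tmul (n n' : N) (m : M) :
    TensorOver.tmul k A (n - n') m = TensorOver.tmul k A n m - TensorOver.tmul k A n' m := by
  simp only [TensorOver.tmul, TensorProduct.sub_tmul, map_sub]

end TensorOver

/-! ### Consequences of, and a criterion for, faithful flatness. -/

section FaithfullyFlat

variable {k : Type u} {A : Type v} [Field k] [Ring A] [Algebra k A]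
  {M : Type v} [AddCommGroup M] [Module k M] [Module A M]

section

variable {N₁ N₂ N₃ : Type*} [AddCommGroup N₁] [Module k N₁] [Module Aᵐᵒᵖ N₁]
  [IsScalarTower k Aᵐᵒᵖ N₁] [AddCommGroup N₂] [Module k N₂] [Module Aᵐᵒᵖ N₂]
  [IsScalarTower k Aᵐᵒᵖ N₂] [AddCommGroup N₃] [Module k N₃] [Module Aᵐᵒᵖ N₃]
  [IsScalarTower k Aᵐᵒᵖ N₃]

@[simp]
theorem TensorOver.mapLeft_tmul {M : Type*} [AddCommGroup M] [Module k M] [Module A M]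
    (f : N₁ →ₗ[Aᵐᵒᵖ] N₂) (n : N₁) (m : M) :
    TensorOver.mapLeft k M f (TensorOver.tmul k A n m) = TensorOver.tmul k A (f n) m := rfl

theorem TensorOver.mapLeft_comp_apply {M : Type*} [AddCommGroup M] [Module k M] [Module A M]
    (g : N₂ →ₗ[Aᵐᵒᵖ] N₃) (f : N₁ →ₗ[Aᵐᵒᵖ] N₂) (t : TensorOver k A N₁ M) :
    TensorOver.mapLeft k M (g ∘ₗ f) t =
      TensorOver.mapLeft k M g (TensorOver.mapLeft k M f t) := by
  induction t using TensorOver.induction_on with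
  | tmul n m => rfl
  | add x y hx hy => simp only [map_add, hx, hy]

theorem TensorOver.mapLeft_zero {M : Type*} [AddCommGroup M] [Module k M] [Module A M]
    (t : TensorOver k A N₁ M) :
    TensorOver.mapLeft k M (0 : N₁ →ₗ[Aᵐᵒᵖ] N₂) t = 0 := by
  induction t using TensorOver.induction_on with
  | tmul n m => simp
  | add x y hx hy => simp only [map_add, hx, hy, add_zero]

end

variable {N₁ N₂ N₃ : Type v} [AddCommGroup N₁] [Module k N₁] [Module Aᵐᵒᵖ N₁]
  [IsScalarTower k Aᵐᵒᵖ N₁] [AddCommGroup N₂] [Module k N₂] [Module Aᵐᵒᵖ N₂]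
  [IsScalarTower k Aᵐᵒᵖ N₂] [AddCommGroup N₃] [Module k N₃] [Module Aᵐᵒᵖ N₃]
  [IsScalarTower k Aᵐᵒᵖ N₃]

theorem LeftFaithfullyFlat.subsingleton (hM : LeftFaithfullyFlat k A M)
    (h : ∀ (n : N₁) (m : M), TensorOver.tmul k A n m = 0) : Subsingleton N₁ := by
  by_contra hN
  rw [not_subsingleton_iff_nontrivial] at hN
  refine not_subsingleton_iff_nontrivial.2 (hM.nontrivial N₁ hN) ⟨fun x y => ?_⟩
  have h0 : ∀ t : TensorOver k A N₁ M, t = 0 := fun t => by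
    induction t using TensorOver.induction_on with
    | tmul n m => exact h n m
    | add x y hx hy => rw [hx, hy, add_zero]
  rw [h0 x, h0 y]

/-- This is exactness of the functor on `0 → N₁ → N₂`, with `PUnit` as the zero module. -/
theorem LeftFaithfullyFlat.mapLeft_injective (hM : LeftFaithfullyFlat k A M)
    (f : N₁ →ₗ[Aᵐᵒᵖ] N₂) (hf : Function.Injective f) :
    Function.Injective (TensorOver.mapLeft k M f) := by
  rw [injective_iff_map_eq_zero]
  intro t ht
  have h := hM.exact PUnit N₁ N₂ 0 f (by
    intro x
    rw [map_eq_zero_iff f hf]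
    simp [eq_comm])
  obtain ⟨s, rfl⟩ := (h t).1 ht
  exact TensorOver.mapLeft_zero s

/-- Tensoring with a faithfully flat module reflects exactness of complexes. -/
theorem LeftFaithfullyFlat.exact_of_exact (hM : LeftFaithfullyFlat k A M)
    (f : N₁ →ₗ[Aᵐᵒᵖ] N₂) (g : N₂ →ₗ[Aᵐᵒᵖ] N₃) (hfg : ∀ x, g (f x) = 0)
    (h : ∀ t, TensorOver.mapLeft k M g t = 0 → t ∈ Set.range (TensorOver.mapLeft k M f)) :
    Function.Exact f g := by
  -- The homology `Q = ker g / im f` is shown to vanish; by faithfulness it suffices that every `q ⊗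
  -- m` is zero.
  let Z := LinearMap.ker g
  let f' : N₁ →ₗ[Aᵐᵒᵖ] Z := f.codRestrict Z hfg
  let Q := Z ⧸ LinearMap.range f'
  have hsub : Subsingleton Q := by
    refine hM.subsingleton (k := k) fun q m => ?_
    obtain ⟨z, rfl⟩ := (LinearMap.range f').mkQ_surjective q
    obtain ⟨w, hw⟩ := h (TensorOver.tmul k A (z : N₂) m) (by
      rw [TensorOver.mapLeft_tmul, z.2, TensorOver.zero_tmul])
    -- The hypothesis provides a preimage only up to equality in `N₂ ⊗_A M`; injectivity of `Z ⊗_A M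
    -- → N₂ ⊗_A M` brings the equality down to `Z ⊗_A M`.
    have h1 : TensorOver.mapLeft k M f' w = TensorOver.tmul k A z m := by
      apply hM.mapLeft_injective Z.subtype Z.injective_subtype
      rw [← TensorOver.mapLeft_comp_apply]
      exact hw
    have h2 := congrArg (TensorOver.mapLeft k M (LinearMap.range f').mkQ) h1
    rw [← TensorOver.mapLeft_comp_apply, LinearMap.range_mkQ_comp,
      TensorOver.mapLeft_zero, TensorOver.mapLeft_tmul] at h2
    exact h2.symm
  intro y
  refine ⟨fun hy => ?_, ?_⟩
  · have : (LinearMap.range f').mkQ ⟨y, hy⟩ = 0 := Subsingleton.elim _ _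
    rw [← LinearMap.mem_ker, Submodule.ker_mkQ] at this
    obtain ⟨x, hx⟩ := this
    exact ⟨x, congrArg Subtype.val hx⟩
  · rintro ⟨x, rfl⟩
    exact hfg x

/-- Right exactness of `- ⊗_A M`, deduced from that of `- ⊗ M` over `k`: as `g` is onto, every
balancing relation on `N₃` lifts to one on `N₂`. -/
theorem TensorOver.mapLeft_exact_of_surjective (f : N₁ →ₗ[Aᵐᵒᵖ] N₂) (g : N₂ →ₗ[Aᵐᵒᵖ] N₃)
    (hfg : Function.Exact f g) (hg : Function.Surjective g) (t : TensorOver k A N₂ M)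
    (ht : TensorOver.mapLeft k M g t = 0) : t ∈ Set.range (TensorOver.mapLeft k M f) := by
  obtain ⟨s, rfl⟩ := (balancedRel k A N₂ M).mkQ_surjective t
  have h1 : (g.restrictScalars k).rTensor M s ∈ balancedRel k A N₃ M := by
    rw [← Submodule.ker_mkQ (balancedRel k A N₃ M)]
    exact ht
  have h2 : balancedRel k A N₃ M ≤
      (balancedRel k A N₂ M).map ((g.restrictScalars k).rTensor M) := by
    refine Submodule.span_le.2 ?_
    rintro _ ⟨n, a, m, rfl⟩
    obtain ⟨n, rfl⟩ := hg n
    exact ⟨_, Submodule.subset_span ⟨n, a, m, rfl⟩, by simp⟩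
  obtain ⟨b, hb, hbs⟩ := h2 h1
  obtain ⟨r, hr⟩ := (rTensor_exact (R := k) M (f := f.restrictScalars k)
    (g := g.restrictScalars k) hfg hg (s - b)).1 (by rw [map_sub, hbs, sub_self])
  refine ⟨(balancedRel k A N₁ M).mkQ r, ?_⟩
  change (balancedRel k A N₂ M).mkQ ((f.restrictScalars k).rTensor M r) = _
  rw [hr, map_sub, sub_eq_self, ← LinearMap.mem_ker, Submodule.ker_mkQ]
  exact hb

/-- A module is faithfully flat if tensoring with it preserves injections and reflects
triviality. -/
theorem LeftFaithfullyFlat.of_injective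
    (hinj : ∀ (N N' : Type v) [AddCommGroup N] [Module k N] [Module Aᵐᵒᵖ N]
      [IsScalarTower k Aᵐᵒᵖ N] [AddCommGroup N'] [Module k N'] [Module Aᵐᵒᵖ N']
      [IsScalarTower k Aᵐᵒᵖ N'] (f : N →ₗ[Aᵐᵒᵖ] N'), Function.Injective f →
      Function.Injective (TensorOver.mapLeft k M f))
    (hsub : ∀ (N : Type v) [AddCommGroup N] [Module k N] [Module Aᵐᵒᵖ N]
      [IsScalarTower k Aᵐᵒᵖ N], Subsingleton (TensorOver k A N M) → Subsingleton N) :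
    LeftFaithfullyFlat k A M where
  exact N₁ N₂ N₃ _ _ _ _ _ _ _ _ _ _ _ _ f g hfg := by
    intro t
    constructor
    · intro ht
      -- Factor `g` through its range: right exactness handles the surjection onto the range, and
      -- `hinj` handles the inclusion of the range into `N₃`.
      refine TensorOver.mapLeft_exact_of_surjective f g.rangeRestrict (fun x => ?_)
        g.surjective_rangeRestrict t ?_
      · rw [← hfg x, ← Subtype.val_inj]
        rfl
      · apply hinj _ _ (LinearMap.range g).subtype (Submodule.injective_subtype _)
        rw [← TensorOver.mapLeft_comp_apply, map_zero]
        exact ht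
    · rintro ⟨s, rfl⟩
      rw [← TensorOver.mapLeft_comp_apply, hfg.linearMap_comp_eq_zero, TensorOver.mapLeft_zero]
  nontrivial N _ _ _ _ hN := by
    by_contra h
    rw [not_nontrivial_iff_subsingleton] at h
    exact not_subsingleton_iff_nontrivial.2 hN (hsub N h)

end FaithfullyFlat

/-! ### The Galois map and its kernel. -/

section Galois

variable {k : Type u} {H : Type v} [Field k] [Ring H] [HopfAlgebra k H]

namespace LeftModuleFactorCoalgebra

variable (C : LeftModuleFactorCoalgebra k H)

/-- The canonical surjection `H → H ⧸ I` as a linear map. -/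
abbrev mkQ : H →ₗ[k] C.Quot := (C.ker.restrictScalars k).mkQ

theorem mem_coinvariants {a : H} :
    a ∈ C.coinvariants.carrier ↔ C.mkQ.rTensor H (comul a) = C.mkQ 1 ⊗ₜ[k] a := Iff.rfl

theorem leftComodule_coact_apply (x : H) :
    C.leftComodule.coact x = C.mkQ.rTensor H (comul x) := rfl

theorem rightComodule_coact_apply (x : H) :
    C.rightComodule.coact x = C.mkQ.lTensor H (comul x) := rfl

theorem comul_mkQ (x : H) :
    comul (R := k) (C.mkQ x) = TensorProduct.map C.mkQ C.mkQ (comul x) := rfl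

theorem mkQ_eq_zero {x : H} : C.mkQ x = 0 ↔ x ∈ C.ker := by
  rw [← LinearMap.mem_ker, Submodule.ker_mkQ, Submodule.restrictScalars_mem]

/-- The left action of `h` on `C`. -/
noncomputable def lsmul (h : H) : C.Quot →ₗ[k] C.Quot :=
  Submodule.mapQ _ _ (LinearMap.mulLeft k h) fun _ hx => C.ker.mul_mem_left h hx

@[simp]
theorem lsmul_mkQ (h x : H) : C.lsmul h (C.mkQ x) = C.mkQ (h * x) := rfl

/-- The kernel of `π ⊗ id` is `I ⊗ H`, a left ideal of `H ⊗ H` because `I` is a left ideal of `H`.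
-/
theorem rTensor_mkQ_mul (z w : H ⊗[k] H) (hw : C.mkQ.rTensor H w = 0) :
    C.mkQ.rTensor H (z * w) = 0 := by
  have h := mul_mem_range_rTensor C.ker z w
    ((rTensor_exact H (LinearMap.exact_subtype_mkQ _) (Submodule.mkQ_surjective _) _).1 hw)
  exact (rTensor_exact H (LinearMap.exact_subtype_mkQ _) (Submodule.mkQ_surjective _) _).2 h

theorem lTensor_mkQ_mul (z w : H ⊗[k] H) (hw : C.mkQ.lTensor H w = 0) :
    C.mkQ.lTensor H (z * w) = 0 := by
  have h := mul_mem_range_lTensor C.ker z w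
    ((lTensor_exact H (LinearMap.exact_subtype_mkQ _) (Submodule.mkQ_surjective _) _).1 hw)
  exact (lTensor_exact H (LinearMap.exact_subtype_mkQ _) (Submodule.mkQ_surjective _) _).2 h

theorem rTensor_mkQ_mul_tmul (z : H ⊗[k] H) (y : H) :
    C.mkQ.rTensor H (z * (1 ⊗ₜ y)) = (LinearMap.mulRight k y).lTensor _ (C.mkQ.rTensor H z) := by
  induction z with
  | zero => simp
  | add a b ha hb => simp only [add_mul, map_add, ha, hb]
  | tmul a b => simp

/-- For coinvariant `a`, the comultiplication of `x a` agrees modulo `I ⊗ H` with `x₁ ⊗ x₂ a`. -/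
theorem rTensor_mkQ_comul_mul (z : H ⊗[k] H) {a : H} (ha : a ∈ C.coinvariants.carrier) :
    C.mkQ.rTensor H (z * comul a) = C.mkQ.rTensor H (z * (1 ⊗ₜ a)) := by
  rw [← sub_eq_zero, ← map_sub, ← mul_sub]
  apply C.rTensor_mkQ_mul
  rw [map_sub, C.mem_coinvariants.1 ha, LinearMap.rTensor_tmul, sub_self]

/-- The Galois map `x ⊗ y ↦ π(x₁) ⊗ x₂ y`. -/
noncomputable def galois : H ⊗[k] H →ₗ[k] C.Quot ⊗[k] H := C.mkQ.rTensor H ∘ₗ gal k H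

theorem galois_surjective : Function.Surjective C.galois :=
  (LinearMap.rTensor_surjective H (Submodule.mkQ_surjective _)).comp
    (Function.RightInverse.surjective gal_galInv)

theorem galois_tmul (x y : H) : C.galois (x ⊗ₜ y) =
    (LinearMap.mulRight k y).lTensor _ (C.leftComodule.coact x) := by
  rw [galois, LinearMap.comp_apply, gal_tmul, rTensor_mkQ_mul_tmul, leftComodule_coact_apply]

/-- Modulo `I ⊗ H`, `Δ(xa)` is `x₁ ⊗ x₂a`. Hence the Galois map factors through the tensor product
over the coinvariants. -/
theorem galois_mul_tmul (x : H) {a : H} (ha : a ∈ C.coinvariants.carrier) (y : H) :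
    C.galois ((x * a) ⊗ₜ y) = C.galois (x ⊗ₜ (a * y)) := by
  simp only [galois, LinearMap.comp_apply, gal_tmul, Bialgebra.comul_mul]
  rw [rTensor_mkQ_mul_tmul, rTensor_mkQ_comul_mul C _ ha, ← rTensor_mkQ_mul_tmul, mul_assoc,
    Algebra.TensorProduct.tmul_mul_tmul, one_mul]

theorem galois_coinvariant_tmul {a : H} (ha : a ∈ C.coinvariants.carrier) (y : H) :
    C.galois (a ⊗ₜ y) = C.galois (1 ⊗ₜ (a * y)) := by
  rw [← galois_mul_tmul C 1 ha, one_mul]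

end LeftModuleFactorCoalgebra

namespace RightCoidealSubalgebra

variable (A : RightCoidealSubalgebra k H)

/-- `Δ(a) ∈ A ⊗ H` in a form suited to induction. -/
theorem comul_mem_span {a : H} (ha : a ∈ A.carrier) :
    comul (R := k) a ∈ Submodule.span k {t : H ⊗[k] H | ∃ b ∈ A.carrier, ∃ h, t = b ⊗ₜ h} := by
  obtain ⟨z, hz⟩ := A.comul_mem a ha
  rw [← hz]
  clear hz
  induction z with
  | zero => simp
  | add a b ha hb => rw [map_add]; exact add_mem ha hb
  | tmul b h => exact Submodule.subset_span ⟨b, b.2, h, rfl⟩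

theorem sub_counit_mem {a : H} (ha : a ∈ A.carrier) :
    a - algebraMap k H (counit a) ∈ A.factor.ker :=
  Ideal.subset_span ⟨A.carrier.sub_mem ha (A.carrier.algebraMap_mem _), by simp⟩

theorem mkQ_factor {a : H} (ha : a ∈ A.carrier) :
    A.factor.mkQ a = counit (R := k) a • A.factor.mkQ 1 := by
  rw [← sub_eq_zero, ← map_smul, ← map_sub, LeftModuleFactorCoalgebra.mkQ_eq_zero,
    ← Algebra.algebraMap_eq_smul_one]
  exact A.sub_counit_mem ha

/-- The first leg of `Δ(a)` lies in `A`, where `π` is `ε` times `π(1)`; the counit axiom then gives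
`π(1) ⊗ a`. -/
theorem mem_coinvariants_factor {a : H} (ha : a ∈ A.carrier) :
    a ∈ A.factor.coinvariants.carrier := by
  rw [LeftModuleFactorCoalgebra.mem_coinvariants]
  have key : ∀ z ∈ Submodule.span k {t : H ⊗[k] H | ∃ b ∈ A.carrier, ∃ h, t = b ⊗ₜ h},
      A.factor.mkQ.rTensor H z =
        A.factor.mkQ 1 ⊗ₜ TensorProduct.lid k H ((counit (R := k) (A := H)).rTensor H z) := by
    intro z hz
    induction hz using Submodule.span_induction with
    | zero => simp
    | add x y _ _ hx hy => simp only [map_add, hx, hy, tmul_add]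
    | smul c x _ hx => simp only [map_smul, hx, tmul_smul]
    | mem x hx =>
      obtain ⟨b, hb, h, rfl⟩ := hx
      rw [LinearMap.rTensor_tmul, A.mkQ_factor hb]
      simp [smul_tmul]
  rw [key _ (A.comul_mem_span ha)]
  simp

/-- The relations defining `H ⊗_A H`. -/
def relations : Submodule k (H ⊗[k] H) :=
  Submodule.span k {t | ∃ (x : H) (a : A.carrier) (y : H),
    t = (x * (a : H)) ⊗ₜ y - x ⊗ₜ ((a : H) * y)}

theorem mul_tmul_sub_mem_relations (x : H) {a : H} (ha : a ∈ A.carrier) (y : H) :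
    (x * a) ⊗ₜ y - x ⊗ₜ (a * y) ∈ A.relations :=
  Submodule.subset_span ⟨x, ⟨a, ha⟩, y, rfl⟩

theorem mul_mem_relations (x : H) {t : H ⊗[k] H} (ht : t ∈ A.relations) :
    (x ⊗ₜ 1) * t ∈ A.relations := by
  induction ht using Submodule.span_induction with
  | zero => simp
  | add x y _ _ hx hy => rw [mul_add]; exact add_mem hx hy
  | smul c x _ hx => rw [mul_smul_comm]; exact A.relations.smul_mem c hx
  | mem t ht =>
    obtain ⟨x', a, y, rfl⟩ := ht
    simpa [mul_sub, mul_assoc] using A.mul_tmul_sub_mem_relations (x * x') a.2 y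

/-- For `a ∈ A⁺`, moving `a₁` across the tensor sign turns `a₁ ⊗ S(a₂)y` into `1 ⊗ a₁S(a₂)y = ε(a) 1
⊗ y = 0`. A left multiple `cx` reduces to `x`, since its image is `(c₁ ⊗ 1)` times the image of `x ⊗
S(c₂)y`. -/
theorem galInv_mem_relations {z : H} (hz : z ∈ A.factor.ker) (y : H) :
    galInv k H (z ⊗ₜ y) ∈ A.relations := by
  change z ∈ Ideal.span _ at hz
  induction hz using Submodule.span_induction generalizing y with
  | zero => simp
  | add x x' _ _ hx hx' => rw [add_tmul, map_add]; exact add_mem (hx y) (hx' y)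
  | smul c x _ hx =>
    rw [galInv_tmul, smul_eq_mul, Bialgebra.comul_mul]
    have h : ∀ z w : H ⊗[k] H, (∀ y, (antipode k).lTensor H w * (1 ⊗ₜ y) ∈ A.relations) →
        (antipode k).lTensor H (z * w) * (1 ⊗ₜ[k] y) ∈ A.relations := by
      intro z w hw
      induction z with
      | zero => simp
      | add a b ha hb => simp only [add_mul, map_add]; exact add_mem ha hb
      | tmul a b =>
        have e : (antipode k).lTensor H ((a ⊗ₜ[k] b) * w) * (1 ⊗ₜ[k] y) =
            (a ⊗ₜ 1) * ((antipode k).lTensor H w * (1 ⊗ₜ (antipode k b * y))) := by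
          clear hw
          induction w with
          | zero => simp
          | add u v hu hv => simp only [mul_add, add_mul, map_add, hu, hv]
          | tmul u v => simp [antipode_mul_antidistrib, mul_assoc]
        rw [e]
        exact A.mul_mem_relations a (hw _)
    refine h _ _ fun y' => ?_
    rw [← galInv_tmul]
    exact hx y'
  | mem a ha =>
    have key : ∀ z ∈ Submodule.span k {t : H ⊗[k] H | ∃ b ∈ A.carrier, ∃ h, t = b ⊗ₜ h},
        (antipode k).lTensor H z * (1 ⊗ₜ y) -
          1 ⊗ₜ (LinearMap.mul' k H ((antipode k).lTensor H z) * y) ∈ A.relations := by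
      intro z hz
      induction hz using Submodule.span_induction with
      | zero => simp
      | add x y _ _ hx hy =>
        simp only [map_add, add_mul, tmul_add]
        rw [add_sub_add_comm]
        exact add_mem hx hy
      | smul c x _ hx =>
        simp only [map_smul, smul_mul_assoc, tmul_smul, ← smul_sub]
        exact A.relations.smul_mem c hx
      | mem x hx =>
        obtain ⟨b, hb, h, rfl⟩ := hx
        simpa [mul_assoc] using A.mul_tmul_sub_mem_relations 1 hb (antipode k h * y)
    have := key _ (A.comul_mem_span ha.1)
    rwa [mul_antipode_lTensor_comul_apply, ha.2, map_zero, zero_mul, tmul_zero, sub_zero,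
      ← galInv_tmul] at this

/-- The Galois map is the bijection `gal` followed by `π ⊗ id`, so its kernel is the image of `HA⁺ ⊗
H` under `galInv`. Together with `galois_eq_zero_of_mem_relations` and `galois_surjective` this is
the isomorphism `H ⊗_A H ≅ C ⊗ H`. -/
theorem mem_relations_of_galois_eq_zero {t : H ⊗[k] H} (ht : A.factor.galois t = 0) :
    t ∈ A.relations := by
  obtain ⟨s, hs⟩ :=
    (rTensor_exact H (LinearMap.exact_subtype_mkQ _) (Submodule.mkQ_surjective _) _).1 ht
  rw [← galInv_gal t, ← hs]
  clear hs
  induction s with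
  | zero => simp
  | add a b ha hb => simp only [map_add]; exact add_mem ha hb
  | tmul z y => exact A.galInv_mem_relations z.2 y

theorem galois_eq_zero_of_mem_relations {t : H ⊗[k] H} (ht : t ∈ A.relations) :
    A.factor.galois t = 0 := by
  induction ht using Submodule.span_induction with
  | zero => simp
  | add x y _ _ hx hy => rw [map_add, hx, hy, add_zero]
  | smul c x _ hx => rw [map_smul, hx, smul_zero]
  | mem t ht =>
    obtain ⟨x, a, y, rfl⟩ := ht
    rw [map_sub, LeftModuleFactorCoalgebra.galois_mul_tmul _ _ (A.mem_coinvariants_factor a.2),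
      sub_self]

end RightCoidealSubalgebra

end Galois

/-! ### Recovering `A` from `H/HA⁺`, and the Galois isomorphism with coefficients. -/

section Descent

variable {k : Type u} {H : Type v} [Field k] [Ring H] [HopfAlgebra k H]

namespace RightCoidealSubalgebra

variable (A : RightCoidealSubalgebra k H)

/-- A faithfully flat right coideal subalgebra is recovered as the coinvariants of its factor
coalgebra. -/
theorem coinvariants_factor (hA : A.IsLeftFaithfullyFlat) : A.factor.coinvariants = A := by
  ext b
  refine ⟨fun hb => ?_, A.mem_coinvariants_factor⟩
  let _ := A.rightModule
  have smul_def : ∀ (a : A.carrier) (h : H), MulOpposite.op a • h = h * (a : H) :=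
    fun _ _ => rfl
  have : IsScalarTower k (A.carrier)ᵐᵒᵖ H := ⟨fun c a h => by
    obtain ⟨a, rfl⟩ := MulOpposite.op_surjective a
    rw [← MulOpposite.op_smul, smul_def, smul_def]
    simp⟩
  let A' : Submodule (A.carrier)ᵐᵒᵖ H :=
    { carrier := A.carrier
      add_mem' := A.carrier.add_mem
      zero_mem' := A.carrier.zero_mem
      smul_mem' := fun a x hx => A.carrier.mul_mem hx a.unop.2 }
  -- Only the class of `b` will be seen to die in `(H/A) ⊗_A H`, so faithfulness is applied to the
  -- cyclic submodule that it generates.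
  let N : Submodule (A.carrier)ᵐᵒᵖ (H ⧸ A') := Submodule.span _ {A'.mkQ b}
  have hrel : ∀ t ∈ A.relations,
      (balancedRel k A.carrier (H ⧸ A') H).mkQ
        ((A'.mkQ.restrictScalars k).rTensor H t) = 0 := by
    intro t ht
    induction ht using Submodule.span_induction with
    | zero => simp
    | add x y _ _ hx hy => simp only [map_add, hx, hy, add_zero]
    | smul c x _ hx => simp only [map_smul, hx, smul_zero]
    | mem t ht =>
      obtain ⟨x, a, y, rfl⟩ := ht
      rw [map_sub, map_sub, sub_eq_zero]
      exact TensorOver.smul_tmul (k := k) (A'.mkQ x) a y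
  have hb0 : ∀ h : H, TensorOver.tmul k A.carrier (A'.mkQ b) h = 0 := by
    intro h
    -- The Galois map cannot distinguish `b ⊗ h` from `1 ⊗ bh` when `b` is coinvariant, so they
    -- agree in `H ⊗_A H`; in `(H/A) ⊗_A H` the second one is zero.
    have h1 := hrel (b ⊗ₜ h - 1 ⊗ₜ (b * h)) (A.mem_relations_of_galois_eq_zero (by
      rw [map_sub, LeftModuleFactorCoalgebra.galois_coinvariant_tmul _ hb, sub_self]))
    rw [map_sub, map_sub, sub_eq_zero] at h1
    have h2 : A'.mkQ (1 : H) = 0 := by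
      rw [← LinearMap.mem_ker, Submodule.ker_mkQ]
      exact A.carrier.one_mem
    refine h1.trans ?_
    rw [LinearMap.rTensor_tmul, LinearMap.restrictScalars_apply, h2, zero_tmul, map_zero]
  have hN : Subsingleton N := by
    refine LeftFaithfullyFlat.subsingleton (k := k) hA fun n h => ?_
    -- Flatness embeds `N ⊗_A H` into `(H/A) ⊗_A H`, where the vanishing is known.
    apply LeftFaithfullyFlat.mapLeft_injective hA N.subtype N.injective_subtype
    obtain ⟨a, ha⟩ := Submodule.mem_span_singleton.1 n.2
    obtain ⟨a, rfl⟩ := MulOpposite.op_surjective a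
    rw [TensorOver.mapLeft_tmul, map_zero, Submodule.subtype_apply, ← ha, TensorOver.smul_tmul, hb0]
  have h3 : (⟨A'.mkQ b, Submodule.mem_span_singleton_self _⟩ : N) = 0 := Subsingleton.elim _ _
  have h4 : A'.mkQ b = 0 := congrArg Subtype.val h3
  rw [← LinearMap.mem_ker, Submodule.ker_mkQ] at h4
  exact h4

/-- The right `A`-module structure on `V ⊗ H` given by multiplication in `H`. -/
noncomputable instance tensorRightModule (V : Type*) [AddCommGroup V] [Module k V] :
    Module (A.carrier)ᵐᵒᵖ (V ⊗[k] H) :=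
  Module.compHom (V ⊗[k] H)
    (R := Module.End k (V ⊗[k] H))
    { toFun := fun a => (LinearMap.mulRight k (a.unop : H)).lTensor V
      map_one' := by ext; simp
      map_mul' := fun a b => by ext; simp [mul_assoc]
      map_zero' := by ext; simp
      map_add' := fun a b => by ext; simp [mul_add, tmul_add] }

variable {V : Type v} [AddCommGroup V] [Module k V] {W : Type v} [AddCommGroup W] [Module k W]

theorem op_smul_def (a : A.carrier) (t : V ⊗[k] H) :
    MulOpposite.op a • t = (LinearMap.mulRight k (a : H)).lTensor V t := rfl

instance : IsScalarTower k (A.carrier)ᵐᵒᵖ (V ⊗[k] H) := ⟨fun c a t => by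
  obtain ⟨a, rfl⟩ := MulOpposite.op_surjective a
  rw [← MulOpposite.op_smul, op_smul_def, op_smul_def]
  induction t with
  | zero => simp
  | add x y hx hy => simp only [map_add, hx, hy, smul_add]
  | tmul v h => simp⟩

/-- Linear maps commuting with right multiplication on `H` are `A`-linear. -/
def tensorLinear (f : V ⊗[k] H →ₗ[k] W ⊗[k] H)
    (hf : ∀ v x, ∀ a ∈ A.carrier, f (v ⊗ₜ (x * a)) =
      (LinearMap.mulRight k a).lTensor W (f (v ⊗ₜ x))) :
    V ⊗[k] H →ₗ[(A.carrier)ᵐᵒᵖ] W ⊗[k] H where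
  toFun := f
  map_add' := f.map_add
  map_smul' := fun a t => by
    obtain ⟨a, rfl⟩ := MulOpposite.op_surjective a
    rw [op_smul_def, RingHom.id_apply, op_smul_def]
    induction t with
    | zero => simp
    | add x y hx hy => simp only [map_add, hx, hy]
    | tmul v x => exact hf v x a a.2

variable (V) in
/-- The map `(V ⊗ H) ⊗_A H → V ⊗ H` given by multiplication. -/
noncomputable def tensorMul : TensorOver k A.carrier (V ⊗[k] H) H →ₗ[k] V ⊗[k] H :=
  Submodule.liftQ _ ((LinearMap.mul' k H).lTensor V ∘ₗ (TensorProduct.assoc k V H H).toLinearMap)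
    (by
      refine Submodule.span_le.2 ?_
      rintro _ ⟨t, a, y, rfl⟩
      rw [SetLike.mem_coe, LinearMap.mem_ker, map_sub, sub_eq_zero, op_smul_def]
      induction t with
      | zero => simp
      | add s t hs ht => simp only [map_add, add_tmul, hs, ht]
      | tmul v x => simp [mul_assoc, Subalgebra.smul_def])

theorem tensorMul_tmul (t : V ⊗[k] H) (y : H) :
    A.tensorMul V (TensorOver.tmul k A.carrier t y) = (LinearMap.mulRight k y).lTensor V t := by
  change (LinearMap.mul' k H).lTensor V (TensorProduct.assoc k V H H (t ⊗ₜ y)) = _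
  induction t with
  | zero => simp
  | add s t hs ht => simp only [map_add, add_tmul, hs, ht]
  | tmul v x => simp

variable (V) in
/-- The Galois map `(V ⊗ H) ⊗_A H → V ⊗ (C ⊗ H)`. -/
noncomputable def tensorGalois :
    TensorOver k A.carrier (V ⊗[k] H) H →ₗ[k] V ⊗[k] (A.factor.Quot ⊗[k] H) :=
  Submodule.liftQ _ (A.factor.galois.lTensor V ∘ₗ (TensorProduct.assoc k V H H).toLinearMap)
    (by
      refine Submodule.span_le.2 ?_
      rintro _ ⟨t, a, y, rfl⟩
      rw [SetLike.mem_coe, LinearMap.mem_ker, map_sub, sub_eq_zero, op_smul_def]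
      induction t with
      | zero => simp
      | add s t hs ht => simp only [map_add, add_tmul, hs, ht]
      | tmul v x =>
        simp [Subalgebra.smul_def,
          A.factor.galois_mul_tmul x (A.mem_coinvariants_factor a.2) y])

theorem tensorGalois_tmul_tmul (v : V) (x y : H) :
    A.tensorGalois V (TensorOver.tmul k A.carrier (v ⊗ₜ x) y) = v ⊗ₜ A.factor.galois (x ⊗ₜ y) :=
  rfl

theorem tensorGalois_tmul (t : V ⊗[k] H) (y : H) :
    A.tensorGalois V (TensorOver.tmul k A.carrier t y) =
      ((LinearMap.mulRight k y).lTensor _).lTensor V (A.factor.leftComodule.coact.lTensor V t) := by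
  induction t with
  | zero => simp
  | add s t hs ht =>
    rw [TensorOver.add_tmul]
    simp only [map_add, hs, ht]
  | tmul v x =>
    rw [tensorGalois_tmul_tmul, LeftModuleFactorCoalgebra.galois_tmul]
    rfl

/-- Tensoring over a field with `V` preserves the kernel of the Galois map, and `V ⊗ relations`
consists of balancing relations for `V ⊗ H`. -/
theorem tensorGalois_injective : Function.Injective (A.tensorGalois V) := by
  rw [injective_iff_map_eq_zero]
  intro t ht
  obtain ⟨z, rfl⟩ := (balancedRel k A.carrier (V ⊗[k] H) H).mkQ_surjective t
  have hex : Function.Exact A.relations.subtype A.factor.galois := fun x => by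
    refine ⟨fun hx => ⟨⟨x, A.mem_relations_of_galois_eq_zero hx⟩, rfl⟩, ?_⟩
    rintro ⟨x, rfl⟩
    exact A.galois_eq_zero_of_mem_relations x.2
  obtain ⟨s, hs⟩ := (Module.Flat.lTensor_exact (R := k) V hex _).1 ht
  replace hs := congrArg (TensorProduct.assoc k V H H).symm hs
  rw [LinearEquiv.coe_coe, LinearEquiv.symm_apply_apply] at hs
  rw [← LinearMap.mem_ker, Submodule.ker_mkQ, ← hs]
  clear hs ht
  induction s with
  | zero => simp
  | add a b ha hb => simp only [map_add]; exact add_mem ha hb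
  | tmul v r =>
    obtain ⟨r, hr⟩ := r
    rw [LinearMap.lTensor_tmul, Submodule.subtype_apply]
    change (TensorProduct.assoc k V H H).symm (v ⊗ₜ r) ∈ _
    induction hr using Submodule.span_induction with
    | zero => simp
    | add x y _ _ hx hy => rw [tmul_add, map_add]; exact add_mem hx hy
    | smul c x _ hx => rw [tmul_smul, map_smul]; exact Submodule.smul_mem _ c hx
    | mem r hr =>
      obtain ⟨x, a, y, rfl⟩ := hr
      rw [tmul_sub, map_sub]
      exact Submodule.subset_span ⟨v ⊗ₜ x, a, y, by simp [op_smul_def, Subalgebra.smul_def]⟩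

theorem tensorGalois_surjective : Function.Surjective (A.tensorGalois V) := by
  intro z
  obtain ⟨s, rfl⟩ := LinearMap.lTensor_surjective V A.factor.galois_surjective z
  refine ⟨(balancedRel k A.carrier (V ⊗[k] H) H).mkQ ((TensorProduct.assoc k V H H).symm s), ?_⟩
  change A.factor.galois.lTensor V
    (TensorProduct.assoc k V H H ((TensorProduct.assoc k V H H).symm s)) = _
  rw [LinearEquiv.apply_symm_apply]

end RightCoidealSubalgebra

end Descent

/-! ### The isomorphism `(V □_C H) ⊗_A H ≅ V ⊗ H` and faithful coflatness. -/

section Coflat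

variable {k : Type u} {H : Type v} [Field k] [Ring H] [HopfAlgebra k H]

namespace LeftModuleFactorCoalgebra

variable (C : LeftModuleFactorCoalgebra k H)

/-- The coaction on `H` is linear for right multiplication by coinvariants. This is what makes `V
□_C H` a right `A`-submodule of `V ⊗ H`. -/
theorem coact_mul_coinvariant (x : H) {a : H} (ha : a ∈ C.coinvariants.carrier) :
    C.leftComodule.coact (x * a) =
      (LinearMap.mulRight k a).lTensor _ (C.leftComodule.coact x) := by
  rw [leftComodule_coact_apply, Bialgebra.comul_mul, rTensor_mkQ_comul_mul C _ ha,
    rTensor_mkQ_mul_tmul, leftComodule_coact_apply]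

/-- The Galois map is colinear. -/
theorem galois_colinear (x y : H) :
    (C.galois ∘ₗ (TensorProduct.mk k H H).flip y).lTensor C.Quot (C.leftComodule.coact x) =
      TensorProduct.assoc k _ _ _ (comul.rTensor H (C.galois (x ⊗ₜ y))) := by
  have h1 : C.galois ∘ₗ (TensorProduct.mk k H H).flip y =
      (LinearMap.mulRight k y).lTensor _ ∘ₗ C.leftComodule.coact := by
    ext x
    exact C.galois_tmul x y
  have h2 := LinearMap.congr_fun C.leftComodule.coassoc x
  simp only [LinearMap.comp_apply, LinearEquiv.coe_coe] at h2
  rw [h1, LinearMap.lTensor_comp_apply, ← h2, C.galois_tmul]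
  generalize C.leftComodule.coact x = z
  induction z with
  | zero => simp
  | add a b ha hb => simp only [map_add, ha, hb]
  | tmul c h =>
    simp only [LinearMap.rTensor_tmul, LinearMap.lTensor_tmul]
    induction comul (R := k) c with
    | zero => simp
    | add a b ha hb => simp only [map_add, add_tmul, ha, hb]
    | tmul a b => simp

end LeftModuleFactorCoalgebra

namespace RightCoidealSubalgebra

variable (A : RightCoidealSubalgebra k H)

variable {V : Type v} [AddCommGroup V] [Module k V] {W : Type v} [AddCommGroup W] [Module k W]
  (ρ : RightComodule k A.factor.Quot V) (σ : RightComodule k A.factor.Quot W)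

/-- The map `ρ ⊗ id` as an `A`-linear map. -/
noncomputable def coactLeft : V ⊗[k] H →ₗ[(A.carrier)ᵐᵒᵖ] (V ⊗[k] A.factor.Quot) ⊗[k] H :=
  A.tensorLinear (ρ.coact.rTensor H) fun v x a _ => by simp

variable (V) in
/-- The map `id ⊗ τ` as an `A`-linear map, where `τ` is the coaction of `C` on `H`. -/
noncomputable def coactRight : V ⊗[k] H →ₗ[(A.carrier)ᵐᵒᵖ] (V ⊗[k] A.factor.Quot) ⊗[k] H :=
  A.tensorLinear ((TensorProduct.assoc k V A.factor.Quot H).symm.toLinearMap ∘ₗ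
    A.factor.leftComodule.coact.lTensor V) fun v x a ha => by
      simp only [LinearMap.comp_apply, LinearMap.lTensor_tmul, LinearEquiv.coe_coe,
        A.factor.coact_mul_coinvariant x (A.mem_coinvariants_factor ha)]
      induction A.factor.leftComodule.coact x with
      | zero => simp
      | add a b ha hb => simp only [map_add, tmul_add, ha, hb]
      | tmul c h => simp

/-- The cotensor product `V □_C H` as a right `A`-submodule of `V ⊗ H`. -/
noncomputable def cotensorSub : Submodule (A.carrier)ᵐᵒᵖ (V ⊗[k] H) :=
  LinearMap.ker (A.coactLeft ρ - A.coactRight V)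

theorem mem_cotensorSub_iff (t : V ⊗[k] H) :
    t ∈ A.cotensorSub ρ ↔ t ∈ cotensor ρ A.factor.leftComodule := by
  rw [cotensorSub, LinearMap.mem_ker, LinearMap.sub_apply, sub_eq_zero]
  change ρ.coact.rTensor H t = (TensorProduct.assoc k V A.factor.Quot H).symm
    (A.factor.leftComodule.coact.lTensor V t) ↔
    TensorProduct.assoc k V A.factor.Quot H (ρ.coact.rTensor H t) =
      A.factor.leftComodule.coact.lTensor V t
  rw [LinearEquiv.eq_symm_apply]

/-- The map `(V □_C H) ⊗_A H → V ⊗ H`. -/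
noncomputable def cotensorMul : TensorOver k A.carrier (A.cotensorSub ρ) H →ₗ[k] V ⊗[k] H :=
  A.tensorMul V ∘ₗ TensorOver.mapLeft k H (A.cotensorSub ρ).subtype

/-- The Galois image of `v ⊗ x ⊗ y` is `v ⊗ π(x₁) ⊗ x₂y`; on the cotensor product the defining
equation rewrites it as `v₀ ⊗ v₁ ⊗ xy`. Injectivity of `cotensorMul` thus follows from that of the
Galois map and flatness. -/
theorem tensorGalois_mapLeft_subtype (t : TensorOver k A.carrier (A.cotensorSub ρ) H) :
    A.tensorGalois V (TensorOver.mapLeft k H (A.cotensorSub ρ).subtype t) =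
      TensorProduct.assoc k _ _ _ (ρ.coact.rTensor H (A.cotensorMul ρ t)) := by
  induction t using TensorOver.induction_on with
  | add x y hx hy => simp only [map_add, hx, hy]
  | tmul e y =>
    obtain ⟨e, he⟩ := e
    rw [cotensorMul, LinearMap.comp_apply, TensorOver.mapLeft_tmul, Submodule.subtype_apply,
      tensorGalois_tmul, tensorMul_tmul]
    have he' : TensorProduct.assoc k V A.factor.Quot H (ρ.coact.rTensor H e) =
      A.factor.leftComodule.coact.lTensor V e := (A.mem_cotensorSub_iff ρ e).1 he
    rw [← he']
    change _ = TensorProduct.assoc k V A.factor.Quot H (ρ.coact.rTensor H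
      ((LinearMap.mulRight k y).lTensor V e))
    clear he he'
    induction e with
    | zero => simp
    | add a b ha hb => simp only [map_add, ha, hb]
    | tmul v x =>
      simp only [LinearMap.rTensor_tmul, LinearMap.lTensor_tmul]
      induction ρ.coact v with
      | zero => simp
      | add a b ha hb => simp only [map_add, add_tmul, ha, hb]
      | tmul a b => simp

theorem cotensorMul_injective (hA : A.IsLeftFaithfullyFlat) :
    Function.Injective (A.cotensorMul ρ) := by
  rw [injective_iff_map_eq_zero]
  intro t ht
  have h := A.tensorGalois_mapLeft_subtype ρ t
  rw [ht, map_zero, map_zero] at h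
  exact (injective_iff_map_eq_zero _).1 (LeftFaithfullyFlat.mapLeft_injective hA
    (A.cotensorSub ρ).subtype (A.cotensorSub ρ).injective_subtype) _
    ((injective_iff_map_eq_zero _).1 A.tensorGalois_injective _ h)

/-- Here and in `tensorGalois_mapLeft_coactRight`, the two maps with equalizer `V □_C H` are
transported along the Galois isomorphism: after `- ⊗_A H` they become `ρ ⊗ id` and `id ⊗ Δ ⊗ id` on
`V ⊗ C ⊗ H`. -/
theorem tensorGalois_mapLeft_coactLeft (t : TensorOver k A.carrier (V ⊗[k] H) H) :
    A.tensorGalois _ (TensorOver.mapLeft k H (A.coactLeft ρ) t) =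
      ρ.coact.rTensor _ (A.tensorGalois V t) := by
  induction t using TensorOver.induction_on with
  | add x y hx hy => simp only [map_add, hx, hy]
  | tmul e y =>
    rw [TensorOver.mapLeft_tmul, tensorGalois_tmul, tensorGalois_tmul]
    change _ = ρ.coact.rTensor _ _
    change ((LinearMap.mulRight k y).lTensor _).lTensor _
      (A.factor.leftComodule.coact.lTensor _ (ρ.coact.rTensor H e)) = _
    simp only [← LinearMap.comp_apply, ← LinearMap.lTensor_comp, LinearMap.lTensor_comp_rTensor]
    congr 1
    ext
    simp

theorem tensorGalois_mapLeft_coactRight (t : TensorOver k A.carrier (V ⊗[k] H) H) :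
    A.tensorGalois _ (TensorOver.mapLeft k H (A.coactRight V) t) =
      (TensorProduct.assoc k V A.factor.Quot (A.factor.Quot ⊗[k] H)).symm
        (((TensorProduct.assoc k _ _ _).toLinearMap ∘ₗ
          (comul (R := k) (A := A.factor.Quot)).rTensor H).lTensor V (A.tensorGalois V t)) := by
  induction t using TensorOver.induction_on with
  | add x y hx hy => simp only [map_add, hx, hy]
  | tmul e y =>
    induction e with
    | zero => simp
    | add a b ha hb => simp only [TensorOver.add_tmul, map_add, ha, hb]
    | tmul v x =>
      have h : ∀ z : A.factor.Quot ⊗[k] H, A.tensorGalois _ (TensorOver.tmul k A.carrier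
          ((TensorProduct.assoc k V A.factor.Quot H).symm (v ⊗ₜ z)) y) =
          (TensorProduct.assoc k V A.factor.Quot (A.factor.Quot ⊗[k] H)).symm
            (v ⊗ₜ (A.factor.galois ∘ₗ (TensorProduct.mk k H H).flip y).lTensor A.factor.Quot z) := by
        intro z
        induction z with
        | zero => simp
        | add a b ha hb => simp only [tmul_add, map_add, TensorOver.add_tmul, ha, hb]
        | tmul c h =>
          rw [TensorProduct.assoc_symm_tmul, tensorGalois_tmul_tmul]
          simp
      rw [TensorOver.mapLeft_tmul, tensorGalois_tmul_tmul, LinearMap.lTensor_tmul]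
      refine (h (A.factor.leftComodule.coact x)).trans ?_
      rw [A.factor.galois_colinear]
      rfl

end RightCoidealSubalgebra

/-- `(ρ ⊗ id)(t)` lies in the cotensor product of `V` with the cofree comodule `C ⊗ W`;
`counit_rTensor` recovers `t` from it. -/
theorem RightComodule.coassoc_rTensor {C : Type*} [AddCommGroup C] [Module k C] [Coalgebra k C]
    {V W : Type*} [AddCommGroup V] [Module k V] [AddCommGroup W] [Module k W]
    (ρ : RightComodule k C V) (t : V ⊗[k] W) :
    TensorProduct.assoc k V C (C ⊗[k] W) (ρ.coact.rTensor _
      (TensorProduct.assoc k V C W (ρ.coact.rTensor W t))) =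
    ((TensorProduct.assoc k C C W).toLinearMap ∘ₗ comul.rTensor W).lTensor V
      (TensorProduct.assoc k V C W (ρ.coact.rTensor W t)) := by
  induction t with
  | zero => simp
  | add a b ha hb => simp only [map_add, ha, hb]
  | tmul v x =>
    rw [LinearMap.rTensor_tmul]
    let G : V ⊗[k] (C ⊗[k] C) →ₗ[k] V ⊗[k] (C ⊗[k] (C ⊗[k] W)) :=
      ((TensorProduct.assoc k C C W).toLinearMap ∘ₗ
        (TensorProduct.mk k (C ⊗[k] C) W).flip x).lTensor V
    have h1 : ∀ p : V ⊗[k] C, TensorProduct.assoc k V C (C ⊗[k] W)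
        (ρ.coact.rTensor _ (TensorProduct.assoc k V C W (p ⊗ₜ x))) =
        G (TensorProduct.assoc k V C C (ρ.coact.rTensor C p)) := by
      intro p
      induction p with
      | zero => simp
      | add a b ha hb => simp only [add_tmul, map_add, ha, hb]
      | tmul v' c =>
        simp only [TensorProduct.assoc_tmul, LinearMap.rTensor_tmul]
        induction ρ.coact v' with
        | zero => simp
        | add a b ha hb => simp only [add_tmul, map_add, ha, hb]
        | tmul v'' c' => simp [G]
    have h2 : ∀ p : V ⊗[k] C, ((TensorProduct.assoc k C C W).toLinearMap ∘ₗ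
        comul.rTensor W).lTensor V (TensorProduct.assoc k V C W (p ⊗ₜ x)) =
        G (comul.lTensor V p) := by
      intro p
      induction p with
      | zero => simp
      | add a b ha hb => simp only [add_tmul, map_add, ha, hb]
      | tmul v' c => simp [G]
    rw [h1, h2]
    exact congrArg G (LinearMap.congr_fun ρ.coassoc v)

theorem RightComodule.counit_rTensor {C : Type*} [AddCommGroup C] [Module k C] [Coalgebra k C]
    {V W : Type*} [AddCommGroup V] [Module k V] [AddCommGroup W] [Module k W]
    (ρ : RightComodule k C V) (t : V ⊗[k] W) :
    ((TensorProduct.lid k W).toLinearMap ∘ₗ (Coalgebra.counit (R := k)).rTensor W).lTensor V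
      (TensorProduct.assoc k V C W (ρ.coact.rTensor W t)) = t := by
  induction t with
  | zero => simp
  | add a b ha hb => simp only [map_add, ha, hb]
  | tmul v x =>
    rw [LinearMap.rTensor_tmul]
    have h : ∀ p : V ⊗[k] C, ((TensorProduct.lid k W).toLinearMap ∘ₗ
        (Coalgebra.counit (R := k)).rTensor W).lTensor V (TensorProduct.assoc k V C W (p ⊗ₜ x)) =
        (TensorProduct.rid k V ((Coalgebra.counit (R := k)).lTensor V p)) ⊗ₜ x := by
      intro p
      induction p with
      | zero => simp
      | add a b ha hb => simp only [add_tmul, map_add, ha, hb]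
      | tmul v' c => simp [smul_tmul]
    rw [h]
    exact congrArg (· ⊗ₜ[k] x) (LinearMap.congr_fun ρ.counit v)

namespace RightCoidealSubalgebra

variable (A : RightCoidealSubalgebra k H)

variable {V : Type v} [AddCommGroup V] [Module k V] {W : Type v} [AddCommGroup W] [Module k W]
  (ρ : RightComodule k A.factor.Quot V) (σ : RightComodule k A.factor.Quot W)

/-- The multiplication map is recovered from the Galois map. -/
theorem counit_tensorGalois (t : TensorOver k A.carrier (V ⊗[k] H) H) :
    ((TensorProduct.lid k H).toLinearMap ∘ₗ counit.rTensor H).lTensor V (A.tensorGalois V t) =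
      A.tensorMul V t := by
  induction t using TensorOver.induction_on with
  | add x y hx hy => simp only [map_add, hx, hy]
  | tmul e y =>
    have h1 : ((TensorProduct.lid k H).toLinearMap ∘ₗ counit.rTensor H) ∘ₗ
        (LinearMap.mulRight k y).lTensor _ ∘ₗ A.factor.leftComodule.coact =
        LinearMap.mulRight k y := by
      have h2 : ((TensorProduct.lid k H).toLinearMap ∘ₗ counit.rTensor H) ∘ₗ
        (LinearMap.mulRight k y).lTensor A.factor.Quot = LinearMap.mulRight k y ∘ₗ
          ((TensorProduct.lid k H).toLinearMap ∘ₗ counit.rTensor H) := by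
        ext; simp
      rw [← LinearMap.comp_assoc, h2, LinearMap.comp_assoc, LinearMap.comp_assoc,
        A.factor.leftComodule.counit, LinearMap.comp_id]
    rw [tensorGalois_tmul, tensorMul_tmul, ← LinearMap.lTensor_comp_apply,
      ← LinearMap.lTensor_comp_apply, LinearMap.comp_assoc, h1]

/-- Take the `t` whose Galois image is `(ρ ⊗ id)(s)`. Coassociativity puts `t` in the kernel of the
map defining `V □_C H`, tensored with `H` over `A`; by flatness that kernel comes from `(V □_C H)
⊗_A H`. Applying the counit returns `s`. -/
theorem cotensorMul_surjective (hA : A.IsLeftFaithfullyFlat) :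
    Function.Surjective (A.cotensorMul ρ) := by
  intro s
  obtain ⟨t, ht⟩ := A.tensorGalois_surjective
    (TensorProduct.assoc k _ _ _ (ρ.coact.rTensor H s))
  have h0 : TensorOver.mapLeft k H (A.coactLeft ρ - A.coactRight V) t = 0 := by
    apply A.tensorGalois_injective
    have h1 : TensorOver.mapLeft k H (A.coactLeft ρ - A.coactRight V) t =
        TensorOver.mapLeft k H (A.coactLeft ρ) t - TensorOver.mapLeft k H (A.coactRight V) t := by
      clear ht
      induction t using TensorOver.induction_on with
      | add x y hx hy => simp only [map_add, hx, hy]; abel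
      | tmul e y => exact TensorOver.sub_tmul _ _ _
    rw [h1, map_sub, map_zero, sub_eq_zero, tensorGalois_mapLeft_coactLeft,
      tensorGalois_mapLeft_coactRight, ht, LinearEquiv.eq_symm_apply]
    exact ρ.coassoc_rTensor s
  obtain ⟨w, hw⟩ := (hA.exact _ _ _ (A.cotensorSub ρ).subtype (A.coactLeft ρ - A.coactRight V)
    (LinearMap.exact_subtype_ker_map _) t).1 h0
  refine ⟨w, ?_⟩
  rw [cotensorMul, LinearMap.comp_apply, hw, ← counit_tensorGalois, ht, ρ.counit_rTensor]

variable {ρ σ} in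
/-- The map `V □_C H → W □_C H` induced by a colinear map, as an `A`-linear map. -/
noncomputable def cotensorSubMap (f : V →ₗ[k] W) (hf : ρ.IsColinear σ f) :
    A.cotensorSub ρ →ₗ[(A.carrier)ᵐᵒᵖ] A.cotensorSub σ :=
  (A.tensorLinear (f.rTensor H) fun v x a _ => by simp).restrict fun t ht => by
    rw [mem_cotensorSub_iff] at ht ⊢
    exact (cotensorMapLeft A.factor.leftComodule f hf ⟨t, ht⟩).2

variable {ρ σ} in
theorem cotensorMul_mapLeft (f : V →ₗ[k] W) (hf : ρ.IsColinear σ f)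
    (t : TensorOver k A.carrier (A.cotensorSub ρ) H) :
    A.cotensorMul σ (TensorOver.mapLeft k H (A.cotensorSubMap f hf) t) =
      f.rTensor H (A.cotensorMul ρ t) := by
  induction t using TensorOver.induction_on with
  | add x y hx hy => simp only [map_add, hx, hy]
  | tmul e y =>
    rw [TensorOver.mapLeft_tmul, cotensorMul, cotensorMul, LinearMap.comp_apply,
      LinearMap.comp_apply, TensorOver.mapLeft_tmul, TensorOver.mapLeft_tmul, tensorMul_tmul,
      tensorMul_tmul]
    change (LinearMap.mulRight k y).lTensor W (f.rTensor H (e : V ⊗[k] H)) = _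
    simp only [← LinearMap.comp_apply, LinearMap.lTensor_comp_rTensor,
      LinearMap.rTensor_comp_lTensor]
    rfl

/-- If `H` is left faithfully flat over `A`, it is left faithfully coflat over `H ⧸ HA⁺`. -/
theorem factor_isLeftFaithfullyCoflat (hA : A.IsLeftFaithfullyFlat) :
    A.factor.IsLeftFaithfullyCoflat where
  exact V₁ V₂ V₃ _ _ _ _ _ _ ρ₁ ρ₂ ρ₃ f g hf hg hfg := by
    -- After `- ⊗_A H` the sequence of cotensor products becomes `Vᵢ ⊗ H`, exact over a field, and
    -- faithful flatness reflects exactness.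
    have hex : Function.Exact (A.cotensorSubMap f hf) (A.cotensorSubMap g hg) := by
      refine LeftFaithfullyFlat.exact_of_exact (k := k) hA _ _ (fun x => ?_) (fun t ht => ?_)
      · apply Subtype.ext
        change g.rTensor H (f.rTensor H (x : V₁ ⊗[k] H)) = 0
        rw [← LinearMap.rTensor_comp_apply, hfg.linearMap_comp_eq_zero]
        simp
      · have h1 := A.cotensorMul_mapLeft g hg t
        rw [ht, map_zero] at h1
        obtain ⟨s, hs⟩ := (Module.Flat.rTensor_exact (R := k) H hfg _).1 h1.symm
        obtain ⟨w, rfl⟩ := A.cotensorMul_surjective ρ₁ hA s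
        refine ⟨w, A.cotensorMul_injective ρ₂ hA ?_⟩
        rw [cotensorMul_mapLeft, hs]
    rintro ⟨y, hy⟩
    have h := hex ⟨y, (A.mem_cotensorSub_iff ρ₂ y).2 hy⟩
    constructor
    · intro h0
      have h0' := congrArg Subtype.val h0
      obtain ⟨x, hx⟩ := h.1 (Subtype.ext h0')
      have hx' := congrArg Subtype.val hx
      exact ⟨⟨x, (A.mem_cotensorSub_iff ρ₁ x).1 x.2⟩, Subtype.ext hx'⟩
    · rintro ⟨x, hx⟩
      have hx' := congrArg Subtype.val hx
      have h0 := congrArg Subtype.val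
        (h.2 ⟨⟨x, (A.mem_cotensorSub_iff ρ₁ x).2 x.2⟩, Subtype.ext hx'⟩)
      exact Subtype.ext h0
  nontrivial V _ _ ρ hV := by
    by_contra hE
    rw [not_nontrivial_iff_subsingleton] at hE
    have hE' : ∀ e : A.cotensorSub ρ, e = 0 := fun e => by
      have : (⟨e, (A.mem_cotensorSub_iff ρ e).1 e.2⟩ : cotensor ρ A.factor.leftComodule) = 0 :=
        Subsingleton.elim _ _
      have h := congrArg Subtype.val this
      exact Subtype.ext h
    obtain ⟨v, hv⟩ := exists_ne (0 : V)
    -- If `V □_C H` were zero, every `v ⊗ 1` would be in the image of the zero space, and the counit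
    -- of `H` would give `v = 0`.
    obtain ⟨t, ht⟩ := A.cotensorMul_surjective ρ hA (v ⊗ₜ 1)
    have ht0 : ∀ t : TensorOver k A.carrier (A.cotensorSub ρ) H, t = 0 := fun t => by
      induction t using TensorOver.induction_on with
      | add x y hx hy => rw [hx, hy, add_zero]
      | tmul e y => rw [hE' e, TensorOver.zero_tmul]
    apply hv
    rw [ht0 t, map_zero] at ht
    have := congrArg (fun z => TensorProduct.rid k V ((counit (R := k) (A := H)).lTensor V z)) ht
    simpa using this.symm

end RightCoidealSubalgebra

end Coflat

/-! ### Tensor multiples, quotients and kernels of comodules. -/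

section ComoduleConstructions

variable {k : Type u} {C : Type v} [Field k] [AddCommGroup C] [Module k C] [Coalgebra k C]
  {V : Type*} [AddCommGroup V] [Module k V] {W : Type*} [AddCommGroup W] [Module k W]

namespace RightComodule

theorem coassoc_apply (ρ : RightComodule k C V) (v : V) :
    TensorProduct.assoc k V C C (ρ.coact.rTensor C (ρ.coact v)) =
      (comul (R := k) (A := C)).lTensor V (ρ.coact v) :=
  LinearMap.congr_fun ρ.coassoc v

theorem counit_apply (ρ : RightComodule k C V) (v : V) :
    TensorProduct.rid k V ((Coalgebra.counit (R := k) (A := C)).lTensor V (ρ.coact v)) = v :=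
  LinearMap.congr_fun ρ.counit v

/-- Coassociativity pushed forward along a linear map compatible with the coactions. -/
theorem rTensor_coassoc (ρ : RightComodule k C V) (f : V →ₗ[k] W) (δ : W →ₗ[k] W ⊗[k] C)
    (h : ∀ v, δ (f v) = f.rTensor C (ρ.coact v)) (v : V) :
    TensorProduct.assoc k W C C (δ.rTensor C (δ (f v))) =
      (comul (R := k) (A := C)).lTensor W (δ (f v)) := by
  have h' : δ ∘ₗ f = f.rTensor C ∘ₗ ρ.coact := LinearMap.ext h
  have h1 : (TensorProduct.assoc k W C C).toLinearMap ∘ₗ (f.rTensor C).rTensor C =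
      f.rTensor (C ⊗[k] C) ∘ₗ (TensorProduct.assoc k V C C).toLinearMap :=
    TensorProduct.ext_threefold fun _ _ _ => rfl
  rw [h, ← LinearMap.rTensor_comp_apply, h', LinearMap.rTensor_comp_apply,
    ← LinearMap.comp_apply (comul.lTensor W), LinearMap.lTensor_comp_rTensor,
    ← LinearMap.rTensor_comp_lTensor, LinearMap.comp_apply, ← ρ.coassoc_apply]
  exact LinearMap.congr_fun h1 _

theorem rTensor_counit (ρ : RightComodule k C V) (f : V →ₗ[k] W) (δ : W →ₗ[k] W ⊗[k] C)
    (h : ∀ v, δ (f v) = f.rTensor C (ρ.coact v)) (v : V) :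
    TensorProduct.rid k W ((Coalgebra.counit (R := k) (A := C)).lTensor W (δ (f v))) = f v := by
  rw [h, ← LinearMap.comp_apply (LinearMap.lTensor W _), LinearMap.lTensor_comp_rTensor,
    ← LinearMap.rTensor_comp_lTensor, LinearMap.comp_apply]
  conv_rhs => rw [← ρ.counit_apply v]
  have h1 : (TensorProduct.rid k W).toLinearMap ∘ₗ f.rTensor k =
      f ∘ₗ (TensorProduct.rid k V).toLinearMap := by
    ext; simp
  exact LinearMap.congr_fun h1 _

/-- The comodule `X ⊗ V`, where `X` is a vector space. -/
noncomputable def tensor (X : Type*) [AddCommGroup X] [Module k X] (ρ : RightComodule k C V) :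
    RightComodule k C (X ⊗[k] V) where
  coact := (TensorProduct.assoc k X V C).symm.toLinearMap ∘ₗ ρ.coact.lTensor X
  coassoc := by
    refine TensorProduct.ext' fun x v => ?_
    exact ρ.rTensor_coassoc (TensorProduct.mk k X V x)
      ((TensorProduct.assoc k X V C).symm.toLinearMap ∘ₗ ρ.coact.lTensor X) (fun v => by
        simp only [mk_apply, LinearMap.comp_apply, LinearMap.lTensor_tmul, LinearEquiv.coe_coe]
        induction ρ.coact v with
        | zero => simp
        | add a b ha hb => simp only [tmul_add, map_add, ha, hb]
        | tmul a b => simp) v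
  counit := by
    refine TensorProduct.ext' fun x v => ?_
    exact ρ.rTensor_counit (TensorProduct.mk k X V x)
      ((TensorProduct.assoc k X V C).symm.toLinearMap ∘ₗ ρ.coact.lTensor X) (fun v => by
        simp only [mk_apply, LinearMap.comp_apply, LinearMap.lTensor_tmul, LinearEquiv.coe_coe]
        induction ρ.coact v with
        | zero => simp
        | add a b ha hb => simp only [tmul_add, map_add, ha, hb]
        | tmul a b => simp) v

theorem tensor_coact_tmul {X : Type*} [AddCommGroup X] [Module k X] (ρ : RightComodule k C V)
    (x : X) (v : V) : (ρ.tensor X).coact (x ⊗ₜ v) =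
      (TensorProduct.assoc k X V C).symm (x ⊗ₜ ρ.coact v) := rfl

/-- Transport of a comodule structure along a linear equivalence. -/
noncomputable def congr (ρ : RightComodule k C V) (e : V ≃ₗ[k] W) : RightComodule k C W where
  coact := e.toLinearMap.rTensor C ∘ₗ ρ.coact ∘ₗ e.symm.toLinearMap
  coassoc := by
    ext w
    obtain ⟨v, rfl⟩ := e.surjective w
    exact ρ.rTensor_coassoc e.toLinearMap
      (e.toLinearMap.rTensor C ∘ₗ ρ.coact ∘ₗ e.symm.toLinearMap) (by simp) v
  counit := by
    ext w
    obtain ⟨v, rfl⟩ := e.surjective w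
    exact ρ.rTensor_counit e.toLinearMap
      (e.toLinearMap.rTensor C ∘ₗ ρ.coact ∘ₗ e.symm.toLinearMap) (by simp) v

theorem congr_coact (ρ : RightComodule k C V) (e : V ≃ₗ[k] W) (w : W) :
    (ρ.congr e).coact w = e.toLinearMap.rTensor C (ρ.coact (e.symm w)) := rfl

/-- The quotient of a comodule by a subcomodule. -/
noncomputable def quotient (ρ : RightComodule k C V) (Q : Submodule k V)
    (hQ : ∀ v ∈ Q, Q.mkQ.rTensor C (ρ.coact v) = 0) : RightComodule k C (V ⧸ Q) where
  coact := Q.liftQ (Q.mkQ.rTensor C ∘ₗ ρ.coact) hQ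
  coassoc := by
    ext v
    exact ρ.rTensor_coassoc Q.mkQ (Q.liftQ (Q.mkQ.rTensor C ∘ₗ ρ.coact) hQ) (fun _ => rfl) v
  counit := by
    ext v
    exact ρ.rTensor_counit Q.mkQ (Q.liftQ (Q.mkQ.rTensor C ∘ₗ ρ.coact) hQ) (fun _ => rfl) v

theorem isColinear_mkQ (ρ : RightComodule k C V) (Q : Submodule k V)
    (hQ : ∀ v ∈ Q, Q.mkQ.rTensor C (ρ.coact v) = 0) :
    ρ.IsColinear (ρ.quotient Q hQ) Q.mkQ := rfl

/-- Over a field `ker f ⊗ C` is the kernel of `f ⊗ id`, so the coaction restricts to `ker f`. -/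
theorem coact_mem_range_of_mem_ker {ρ : RightComodule k C V} {σ : RightComodule k C W}
    {f : V →ₗ[k] W} (hf : ρ.IsColinear σ f) (v : LinearMap.ker f) :
    ρ.coact v ∈ LinearMap.range ((LinearMap.ker f).subtype.rTensor C) := by
  have h : Function.Exact ((LinearMap.ker f).subtype.rTensor C) (f.rTensor C) :=
    Module.Flat.rTensor_exact (R := k) C (LinearMap.exact_subtype_ker_map f)
  refine (h _).1 ?_
  rw [← LinearMap.comp_apply, ← hf, LinearMap.comp_apply, v.2, map_zero]

/-- The coaction on the kernel of a colinear map. -/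
noncomputable def kerCoact {ρ : RightComodule k C V} {σ : RightComodule k C W}
    {f : V →ₗ[k] W} (hf : ρ.IsColinear σ f) :
    LinearMap.ker f →ₗ[k] LinearMap.ker f ⊗[k] C :=
  (LinearEquiv.ofInjective ((LinearMap.ker f).subtype.rTensor C)
    (Module.Flat.rTensor_preserves_injective_linearMap _
      (LinearMap.ker f).injective_subtype)).symm.toLinearMap ∘ₗ
    (ρ.coact ∘ₗ (LinearMap.ker f).subtype).codRestrict _ (coact_mem_range_of_mem_ker hf)

theorem rTensor_kerCoact {ρ : RightComodule k C V} {σ : RightComodule k C W}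
    {f : V →ₗ[k] W} (hf : ρ.IsColinear σ f) (v : LinearMap.ker f) :
    (LinearMap.ker f).subtype.rTensor C (kerCoact hf v) = ρ.coact v := by
  have h := (LinearEquiv.ofInjective ((LinearMap.ker f).subtype.rTensor C)
    (Module.Flat.rTensor_preserves_injective_linearMap _
      (LinearMap.ker f).injective_subtype)).apply_symm_apply
      ⟨ρ.coact v, coact_mem_range_of_mem_ker hf v⟩
  exact congrArg Subtype.val h

/-- The kernel of a colinear map. -/
noncomputable def ker {ρ : RightComodule k C V} {σ : RightComodule k C W}
    {f : V →ₗ[k] W} (hf : ρ.IsColinear σ f) : RightComodule k C (LinearMap.ker f) where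
  coact := kerCoact hf
  coassoc := by
    ext v
    set i := (LinearMap.ker f).subtype
    have hi : ∀ v, i.rTensor C (kerCoact hf v) = ρ.coact (i v) := rTensor_kerCoact hf
    have hi' : i.rTensor C ∘ₗ kerCoact hf = ρ.coact ∘ₗ i := LinearMap.ext hi
    -- The inclusion stays injective after tensoring, so coassociativity on the kernel can be tested
    -- in `V ⊗ C ⊗ C`.
    apply Module.Flat.rTensor_preserves_injective_linearMap (M := C ⊗[k] C) i
      (LinearMap.ker f).injective_subtype
    have h1 : (TensorProduct.assoc k V C C).toLinearMap ∘ₗ (i.rTensor C).rTensor C =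
        i.rTensor (C ⊗[k] C) ∘ₗ (TensorProduct.assoc k _ C C).toLinearMap :=
      TensorProduct.ext_threefold fun _ _ _ => rfl
    have h2 := LinearMap.congr_fun h1 ((kerCoact hf).rTensor C (kerCoact hf v))
    simp only [LinearMap.comp_apply, LinearEquiv.coe_coe] at h2 ⊢
    rw [← h2, ← LinearMap.rTensor_comp_apply, hi', LinearMap.rTensor_comp_apply, hi,
      ρ.coassoc_apply, ← hi, ← LinearMap.comp_apply (LinearMap.lTensor V _),
      LinearMap.lTensor_comp_rTensor, ← LinearMap.rTensor_comp_lTensor, LinearMap.comp_apply]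
  counit := by
    ext v
    have h1 : (TensorProduct.rid k V).toLinearMap ∘ₗ (LinearMap.ker f).subtype.rTensor k =
        (LinearMap.ker f).subtype ∘ₗ (TensorProduct.rid k _).toLinearMap := by
      ext; simp
    have h2 := LinearMap.congr_fun h1
      ((Coalgebra.counit (R := k) (A := C)).lTensor _ (kerCoact hf v))
    refine h2.symm.trans ?_
    rw [LinearMap.comp_apply, ← LinearMap.comp_apply (LinearMap.rTensor _ _),
      LinearMap.rTensor_comp_lTensor, ← LinearMap.lTensor_comp_rTensor, LinearMap.comp_apply,
      rTensor_kerCoact]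
    exact ρ.counit_apply v

theorem isColinear_ker_subtype {ρ : RightComodule k C V} {σ : RightComodule k C W}
    {f : V →ₗ[k] W} (hf : ρ.IsColinear σ f) :
    (ker hf).IsColinear ρ (LinearMap.ker f).subtype :=
  LinearMap.ext fun v => (rTensor_kerCoact hf v).symm

/-- The zero comodule. -/
def zero (V : Type*) [AddCommGroup V] [Module k V] [Subsingleton V] : RightComodule k C V where
  coact := 0
  coassoc := by ext v; simp [Subsingleton.elim v 0]
  counit := by ext v; exact Subsingleton.elim _ _

end RightComodule

theorem mem_cotensor {ρ : RightComodule k C V} {τ : LeftComodule k C W} {t : V ⊗[k] W} :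
    t ∈ cotensor ρ τ ↔
      TensorProduct.assoc k V C W (ρ.coact.rTensor W t) = τ.coact.lTensor V t := Iff.rfl

/-- The cotensor product commutes with tensoring by a vector space. -/
theorem exists_of_mem_cotensor_tensor {X : Type*} [AddCommGroup X] [Module k X]
    {ρ : RightComodule k C V} {τ : LeftComodule k C W} {t : (X ⊗[k] V) ⊗[k] W}
    (ht : t ∈ cotensor (ρ.tensor X) τ) :
    ∃ r : X ⊗[k] cotensor ρ τ,
      TensorProduct.assoc k X V W t = (cotensor ρ τ).subtype.lTensor X r := by
  -- The cotensor product is the kernel of `f`, and `X ⊗ -` is exact over a field.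
  let f : V ⊗[k] W →ₗ[k] V ⊗[k] (C ⊗[k] W) :=
    (TensorProduct.assoc k V C W).toLinearMap ∘ₗ ρ.coact.rTensor W - τ.coact.lTensor V
  have hf : Function.Exact (cotensor ρ τ).subtype f := fun x => by
    rw [LinearMap.sub_apply, sub_eq_zero]
    refine ⟨fun h => ⟨⟨x, h⟩, rfl⟩, ?_⟩
    rintro ⟨y, rfl⟩
    exact y.2
  have h1 : ∀ t, f.lTensor X (TensorProduct.assoc k X V W t) =
      TensorProduct.assoc k X V (C ⊗[k] W) (TensorProduct.assoc k (X ⊗[k] V) C W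
        ((ρ.tensor X).coact.rTensor W t) - τ.coact.lTensor (X ⊗[k] V) t) := by
    intro t
    induction t with
    | zero => simp
    | add a b ha hb => simp only [map_add, ha, hb, map_sub]; abel
    | tmul s w =>
      induction s with
      | zero => simp
      | add a b ha hb => simp only [add_tmul, map_add, ha, hb, map_sub]; abel
      | tmul x v =>
        have h2 : ∀ z : V ⊗[k] C, x ⊗ₜ TensorProduct.assoc k V C W (z ⊗ₜ w) =
            TensorProduct.assoc k X V (C ⊗[k] W) (TensorProduct.assoc k (X ⊗[k] V) C W
              ((TensorProduct.assoc k X V C).symm (x ⊗ₜ z) ⊗ₜ w)) := by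
          intro z
          induction z with
          | zero => simp
          | add a b ha hb => simp only [add_tmul, tmul_add, map_add, ha, hb]
          | tmul a b => simp
        simp only [f, TensorProduct.assoc_tmul, LinearMap.lTensor_tmul, LinearMap.sub_apply,
          LinearMap.comp_apply, LinearMap.rTensor_tmul, tmul_sub, map_sub, LinearEquiv.coe_coe, h2,
          RightComodule.tensor_coact_tmul]
  obtain ⟨r, hr⟩ := (Module.Flat.lTensor_exact (R := k) X hf (TensorProduct.assoc k X V W t)).1 (by
    rw [h1, mem_cotensor.1 ht, sub_self, map_zero])
  exact ⟨r, hr.symm⟩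

end ComoduleConstructions

/-! ### Consequences of faithful coflatness. -/

section CoflatLemmas

variable {k : Type u} {C : Type v} [Field k] [AddCommGroup C] [Module k C] [Coalgebra k C]
  {V : Type v} [AddCommGroup V] [Module k V] {W : Type v} [AddCommGroup W] [Module k W]
  {M : Type v} [AddCommGroup M] [Module k M]
  {ρ : RightComodule k C V} {σ : RightComodule k C W} {τ : LeftComodule k C M}

namespace LeftComodule.FaithfullyCoflat

/-- Exactness of the cotensor functor on `V → W → 0`, with `PUnit` carrying the zero comodule. -/
theorem cotensorMapLeft_surjective (hτ : τ.FaithfullyCoflat) {f : V →ₗ[k] W}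
    (hf : ρ.IsColinear σ f) (h : Function.Surjective f) :
    Function.Surjective (cotensorMapLeft τ f hf) := by
  intro y
  have hex := hτ.exact V W PUnit.{v + 1} ρ σ (RightComodule.zero PUnit.{v + 1}) f 0 hf
    (by rw [RightComodule.IsColinear]; ext; simp) (fun x => by simp [h x])
  refine (hex y).1 (Subtype.ext ?_)
  change (0 : W →ₗ[k] PUnit.{v + 1}).rTensor M (y : W ⊗[k] M) = 0
  simp

/-- A colinear map is injective if it is so after applying a faithfully coflat cotensor
product. -/
theorem injective_of_rTensor (hτ : τ.FaithfullyCoflat) {f : V →ₗ[k] W}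
    (hf : ρ.IsColinear σ f) (h : ∀ t ∈ cotensor ρ τ, f.rTensor M t = 0 → t = 0) :
    Function.Injective f := by
  rw [← LinearMap.ker_eq_bot, ← Submodule.subsingleton_iff_eq_bot]
  by_contra hK
  rw [not_subsingleton_iff_nontrivial] at hK
  refine not_subsingleton_iff_nontrivial.2
    (hτ.nontrivial (LinearMap.ker f) (RightComodule.ker hf) hK) ⟨fun x y => ?_⟩
  -- `ker f □ M` embeds into the elements of `V □ M` killed by `f ⊗ id`, which are zero by
  -- hypothesis; faithfulness then forces `ker f = 0`.
  have h0 : ∀ t : cotensor (RightComodule.ker hf) τ, t = 0 := fun t => by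
    have h1 := (cotensorMapLeft τ _ (RightComodule.isColinear_ker_subtype hf) t).2
    apply Subtype.ext
    apply Module.Flat.rTensor_preserves_injective_linearMap (M := M) (LinearMap.ker f).subtype
      (LinearMap.ker f).injective_subtype
    rw [ZeroMemClass.coe_zero, map_zero]
    refine h _ h1 ?_
    rw [← LinearMap.rTensor_comp_apply, LinearMap.comp_ker_subtype]
    simp
  rw [h0 x, h0 y]

end LeftComodule.FaithfullyCoflat

end CoflatLemmas

/-! ### The inverse antipode, the twisted coaction, and `H □_C H` inside `A ⊗ H`. -/

section Antipode

variable {k : Type u} {H : Type v} [Field k] [Ring H] [HopfAlgebra k H]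
  (hS : Function.Bijective (antipode k (A := H)))

/-- The bijective antipode as a linear equivalence. -/
noncomputable def antipodeEquiv : H ≃ₗ[k] H := LinearEquiv.ofBijective (antipode k) hS

theorem antipode_symm_apply (x : H) : antipode k ((antipodeEquiv hS).symm x) = x :=
  (antipodeEquiv hS).apply_symm_apply x

theorem symm_antipode_apply (x : H) : (antipodeEquiv hS).symm (antipode k x) = x :=
  (antipodeEquiv hS).symm_apply_apply x

theorem antipode_symm_mul (x y : H) : (antipodeEquiv hS).symm (x * y) =
    (antipodeEquiv hS).symm y * (antipodeEquiv hS).symm x := by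
  apply hS.injective
  rw [antipode_mul_antidistrib]
  simp only [antipode_symm_apply]

theorem comul_antipode_symm (x : H) : comul (R := k) ((antipodeEquiv hS).symm x) =
    TensorProduct.map (antipodeEquiv hS).symm.toLinearMap (antipodeEquiv hS).symm.toLinearMap
      (TensorProduct.comm k H H (comul x)) := by
  conv_rhs => rw [← antipode_symm_apply hS x, comul_antipode_apply]
  generalize comul (R := k) ((antipodeEquiv hS).symm x) = z
  induction z with
  | zero => simp
  | add a b ha hb => simp only [map_add, ← ha, ← hb]
  | tmul a b => simp [symm_antipode_apply]

/-- The identity `S⁻¹(x₂) x₁ = ε(x)`. -/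
theorem mul_comm_rTensor_antipode_symm_comul (x : H) :
    LinearMap.mul' k H (TensorProduct.comm k H H
      ((antipodeEquiv hS).symm.toLinearMap.lTensor H (comul x))) =
      algebraMap k H (counit x) := by
  apply hS.injective
  have h : ∀ z : H ⊗[k] H, antipode k (LinearMap.mul' k H (TensorProduct.comm k H H
      ((antipodeEquiv hS).symm.toLinearMap.lTensor H z))) =
      LinearMap.mul' k H ((antipode k).rTensor H z) := by
    intro z
    induction z with
    | zero => simp
    | add a b ha hb => simp only [map_add, ha, hb]
    | tmul a b => simp [antipode_mul_antidistrib, antipode_symm_apply]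
  rw [h, mul_antipode_rTensor_comul_apply, Algebra.algebraMap_eq_smul_one, map_smul, antipode_one]

/-- The identity `x₂ S⁻¹(x₁) = ε(x)`. -/
theorem mul_comm_lTensor_antipode_symm_comul (x : H) :
    LinearMap.mul' k H (TensorProduct.comm k H H
      ((antipodeEquiv hS).symm.toLinearMap.rTensor H (comul x))) =
      algebraMap k H (counit x) := by
  apply hS.injective
  have h : ∀ z : H ⊗[k] H, antipode k (LinearMap.mul' k H (TensorProduct.comm k H H
      ((antipodeEquiv hS).symm.toLinearMap.rTensor H z))) =
      LinearMap.mul' k H ((antipode k).lTensor H z) := by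
    intro z
    induction z with
    | zero => simp
    | add a b ha hb => simp only [map_add, ha, hb]
    | tmul a b => simp [antipode_mul_antidistrib, antipode_symm_apply]
  rw [h, mul_antipode_lTensor_comul_apply, Algebra.algebraMap_eq_smul_one, map_smul, antipode_one]

namespace LeftModuleFactorCoalgebra

variable (C : LeftModuleFactorCoalgebra k H)

/-- The map `x ⊗ y ↦ S⁻¹(y)x` sends `I ⊗ H` into `I`. Applied to `Δ(a) - 1 ⊗ a`, which lies in `I ⊗
H`, it gives `ε(a) - S⁻¹(a) ∈ I`. -/
theorem mkQ_antipode_symm {a : H} (ha : a ∈ C.coinvariants.carrier) :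
    C.mkQ ((antipodeEquiv hS).symm a) = counit (R := k) a • C.mkQ 1 := by
  let m : H ⊗[k] H →ₗ[k] H := LinearMap.mul' k H ∘ₗ (TensorProduct.comm k H H).toLinearMap ∘ₗ
    (antipodeEquiv hS).symm.toLinearMap.lTensor H
  have h : ∀ z : H ⊗[k] H, C.mkQ.rTensor H z = 0 → C.mkQ (m z) = 0 := by
    intro z hz
    obtain ⟨z, rfl⟩ :=
      (rTensor_exact H (LinearMap.exact_subtype_mkQ _) (Submodule.mkQ_surjective _) _).1 hz
    clear hz
    induction z with
    | zero => simp
    | add a b ha hb => rw [map_add, map_add, map_add, ha, hb, add_zero]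
    | tmul j y =>
      rw [C.mkQ_eq_zero]
      exact C.ker.mul_mem_left _ j.2
  have h1 := h (comul a - 1 ⊗ₜ a) (by
    rw [map_sub, C.mem_coinvariants.1 ha, LinearMap.rTensor_tmul, sub_self])
  have h2 : m (comul a) = algebraMap k H (counit a) := mul_comm_rTensor_antipode_symm_comul hS a
  rw [map_sub, map_sub, sub_eq_zero, h2, Algebra.algebraMap_eq_smul_one, map_smul] at h1
  rw [h1]
  simp [m]

/-- The inverse of the antipode maps left coinvariants to right coinvariants. -/
theorem lTensor_mkQ_comul_antipode_symm {a : H} (ha : a ∈ C.coinvariants.carrier) :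
    C.mkQ.lTensor H (comul ((antipodeEquiv hS).symm a)) =
      (antipodeEquiv hS).symm a ⊗ₜ C.mkQ 1 := by
  -- `Δ(S⁻¹(a)) = S⁻¹(a₂) ⊗ S⁻¹(a₁)`, and `a₁` ranges over coinvariants because these form a right
  -- coideal, so `mkQ_antipode_symm` applies to the second leg.
  have key : ∀ z ∈ Submodule.span k {t : H ⊗[k] H |
      ∃ b ∈ C.coinvariants.carrier, ∃ h, t = b ⊗ₜ h},
      C.mkQ.lTensor H (TensorProduct.map (antipodeEquiv hS).symm.toLinearMap
        (antipodeEquiv hS).symm.toLinearMap (TensorProduct.comm k H H z)) =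
      (antipodeEquiv hS).symm
        (TensorProduct.lid k H ((counit (R := k) (A := H)).rTensor H z)) ⊗ₜ C.mkQ 1 := by
    intro z hz
    induction hz using Submodule.span_induction with
    | zero => simp
    | add x y _ _ hx hy => simp only [map_add, hx, hy, add_tmul]
    | smul c x _ hx => simp only [map_smul, hx, smul_tmul']
    | mem x hx =>
      obtain ⟨b, hb, h, rfl⟩ := hx
      simp only [comm_tmul, TensorProduct.map_tmul, LinearMap.lTensor_tmul, LinearEquiv.coe_coe]
      rw [C.mkQ_antipode_symm hS hb]
      simp [smul_tmul]
  rw [comul_antipode_symm, key _ (C.coinvariants.comul_mem_span ha)]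
  simp

/-- The coaction of `H` on itself transported along the antipode. -/
noncomputable def twisted : RightComodule k C.Quot H := C.rightComodule.congr (antipodeEquiv hS)

/-- The twisted coaction is linear over the coinvariants. -/
theorem twisted_coact_mul {a : H} (ha : a ∈ C.coinvariants.carrier) (h : H) :
    (C.twisted hS).coact (a * h) =
      (LinearMap.mulLeft k a).rTensor _ ((C.twisted hS).coact h) := by
  rw [twisted, RightComodule.congr_coact, RightComodule.congr_coact, antipode_symm_mul,
    rightComodule_coact_apply, rightComodule_coact_apply, Bialgebra.comul_mul]
  -- `S⁻¹(ah) = S⁻¹(h)S⁻¹(a)`, and `S⁻¹(a)` is right coinvariant: modulo `H ⊗ I` its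
  -- comultiplication is `S⁻¹(a) ⊗ 1`.
  have h1 : C.mkQ.lTensor H (comul ((antipodeEquiv hS).symm h) *
      comul ((antipodeEquiv hS).symm a)) =
      C.mkQ.lTensor H (comul ((antipodeEquiv hS).symm h) * ((antipodeEquiv hS).symm a ⊗ₜ 1)) := by
    rw [← sub_eq_zero, ← map_sub, ← mul_sub]
    apply C.lTensor_mkQ_mul
    rw [map_sub, C.lTensor_mkQ_comul_antipode_symm hS ha, LinearMap.lTensor_tmul, sub_self]
  rw [h1]
  generalize comul (R := k) ((antipodeEquiv hS).symm h) = z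
  induction z with
  | zero => simp
  | add a b ha hb => simp only [add_mul, map_add, ha, hb]
  | tmul x y =>
    simp only [Algebra.TensorProduct.tmul_mul_tmul, LinearMap.lTensor_tmul, LinearMap.rTensor_tmul,
      mul_one, LinearEquiv.coe_coe, LinearMap.mulLeft_apply]
    congr 1
    change antipode k _ = a * antipode k _
    rw [antipode_mul_antidistrib, antipode_symm_apply]

theorem mem_cotensor_of_twisted {s : H ⊗[k] H} (hs : s ∈ cotensor (C.twisted hS) C.leftComodule) :
    (antipodeEquiv hS).symm.toLinearMap.rTensor H s ∈
      cotensor C.rightComodule C.leftComodule := by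
  have hc : (C.twisted hS).IsColinear C.rightComodule (antipodeEquiv hS).symm.toLinearMap := by
    ext x
    change C.rightComodule.coact ((antipodeEquiv hS).symm x) =
      (antipodeEquiv hS).symm.toLinearMap.rTensor _ ((antipodeEquiv hS).toLinearMap.rTensor _
        (C.rightComodule.coact ((antipodeEquiv hS).symm x)))
    rw [← LinearMap.rTensor_comp_apply, LinearEquiv.symm_comp]
    simp
  exact (cotensorMapLeft C.leftComodule _ hc ⟨s, hs⟩).2

theorem mem_cotensor_twisted {s : H ⊗[k] H} (hs : s ∈ cotensor C.rightComodule C.leftComodule) :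
    (antipode k).rTensor H s ∈ cotensor (C.twisted hS) C.leftComodule := by
  have hc : C.rightComodule.IsColinear (C.twisted hS) (antipode k) := by
    ext x
    change (antipodeEquiv hS).toLinearMap.rTensor _
        (C.rightComodule.coact ((antipodeEquiv hS).symm (antipode k x))) =
      (antipode k).rTensor _ (C.rightComodule.coact x)
    rw [symm_antipode_apply]
    rfl
  exact (cotensorMapLeft C.leftComodule _ hc ⟨s, hs⟩).2

theorem comul_mem_cotensor (x : H) :
    comul (R := k) x ∈ cotensor C.rightComodule C.leftComodule := by
  rw [mem_cotensor]
  have h1 : ∀ z : H ⊗[k] H, TensorProduct.assoc k H C.Quot H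
      (C.rightComodule.coact.rTensor H z) = (C.mkQ.rTensor H).lTensor H
        (TensorProduct.assoc k H H H (comul.rTensor H z)) := by
    intro z
    induction z with
    | zero => simp
    | add a b ha hb => simp only [map_add, ha, hb]
    | tmul a b =>
      rw [LinearMap.rTensor_tmul, LinearMap.rTensor_tmul, rightComodule_coact_apply]
      induction comul (R := k) a with
      | zero => simp
      | add a b ha hb => simp only [add_tmul, map_add, ha, hb]
      | tmul a b => simp
  have h2 : C.leftComodule.coact = C.mkQ.rTensor H ∘ₗ comul := rfl
  rw [h1, Coalgebra.coassoc_apply, h2, LinearMap.lTensor_comp_apply]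

/-- The left action of `H` on `C` as a map `H ⊗ C → C`. -/
noncomputable def act : H ⊗[k] C.Quot →ₗ[k] C.Quot :=
  TensorProduct.lift
    { toFun := C.lsmul
      map_add' := fun x y => by
        ext z
        change C.mkQ ((x + y) * z) = C.mkQ (x * z) + C.mkQ (y * z)
        rw [add_mul, map_add]
      map_smul' := fun c x => by
        ext z
        change C.mkQ ((c • x) * z) = c • C.mkQ (x * z)
        rw [smul_mul_assoc, map_smul] }

@[simp]
theorem act_tmul_mkQ (h x : H) : C.act (h ⊗ₜ C.mkQ x) = C.mkQ (h * x) := rfl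

/-- For `s = x ⊗ g`, summation understood, the coaction on the first leg of `S(x)g₁ ⊗ g₂` gives
`π(S(x₂)g₁) ⊗ S(x₁)g₂ ⊗ g₃`. The cotensor condition replaces `x ⊗ π(g₁) ⊗ g₂` by `x₁ ⊗ π(x₂) ⊗ g`,
which turns this into `π(S(x₂)x₃) ⊗ S(x₁)g₁ ⊗ g₂ = π(1) ⊗ S(x)g₁ ⊗ g₂`. -/
theorem galLeft_mem_of_mem_cotensor {s : H ⊗[k] H}
    (hs : s ∈ cotensor C.rightComodule C.leftComodule) :
    galLeft k H ((antipode k).rTensor H s) ∈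
      LinearMap.range (C.coinvariants.carrier.toSubmodule.subtype.rTensor H) := by
  let f : H →ₗ[k] C.Quot ⊗[k] H :=
    C.mkQ.rTensor H ∘ₗ comul - TensorProduct.mk k _ _ (C.mkQ 1)
  have hex : Function.Exact C.coinvariants.carrier.toSubmodule.subtype f := fun x => by
    rw [LinearMap.sub_apply, sub_eq_zero]
    refine ⟨fun h => ⟨⟨x, h⟩, rfl⟩, ?_⟩
    rintro ⟨y, rfl⟩
    exact y.2
  refine (Module.Flat.rTensor_exact (R := k) H hex _).1 ?_
  have hsub : ∀ t, f.rTensor H t = (C.mkQ.rTensor H ∘ₗ comul).rTensor H t -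
      (TensorProduct.mk k _ _ (C.mkQ 1)).rTensor H t := fun t => by
    rw [LinearMap.rTensor_sub]
    rfl
  rw [hsub, sub_eq_zero]
  -- `Ω` sends `(p ⊗ q) ⊗ (c ⊗ h)` to `pc ⊗ qh₁ ⊗ h₂`. Both sides of the coinvariance equation are
  -- `Ω` composed with `Δ ∘ S` on the first factor, evaluated on the two sides of the cotensor
  -- condition.
  let Ω : (H ⊗[k] H) ⊗[k] (C.Quot ⊗[k] H) →ₗ[k] (C.Quot ⊗[k] H) ⊗[k] H :=
    (TensorProduct.assoc k C.Quot H H).symm.toLinearMap ∘ₗ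
      TensorProduct.map C.act (galLeft k H) ∘ₗ
        (TensorProduct.tensorTensorTensorComm k H H C.Quot H).toLinearMap
  have step1 : ∀ t : H ⊗[k] H, (C.mkQ.rTensor H ∘ₗ comul).rTensor H
      (galLeft k H ((antipode k).rTensor H t)) =
      Ω ((comul ∘ₗ antipode k).rTensor _ (C.leftComodule.coact.lTensor H t)) := by
    intro t
    induction t with
    | zero => simp
    | add a b ha hb => simp only [map_add, ha, hb]
    | tmul x g =>
      have h1 : ∀ z : H ⊗[k] H, comul.rTensor H ((antipode k x ⊗ₜ[k] (1 : H)) * z) =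
          (comul (R := k) (antipode k x) ⊗ₜ[k] (1 : H)) * comul.rTensor H z := by
        intro z
        induction z with
        | zero => simp
        | add a b ha hb => simp only [mul_add, map_add, ha, hb]
        | tmul a b => simp
      have h2 : ∀ w z : H ⊗[k] H, (C.mkQ.rTensor H).rTensor H ((w ⊗ₜ[k] (1 : H)) *
          (TensorProduct.assoc k H H H).symm (comul.lTensor H z)) =
          Ω (w ⊗ₜ C.mkQ.rTensor H z) := by
        intro w z
        induction z with
        | zero => simp
        | add a b ha hb => simp only [mul_add, tmul_add, map_add, ha, hb]
        | tmul a b =>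
          induction w with
          | zero => simp
          | add u v hu hv => simp only [add_mul, add_tmul, map_add, hu, hv]
          | tmul p q =>
            simp only [Ω, LinearMap.comp_apply, LinearMap.rTensor_tmul, LinearMap.lTensor_tmul,
              LinearEquiv.coe_coe, tensorTensorTensorComm_tmul, TensorProduct.map_tmul, act_tmul_mkQ,
              galLeft_tmul]
            induction comul (R := k) b with
            | zero => simp
            | add u v hu hv => simp only [mul_add, tmul_add, map_add, hu, hv]
            | tmul u v => simp
      rw [LinearMap.rTensor_tmul, galLeft_tmul, LinearMap.rTensor_comp_apply, h1,
        ← Coalgebra.coassoc_symm_apply, h2]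
      rfl
  have step2 : ∀ t : H ⊗[k] H, Ω ((comul ∘ₗ antipode k).rTensor _
      (TensorProduct.assoc k H C.Quot H (C.rightComodule.coact.rTensor H t))) =
      (TensorProduct.mk k _ _ (C.mkQ 1)).rTensor H (galLeft k H ((antipode k).rTensor H t)) := by
    intro t
    induction t with
    | zero => simp
    | add a b ha hb => simp only [map_add, ha, hb]
    | tmul x g =>
      let Ξ : H ⊗[k] (H ⊗[k] H) →ₗ[k] (C.Quot ⊗[k] H) ⊗[k] H :=
        (TensorProduct.assoc k C.Quot H H).symm.toLinearMap ∘ₗ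
          (TensorProduct.comm k (H ⊗[k] H) C.Quot).toLinearMap ∘ₗ
          TensorProduct.map (galLeft k H ∘ₗ (TensorProduct.mk k H H).flip g ∘ₗ antipode k)
            (C.mkQ ∘ₗ LinearMap.mul' k H ∘ₗ (antipode k).rTensor H)
      have h1 : ∀ z : H ⊗[k] H, Ω ((comul ∘ₗ antipode k).rTensor _
          (TensorProduct.assoc k H C.Quot H (C.mkQ.lTensor H z ⊗ₜ g))) =
          Ξ (TensorProduct.assoc k H H H (comul.rTensor H z)) := by
        intro z
        induction z with
        | zero => simp
        | add a b ha hb => simp only [add_tmul, map_add, ha, hb]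
        | tmul a b =>
          simp only [LinearMap.rTensor_tmul, LinearMap.lTensor_tmul, LinearMap.comp_apply,
            TensorProduct.assoc_tmul, comul_antipode_apply]
          induction comul (R := k) a with
          | zero => simp
          | add u v hu hv => simp only [add_tmul, map_add, hu, hv]
          | tmul u v =>
            simp [Ω, Ξ]
            rfl
      have h2 : ∀ z : H ⊗[k] H, Ξ (comul.lTensor H z) =
          (TensorProduct.mk k _ _ (C.mkQ 1)).rTensor H (galLeft k H
            ((antipode k (TensorProduct.rid k H
              ((counit (R := k) (A := H)).lTensor H z))) ⊗ₜ g)) := by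
        intro z
        induction z with
        | zero => simp
        | add a b ha hb => simp only [add_tmul, map_add, ha, hb]
        | tmul a b =>
          simp only [Ξ, LinearMap.lTensor_tmul, LinearMap.comp_apply, TensorProduct.map_tmul,
            mul_antipode_rTensor_comul_apply, LinearEquiv.coe_coe, Algebra.algebraMap_eq_smul_one,
            map_smul, tmul_smul, TensorProduct.rid_tmul, ← smul_tmul']
          simp only [comm_tmul, LinearMap.flip_apply, mk_apply]
          induction galLeft k H (antipode k a ⊗ₜ g) with
          | zero => simp
          | add u v hu hv => simp only [tmul_add, map_add, smul_add, hu, hv]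
          | tmul u v => simp
      rw [LinearMap.rTensor_tmul, rightComodule_coact_apply, h1, Coalgebra.coassoc_apply, h2]
      simp
  rw [step1, ← mem_cotensor.1 hs, step2]

end LeftModuleFactorCoalgebra

end Antipode

/-! ### Recovering `C` from its coinvariants. -/

section FactorCoinvariants

variable {k : Type u} {H : Type v} [Field k] [Ring H] [HopfAlgebra k H]

namespace LeftModuleFactorCoalgebra

variable (C : LeftModuleFactorCoalgebra k H)

/-- Apply `ε` to the second leg of the coinvariance equation. -/
theorem mkQ_of_mem_coinvariants {a : H} (ha : a ∈ C.coinvariants.carrier) :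
    C.mkQ a = counit (R := k) a • C.mkQ 1 := by
  have h : ∀ z : H ⊗[k] H, TensorProduct.rid k C.Quot ((counit (R := k) (A := H)).lTensor _
      (C.mkQ.rTensor H z)) =
      C.mkQ (TensorProduct.rid k H ((counit (R := k) (A := H)).lTensor H z)) := by
    intro z
    induction z with
    | zero => simp
    | add a b ha hb => simp only [map_add, ha, hb]
    | tmul a b => simp
  have h1 := h (comul a)
  rw [C.mem_coinvariants.1 ha] at h1
  simpa using h1.symm

theorem ker_factor_coinvariants_le : C.coinvariants.factor.ker ≤ C.ker := by
  refine Ideal.span_le.2 ?_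
  rintro a ⟨ha, h0⟩
  rw [SetLike.mem_coe, ← C.mkQ_eq_zero, C.mkQ_of_mem_coinvariants ha, h0, zero_smul]

/-- If `s` corresponds to `a ⊗ g` in `A ⊗ H`, then `s = g₁S⁻¹(a) ⊗ g₂`. In `D` the factor `S⁻¹(a)`
acts on the class of `1` as `ε(a)`, so `x = ε(a)g` serves. -/
theorem exists_rTensor_mkQ_eq_comul (hS : Function.Bijective (antipode k (A := H)))
    {D : LeftModuleFactorCoalgebra k H}
    (hD : ∀ a ∈ C.coinvariants.carrier, a ∈ D.coinvariants.carrier) {s : H ⊗[k] H}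
    (hs : s ∈ cotensor C.rightComodule C.leftComodule) :
    ∃ x, D.mkQ.rTensor H s = D.mkQ.rTensor H (comul x) := by
  obtain ⟨w, hw⟩ := C.galLeft_mem_of_mem_cotensor hs
  have h1 : s = (antipodeEquiv hS).symm.toLinearMap.rTensor H (galLeftInv k H
      (C.coinvariants.carrier.toSubmodule.subtype.rTensor H w)) := by
    rw [hw, galLeftInv_galLeft, ← LinearMap.rTensor_comp_apply]
    have : (antipodeEquiv hS).symm.toLinearMap ∘ₗ antipode k = LinearMap.id :=
      LinearMap.ext (symm_antipode_apply hS)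
    rw [this, LinearMap.rTensor_id_apply]
  refine ⟨TensorProduct.lid k H ((counit (R := k) (A := H)).rTensor H
    (C.coinvariants.carrier.toSubmodule.subtype.rTensor H w)), ?_⟩
  rw [h1]
  clear hs hw h1
  induction w with
  | zero => simp
  | add a b ha hb => simp only [map_add, ha, hb]
  | tmul a g =>
    obtain ⟨a, ha⟩ := a
    have h2 : ∀ z : H ⊗[k] H, D.mkQ.rTensor H ((antipodeEquiv hS).symm.toLinearMap.rTensor H
        ((a ⊗ₜ 1) * (antipode k).rTensor H z)) = counit (R := k) a • D.mkQ.rTensor H z := by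
      intro z
      induction z with
      | zero => simp
      | add a b ha hb => simp only [map_add, mul_add, smul_add, ha, hb]
      | tmul x y =>
        simp only [LinearMap.rTensor_tmul, Algebra.TensorProduct.tmul_mul_tmul, one_mul,
          LinearEquiv.coe_coe, antipode_symm_mul, symm_antipode_apply]
        rw [← lsmul_mkQ, D.mkQ_antipode_symm hS (hD a ha), map_smul, lsmul_mkQ, mul_one,
          smul_tmul']
    rw [LinearMap.rTensor_tmul, galLeftInv_tmul, Submodule.subtype_apply, h2]
    simp

/-- A faithfully coflat factor coalgebra is recovered from its coinvariants. -/
theorem factor_coinvariants (hS : Function.Bijective (antipode k (A := H)))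
    (hC : C.IsLeftFaithfullyCoflat) : C.coinvariants.factor = C := by
  set D := C.coinvariants.factor with hDdef
  have hle : D.ker ≤ C.ker := C.ker_factor_coinvariants_le
  let φ : D.Quot →ₗ[k] C.Quot := Submodule.mapQ _ _ LinearMap.id hle
  have hφ : ∀ x, φ (D.mkQ x) = C.mkQ x := fun _ => rfl
  have hφ' : φ ∘ₗ D.mkQ = C.mkQ := rfl
  let Φ : D.Quot →ₗc[k] C.Quot :=
    { φ with
      counit_comp := by ext x; rfl
      map_comp_comul := by
        ext x
        change TensorProduct.map φ φ (TensorProduct.map D.mkQ D.mkQ (comul x)) =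
          TensorProduct.map C.mkQ C.mkQ (comul x)
        rw [← LinearMap.comp_apply, ← TensorProduct.map_comp, hφ'] }
  have hΦ : Φ.toLinearMap = φ := rfl
  -- `D` is regarded as a right `C`-comodule along `Φ`, so that `H → D` and `φ : D → C` are both
  -- `C`-colinear.
  have hc1 : C.rightComodule.IsColinear (RightComodule.ofCoalgHom Φ) D.mkQ := by
    ext x
    change φ.lTensor D.Quot (TensorProduct.map D.mkQ D.mkQ (comul x)) =
      D.mkQ.rTensor C.Quot (C.mkQ.lTensor H (comul x))
    generalize comul (R := k) x = z
    induction z with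
    | zero => simp
    | add a b ha hb => simp only [map_add, ha, hb]
    | tmul a b => simp only [TensorProduct.map_tmul, LinearMap.lTensor_tmul,
        LinearMap.rTensor_tmul, hφ]
  have hc2 : (RightComodule.ofCoalgHom Φ).IsColinear
      (RightComodule.ofCoalgHom (CoalgHom.id k C.Quot)) φ := by
    ext x
    change (LinearMap.id (R := k) (M := C.Quot)).lTensor C.Quot
        (TensorProduct.map C.mkQ C.mkQ (comul x)) =
      φ.rTensor C.Quot (φ.lTensor D.Quot (TensorProduct.map D.mkQ D.mkQ (comul x)))
    generalize comul (R := k) x = z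
    induction z with
    | zero => simp
    | add a b ha hb => simp only [map_add, ha, hb]
    | tmul a b => simp only [TensorProduct.map_tmul, LinearMap.lTensor_tmul,
        LinearMap.rTensor_tmul, hφ, LinearMap.id_apply]
  have hinj : Function.Injective φ := by
    refine hC.injective_of_rTensor hc2 fun t ht ht0 => ?_
    -- By coflatness an element of `D □_C H` lifts to `H □_C H`, hence is the image of some `Δ(x)`.
    -- If `φ ⊗ id` kills it, then `(π ⊗ id)Δ(x) = 0`, and the counit of `C` gives `x = 0`.
    obtain ⟨⟨s, hs⟩, hst⟩ :=
      hC.cotensorMapLeft_surjective hc1 (Submodule.mkQ_surjective _) ⟨t, ht⟩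
    have hst' : D.mkQ.rTensor H s = t := congrArg Subtype.val hst
    obtain ⟨x, hx⟩ := C.exists_rTensor_mkQ_eq_comul hS (D := D)
      (fun a ha => C.coinvariants.mem_coinvariants_factor ha) hs
    rw [← hst', hx, ← LinearMap.rTensor_comp_apply, hφ'] at ht0
    have h1 := congrArg (fun z => TensorProduct.lid k H
      ((counit (R := k) (A := C.Quot)).rTensor H z)) ht0
    simp only [← LinearMap.rTensor_comp_apply] at h1
    have h2 : counit (R := k) (A := C.Quot) ∘ₗ C.mkQ = counit := rfl
    rw [h2] at h1
    simp only [rTensor_counit_comul, map_zero, TensorProduct.lid_tmul, one_smul] at h1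
    rw [← hst', hx, h1, map_zero, map_zero]
  ext x
  refine ⟨fun hx => hle hx, fun hx => ?_⟩
  rw [← D.mkQ_eq_zero]
  apply hinj
  rw [hφ, map_zero, C.mkQ_eq_zero]
  exact hx

end LeftModuleFactorCoalgebra

end FactorCoinvariants

/-! ### The isomorphism `N ⊗ H ≅ (N ⊗_A H) □_C H` and faithful flatness. -/

section CoinvariantsFlat

variable {k : Type u} {H : Type v} [Field k] [Ring H] [HopfAlgebra k H]
  (hS : Function.Bijective (antipode k (A := H)))

namespace LeftModuleFactorCoalgebra

variable (C : LeftModuleFactorCoalgebra k H)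

theorem isColinear_mk {X V D : Type*} [AddCommGroup X] [Module k X] [AddCommGroup V] [Module k V]
    [AddCommGroup D] [Module k D] [Coalgebra k D] (ρ : RightComodule k D V) (x : X) :
    ρ.IsColinear (ρ.tensor X) (TensorProduct.mk k X V x) := by
  ext v
  simp only [LinearMap.comp_apply, mk_apply, RightComodule.tensor_coact_tmul]
  induction ρ.coact v with
  | zero => simp
  | add a b ha hb => simp only [tmul_add, map_add, ha, hb]
  | tmul a b => simp

/-- The map `n ⊗ g ↦ n ⊗ S(g₁) ⊗ g₂`. -/
noncomputable def preUnitMap (N : Type*) [AddCommGroup N] [Module k N] : N ⊗[k] H →ₗ[k] (N ⊗[k] H) ⊗[k] H :=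
  (TensorProduct.assoc k N H H).symm.toLinearMap ∘ₗ ((antipode k).rTensor H ∘ₗ comul).lTensor N

/-- Coassociativity puts `Δ(g)` in `H □_C H`, and `S` is colinear from `H` to its twisted comodule
structure, so `S(g₁) ⊗ g₂` satisfies the twisted condition; `n` is a spectator. -/
theorem preUnitMap_mem_cotensor {N : Type*} [AddCommGroup N] [Module k N] (u : N ⊗[k] H) :
    preUnitMap N u ∈ cotensor ((C.twisted hS).tensor N) C.leftComodule := by
  induction u with
  | zero => simp
  | add a b ha hb => rw [map_add]; exact add_mem ha hb
  | tmul n g =>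
    have h := (cotensorMapLeft C.leftComodule _ (isColinear_mk (C.twisted hS) n)
      ⟨_, C.mem_cotensor_twisted hS (C.comul_mem_cotensor g)⟩).2
    have h' : preUnitMap N (n ⊗ₜ g) =
        (TensorProduct.mk k N H n).rTensor H ((antipode k).rTensor H (comul g)) := by
      simp only [preUnitMap, LinearMap.comp_apply, LinearMap.lTensor_tmul, LinearEquiv.coe_coe]
      induction (antipode k).rTensor H (comul (R := k) g) with
      | zero => simp
      | add a b ha hb => simp only [tmul_add, map_add, ha, hb]
      | tmul a b => simp
    rw [h']
    exact h

variable {N : Type v} [AddCommGroup N] [Module k N] [Module (C.coinvariants.carrier)ᵐᵒᵖ N]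
  [IsScalarTower k (C.coinvariants.carrier)ᵐᵒᵖ N]

/-- The coinvariants as a vector space. -/
abbrev Coinv : Type v := C.coinvariants.carrier

variable (N) in
/-- The right action `N ⊗ A → N`. -/
noncomputable def rightAct : N ⊗[k] C.Coinv →ₗ[k] N :=
  have := IsScalarTower.to_smulCommClass (R := k) (A := (C.coinvariants.carrier)ᵐᵒᵖ) (M := N)
  TensorProduct.lift <| LinearMap.mk₂ k (fun n (a : C.Coinv) => MulOpposite.op a • n)
    (fun _ _ _ => smul_add _ _ _) (fun c n a => (smul_comm _ _ _))
    (fun n a b => by rw [MulOpposite.op_add, add_smul])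
    (fun c n a => by rw [MulOpposite.op_smul, smul_assoc])

theorem rightAct_tmul (n : N) (a : C.Coinv) :
    C.rightAct N (n ⊗ₜ a) = MulOpposite.op a • n := rfl

/-- The left action `A ⊗ H → H`. -/
noncomputable def leftAct : C.Coinv ⊗[k] H →ₗ[k] H :=
  LinearMap.mul' k H ∘ₗ C.coinvariants.carrier.toSubmodule.subtype.rTensor H

theorem leftAct_tmul (a : C.Coinv) (h : H) : C.leftAct (a ⊗ₜ h) = a * h := rfl

variable (N) in
/-- The map `n ⊗ a ⊗ h ↦ n a ⊗ h - n ⊗ a h` whose cokernel is `N ⊗_A H`. -/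
noncomputable def balancing : (N ⊗[k] C.Coinv) ⊗[k] H →ₗ[k] N ⊗[k] H :=
  (C.rightAct N).rTensor H -
    C.leftAct.lTensor N ∘ₗ (TensorProduct.assoc k N C.Coinv H).toLinearMap

theorem balancing_tmul (n : N) (a : C.Coinv) (h : H) :
    C.balancing N ((n ⊗ₜ a) ⊗ₜ h) = (MulOpposite.op a • n) ⊗ₜ h - n ⊗ₜ (a * h : H) := rfl

variable (N) in
-- `N ⊗_A H` becomes the cokernel of a colinear map between multiples of the twisted comodule, which
-- gives it a coaction and an exact sequence to cotensor with `H`.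
theorem range_balancing :
    LinearMap.range (C.balancing N) = balancedRel k C.coinvariants.carrier N H := by
  apply le_antisymm
  · rintro _ ⟨t, rfl⟩
    induction t with
    | zero => simp
    | add a b ha hb => rw [map_add]; exact add_mem ha hb
    | tmul s h =>
      induction s with
      | zero => simp
      | add a b ha hb => rw [add_tmul, map_add]; exact add_mem ha hb
      | tmul n a => exact Submodule.subset_span ⟨n, a, h, C.balancing_tmul n a h⟩
  · refine Submodule.span_le.2 ?_
    rintro _ ⟨n, a, h, rfl⟩
    exact ⟨(n ⊗ₜ a) ⊗ₜ h, C.balancing_tmul n a h⟩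

variable (N) in
theorem balancing_colinear : ((C.twisted hS).tensor (N ⊗[k] C.Coinv)).IsColinear
    ((C.twisted hS).tensor N) (C.balancing N) := by
  refine TensorProduct.ext_threefold fun n a h => ?_
  simp only [LinearMap.comp_apply, balancing_tmul, map_sub, RightComodule.tensor_coact_tmul,
    C.twisted_coact_mul hS a.2]
  induction (C.twisted hS).coact h with
  | zero => simp
  | add x y hx hy =>
    simp only [tmul_add, map_add, ← hx, ← hy]
    abel
  | tmul x y => simp [balancing_tmul, sub_tmul]

theorem mkQ_coact_eq_zero {t : N ⊗[k] H}
    (ht : t ∈ balancedRel k C.coinvariants.carrier N H) :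
    (balancedRel k C.coinvariants.carrier N H).mkQ.rTensor C.Quot
      (((C.twisted hS).tensor N).coact t) = 0 := by
  rw [← range_balancing] at ht
  obtain ⟨t, rfl⟩ := ht
  rw [← LinearMap.comp_apply _ (C.balancing N), C.balancing_colinear hS N, LinearMap.comp_apply,
    ← LinearMap.rTensor_comp_apply, ← range_balancing, LinearMap.range_mkQ_comp]
  simp

variable (N) in
/-- The right `C`-comodule `N ⊗_A H`. -/
noncomputable def tensorComodule :
    RightComodule k C.Quot (TensorOver k C.coinvariants.carrier N H) :=
  ((C.twisted hS).tensor N).quotient (balancedRel k C.coinvariants.carrier N H)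
    fun _ => C.mkQ_coact_eq_zero hS

theorem mapLeft_colinear {N' : Type v} [AddCommGroup N'] [Module k N']
    [Module (C.coinvariants.carrier)ᵐᵒᵖ N'] [IsScalarTower k (C.coinvariants.carrier)ᵐᵒᵖ N']
    (f : N →ₗ[(C.coinvariants.carrier)ᵐᵒᵖ] N') :
    (C.tensorComodule hS N).IsColinear (C.tensorComodule hS N') (TensorOver.mapLeft k H f) := by
  refine LinearMap.ext fun t => ?_
  obtain ⟨t, rfl⟩ := (balancedRel k C.coinvariants.carrier N H).mkQ_surjective t
  change (balancedRel k C.coinvariants.carrier N' H).mkQ.rTensor C.Quot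
      (((C.twisted hS).tensor N').coact ((f.restrictScalars k).rTensor H t)) =
    (TensorOver.mapLeft k H f).rTensor C.Quot
      ((balancedRel k C.coinvariants.carrier N H).mkQ.rTensor C.Quot
        (((C.twisted hS).tensor N).coact t))
  induction t with
  | zero => simp
  | add a b ha hb => simp only [map_add, ha, hb]
  | tmul n h =>
    rw [LinearMap.rTensor_tmul, RightComodule.tensor_coact_tmul, RightComodule.tensor_coact_tmul]
    induction (C.twisted hS).coact h with
    | zero => simp
    | add a b ha hb => simp only [tmul_add, map_add, ha, hb]
    | tmul x y => rfl

/-- The inclusion `A ⊗ H → H ⊗ H`. -/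
noncomputable abbrev coinvIncl : C.Coinv ⊗[k] H →ₗ[k] H ⊗[k] H :=
  C.coinvariants.carrier.toSubmodule.subtype.rTensor H

theorem coinvIncl_injective : Function.Injective C.coinvIncl :=
  Module.Flat.rTensor_preserves_injective_linearMap _ (Submodule.injective_subtype _)

/-- The version of `galLeft_mem_of_mem_cotensor` with coefficients in `X`; the twist absorbs the
antipode, leaving `galLeft` alone. -/
theorem exists_of_mem_cotensor_twisted {X : Type*} [AddCommGroup X] [Module k X]
    {s : (X ⊗[k] H) ⊗[k] H} (hs : s ∈ cotensor ((C.twisted hS).tensor X) C.leftComodule) :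
    ∃ w : X ⊗[k] (C.Coinv ⊗[k] H), C.coinvIncl.lTensor X w =
      (galLeft k H).lTensor X (TensorProduct.assoc k X H H s) := by
  obtain ⟨r, hr⟩ := exists_of_mem_cotensor_tensor hs
  rw [hr]
  clear hr hs
  induction r with
  | zero => exact ⟨0, by simp⟩
  | add a b ha hb =>
    obtain ⟨w, hw⟩ := ha
    obtain ⟨w', hw'⟩ := hb
    exact ⟨w + w', by simp only [map_add, hw, hw']⟩
  | tmul x r =>
    obtain ⟨w, hw⟩ := C.galLeft_mem_of_mem_cotensor (C.mem_cotensor_of_twisted hS r.2)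
    refine ⟨x ⊗ₜ w, ?_⟩
    rw [LinearMap.lTensor_tmul, LinearMap.lTensor_tmul, LinearMap.lTensor_tmul]
    congr 1
    rw [hw, ← LinearMap.rTensor_comp_apply]
    have : antipode k ∘ₗ (antipodeEquiv hS).symm.toLinearMap = LinearMap.id :=
      LinearMap.ext (antipode_symm_apply hS)
    rw [this, LinearMap.rTensor_id_apply]
    rfl

variable (N) in
/-- The map `n ⊗ g ↦ [n ⊗ S(g₁)] ⊗ g₂`. -/
noncomputable def unitMap :
    N ⊗[k] H →ₗ[k] TensorOver k C.coinvariants.carrier N H ⊗[k] H :=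
  (balancedRel k C.coinvariants.carrier N H).mkQ.rTensor H ∘ₗ
    (TensorProduct.assoc k N H H).symm.toLinearMap ∘ₗ
      ((antipode k).rTensor H ∘ₗ comul).lTensor N

variable (N) in
/-- The right action `N ⊗ (A ⊗ H) → N ⊗ H`. -/
noncomputable def actMap : N ⊗[k] (C.Coinv ⊗[k] H) →ₗ[k] N ⊗[k] H :=
  (C.rightAct N).rTensor H ∘ₗ (TensorProduct.assoc k N C.Coinv H).symm.toLinearMap

/-- The relation `[na ⊗ S(g₁)] ⊗ g₂ = [n ⊗ aS(g₁)] ⊗ g₂`. It shows that classes of elements coming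
from `N ⊗ A ⊗ H` through `galLeftInv` are values of `unitMap`. -/
theorem unitMap_actMap (w : N ⊗[k] (C.Coinv ⊗[k] H)) :
    C.unitMap N (C.actMap N w) =
      (balancedRel k C.coinvariants.carrier N H).mkQ.rTensor H
        ((TensorProduct.assoc k N H H).symm ((galLeftInv k H ∘ₗ C.coinvIncl).lTensor N w)) := by
  induction w with
  | zero => simp
  | add a b ha hb => simp only [map_add, ha, hb]
  | tmul n w =>
    induction w with
    | zero => simp
    | add a b ha hb => simp only [tmul_add, map_add, ha, hb]
    | tmul a g =>
      simp only [actMap, unitMap, LinearMap.comp_apply, LinearEquiv.coe_coe,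
        TensorProduct.assoc_symm_tmul, LinearMap.rTensor_tmul, rightAct_tmul,
        LinearMap.lTensor_tmul, galLeftInv_tmul]
      induction comul (R := k) g with
      | zero => simp
      | add a b ha hb => simp only [map_add, tmul_add, mul_add, ha, hb]
      | tmul x y =>
        simp only [LinearMap.rTensor_tmul, Algebra.TensorProduct.tmul_mul_tmul, one_mul,
          TensorProduct.assoc_symm_tmul]
        congr 1
        exact TensorOver.smul_tmul (k := k) n a (antipode k x)

theorem rTensor_mapLeft_unitMap {N' : Type v} [AddCommGroup N'] [Module k N']
    [Module (C.coinvariants.carrier)ᵐᵒᵖ N'] [IsScalarTower k (C.coinvariants.carrier)ᵐᵒᵖ N']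
    (f : N →ₗ[(C.coinvariants.carrier)ᵐᵒᵖ] N') (u : N ⊗[k] H) :
    (TensorOver.mapLeft k H f).rTensor H (C.unitMap N u) =
      C.unitMap N' ((f.restrictScalars k).rTensor H u) := by
  induction u with
  | zero => simp
  | add a b ha hb => simp only [map_add, ha, hb]
  | tmul n h =>
    simp only [unitMap, LinearMap.comp_apply, LinearMap.lTensor_tmul, LinearMap.rTensor_tmul]
    induction (antipode k).rTensor H (comul (R := k) h) with
    | zero => simp
    | add a b ha hb => simp only [tmul_add, map_add, ha, hb]
    | tmul x y => rfl

variable (N) in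
/-- The analogue of `balancing` on `N ⊗ A ⊗ (H ⊗ H)`. -/
noncomputable def balancingHH :
    (N ⊗[k] C.Coinv) ⊗[k] (H ⊗[k] H) →ₗ[k] N ⊗[k] (H ⊗[k] H) :=
  (C.rightAct N).rTensor (H ⊗[k] H) -
    (C.leftAct.rTensor H ∘ₗ (TensorProduct.assoc k C.Coinv H H).symm.toLinearMap).lTensor N ∘ₗ
      (TensorProduct.assoc k N C.Coinv (H ⊗[k] H)).toLinearMap

variable (N) in
/-- The analogue of `balancing` on `N ⊗ A ⊗ (A ⊗ H)`. -/
noncomputable def balancingAH :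
    (N ⊗[k] C.Coinv) ⊗[k] (C.Coinv ⊗[k] H) →ₗ[k] N ⊗[k] (C.Coinv ⊗[k] H) :=
  (C.rightAct N).rTensor (C.Coinv ⊗[k] H) -
    ((LinearMap.mul' k C.Coinv).rTensor H ∘ₗ
      (TensorProduct.assoc k C.Coinv C.Coinv H).symm.toLinearMap).lTensor N ∘ₗ
      (TensorProduct.assoc k N C.Coinv (C.Coinv ⊗[k] H)).toLinearMap

theorem balancingHH_tmul (n : N) (a : C.Coinv) (z : H ⊗[k] H) :
    C.balancingHH N ((n ⊗ₜ a) ⊗ₜ z) =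
      (MulOpposite.op a • n) ⊗ₜ z - n ⊗ₜ (((a : H) ⊗ₜ 1) * z) := by
  have h : C.leftAct.rTensor H ((TensorProduct.assoc k C.Coinv H H).symm (a ⊗ₜ z)) =
      ((a : H) ⊗ₜ 1) * z := by
    induction z with
    | zero => rw [tmul_zero, LinearEquiv.map_zero, LinearMap.map_zero, mul_zero]
    | add x y hx hy => rw [tmul_add, LinearEquiv.map_add, LinearMap.map_add, hx, hy, mul_add]
    | tmul x y =>
      rw [TensorProduct.assoc_symm_tmul, LinearMap.rTensor_tmul, leftAct_tmul,
        Algebra.TensorProduct.tmul_mul_tmul, one_mul]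
  rw [← h]
  rfl

theorem balancingAH_tmul (n : N) (a b : C.Coinv) (h : H) :
    C.balancingAH N ((n ⊗ₜ a) ⊗ₜ (b ⊗ₜ h)) =
      (MulOpposite.op a • n) ⊗ₜ (b ⊗ₜ h) - n ⊗ₜ ((a * b) ⊗ₜ h) := rfl

theorem coinvIncl_balancingAH (w : (N ⊗[k] C.Coinv) ⊗[k] (C.Coinv ⊗[k] H)) :
    C.coinvIncl.lTensor N (C.balancingAH N w) =
      C.balancingHH N (C.coinvIncl.lTensor (N ⊗[k] C.Coinv) w) := by
  suffices h : C.coinvIncl.lTensor N ∘ₗ C.balancingAH N =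
      C.balancingHH N ∘ₗ C.coinvIncl.lTensor (N ⊗[k] C.Coinv) from LinearMap.congr_fun h w
  ext n a b g
  simp [balancingAH_tmul, balancingHH_tmul]

/-- `galLeft` commutes with left multiplication on its first factor, so it respects the balancing.
With `coinvIncl_balancingAH`, this replaces the presentation of `(N ⊗_A H) □_C H` by that of `N ⊗_A
(A ⊗ H)`. -/
theorem galLeft_balancing (r : ((N ⊗[k] C.Coinv) ⊗[k] H) ⊗[k] H) :
    (galLeft k H).lTensor N (TensorProduct.assoc k N H H ((C.balancing N).rTensor H r)) =
      C.balancingHH N ((galLeft k H).lTensor _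
        (TensorProduct.assoc k (N ⊗[k] C.Coinv) H H r)) := by
  suffices h : (galLeft k H).lTensor N ∘ₗ (TensorProduct.assoc k N H H).toLinearMap ∘ₗ
      (C.balancing N).rTensor H = C.balancingHH N ∘ₗ (galLeft k H).lTensor _ ∘ₗ
        (TensorProduct.assoc k (N ⊗[k] C.Coinv) H H).toLinearMap from LinearMap.congr_fun h r
  ext n a h g
  have e : galLeft k H ((a * h : H) ⊗ₜ[k] g) = ((a : H) ⊗ₜ[k] (1 : H)) * galLeft k H (h ⊗ₜ g) := by
    rw [← galLeft_mul_left, Algebra.TensorProduct.tmul_mul_tmul, one_mul]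
  simp [balancing_tmul, balancingHH_tmul, sub_tmul, e]

theorem actMap_balancingAH (w : (N ⊗[k] C.Coinv) ⊗[k] (C.Coinv ⊗[k] H)) :
    C.actMap N (C.balancingAH N w) = 0 := by
  suffices h : C.actMap N ∘ₗ C.balancingAH N = 0 from LinearMap.congr_fun h w
  ext n a b g
  simp [balancingAH_tmul, actMap, rightAct_tmul, mul_smul]

/-- Cotensoring the presentation of `N ⊗_A H` with `H`, a `u` killed by `unitMap` has `preUnitMap N
u` in the image of the balancing map. Under `galLeft` this says that `n ⊗ 1 ⊗ g` is a balancing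
relation in `N ⊗ (A ⊗ H)`, and the action map kills such relations while sending `n ⊗ 1 ⊗ g` to `n ⊗
g`. -/
theorem unitMap_injective (hS : Function.Bijective (antipode k (A := H)))
    (hC : C.IsLeftFaithfullyCoflat) (u : N ⊗[k] H)
    (hu : C.unitMap N u = 0) : u = 0 := by
  have hex := hC.exact _ _ _ ((C.twisted hS).tensor (N ⊗[k] C.Coinv)) ((C.twisted hS).tensor N)
    (C.tensorComodule hS N) (C.balancing N) (balancedRel k C.coinvariants.carrier N H).mkQ
    (C.balancing_colinear hS N) (RightComodule.isColinear_mkQ _ _ _)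
    (by rw [LinearMap.exact_iff, Submodule.ker_mkQ, range_balancing])
  obtain ⟨⟨r, hr⟩, hrs⟩ := (hex ⟨preUnitMap N u, C.preUnitMap_mem_cotensor hS u⟩).1
    (Subtype.ext hu)
  have hrs' : (C.balancing N).rTensor H r = preUnitMap N u := congrArg Subtype.val hrs
  obtain ⟨w, hw⟩ := C.exists_of_mem_cotensor_twisted hS hr
  -- The equality is checked in `N ⊗ (H ⊗ H)`, where `galLeft` sends `S(g₁) ⊗ g₂` to `1 ⊗ g`.
  have h1 : C.balancingAH N w = (TensorProduct.mk k C.Coinv H 1).lTensor N u := by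
    apply Module.Flat.lTensor_preserves_injective_linearMap (M := N) C.coinvIncl
      C.coinvIncl_injective
    rw [coinvIncl_balancingAH, hw, ← galLeft_balancing, hrs', preUnitMap, LinearMap.comp_apply,
      LinearEquiv.coe_coe, LinearEquiv.apply_symm_apply, ← LinearMap.lTensor_comp_apply,
      ← LinearMap.lTensor_comp_apply]
    congr 2
    ext g
    simp [galLeft_rTensor_antipode_comul]
  have h2 : C.actMap N ((TensorProduct.mk k C.Coinv H 1).lTensor N u) = u := by
    clear hu hex hrs hrs' h1
    induction u with
    | zero => simp
    | add a b ha hb => simp only [map_add, ha, hb]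
    | tmul n g => simp [actMap, rightAct_tmul]
  rw [← h2, ← h1, actMap_balancingAH]

/-- Every element of `(N ⊗_A H) □_C H` is a value of the injective, natural map `unitMap`. So `f ⊗_A
H` becomes, after `- □_C H`, a restriction of the injective `f ⊗ H`, and coflatness reflects
injectivity. -/
theorem mapLeft_injective (hS : Function.Bijective (antipode k (A := H)))
    (hC : C.IsLeftFaithfullyCoflat) {N' : Type v} [AddCommGroup N']
    [Module k N'] [Module (C.coinvariants.carrier)ᵐᵒᵖ N']
    [IsScalarTower k (C.coinvariants.carrier)ᵐᵒᵖ N']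
    (f : N →ₗ[(C.coinvariants.carrier)ᵐᵒᵖ] N') (hf : Function.Injective f) :
    Function.Injective (TensorOver.mapLeft k H f) := by
  refine hC.injective_of_rTensor (C.mapLeft_colinear hS f) fun t ht ht0 => ?_
  obtain ⟨⟨s, hs⟩, hst⟩ := hC.cotensorMapLeft_surjective
    (RightComodule.isColinear_mkQ ((C.twisted hS).tensor N)
      (balancedRel k C.coinvariants.carrier N H) fun _ => C.mkQ_coact_eq_zero hS)
    (Submodule.mkQ_surjective _) ⟨t, ht⟩
  have hst' : (balancedRel k C.coinvariants.carrier N H).mkQ.rTensor H s = t :=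
    congrArg Subtype.val hst
  obtain ⟨w, hw⟩ := C.exists_of_mem_cotensor_twisted hS hs
  -- Surjectivity of `unitMap` onto the cotensor product: `t` lifts to `s` by coflatness, and
  -- undoing `galLeft` on `w` returns `s`.
  have h1 : C.unitMap N (C.actMap N w) = t := by
    rw [unitMap_actMap, LinearMap.lTensor_comp_apply, hw, ← LinearMap.lTensor_comp_apply]
    have : galLeftInv k H ∘ₗ galLeft k H = LinearMap.id := LinearMap.ext galLeftInv_galLeft
    rw [this, LinearMap.lTensor_id_apply, LinearEquiv.symm_apply_apply, hst']
  rw [← h1, rTensor_mapLeft_unitMap] at ht0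
  have h2 := C.unitMap_injective hS hC _ ht0
  have h3 : C.actMap N w = 0 :=
    Module.Flat.rTensor_preserves_injective_linearMap (M := H) (f.restrictScalars k) hf
      (h2.trans (map_zero _).symm)
  rw [← h1, h3, map_zero]

/-- If `H` is left faithfully coflat over `C`, it is left faithfully flat over the coinvariants. -/
theorem coinvariants_isLeftFaithfullyFlat (hS : Function.Bijective (antipode k (A := H)))
    (hC : C.IsLeftFaithfullyCoflat) :
    C.coinvariants.IsLeftFaithfullyFlat := by
  refine LeftFaithfullyFlat.of_injective (fun N N' => ?_) fun N => ?_
  · intro _ _ _ _ _ _ _ _ f hf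
    exact C.mapLeft_injective hS hC f hf
  · intro _ _ _ _ h
    refine ⟨fun x y => ?_⟩
    have h0 : ∀ n : N, n = 0 := fun n => by
      -- When `N ⊗_A H` is zero, so is the target of `unitMap`; injectivity kills `n ⊗ 1`, and the
      -- counit gives `n = 0`.
      have h1 := C.unitMap_injective hS hC (n ⊗ₜ 1) (by
        induction C.unitMap N (n ⊗ₜ 1) with
        | zero => rfl
        | add a b ha hb => rw [ha, hb, add_zero]
        | tmul x y => rw [Subsingleton.elim x 0, zero_tmul])
      have h2 := congrArg
        (fun z => TensorProduct.rid k N ((counit (R := k) (A := H)).lTensor N z)) h1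
      simpa using h2
    rw [h0 x, h0 y]

end LeftModuleFactorCoalgebra

end CoinvariantsFlat

/-! ### The co-opposite Hopf algebra. -/

section CoOpposite

/-- The co-opposite of `H`: the same algebra with the opposite comultiplication. -/
def Cop (H : Type v) : Type v := H

namespace Cop

variable {k : Type u} {H : Type v} [Field k] [Ring H] [HopfAlgebra k H]

instance : Ring (Cop H) := inferInstanceAs (Ring H)

instance : Algebra k (Cop H) := inferInstanceAs (Algebra k H)

variable (k H) in
/-- The identity map `H → Cop H`. -/
def equiv : H ≃ₐ[k] Cop H := AlgEquiv.refl (A₁ := H)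

variable (k H) in
/-- The comultiplication of the co-opposite. -/
noncomputable def comulAux : Cop H →ₗ[k] Cop H ⊗[k] Cop H :=
  TensorProduct.map (equiv k H).toLinearMap (equiv k H).toLinearMap ∘ₗ
    (TensorProduct.comm k H H).toLinearMap ∘ₗ comul ∘ₗ (equiv k H).symm.toLinearMap

variable (k H) in
/-- The counit of the co-opposite. -/
noncomputable def counitAux : Cop H →ₗ[k] k := counit ∘ₗ (equiv k H).symm.toLinearMap

/-- The map `a ⊗ b ⊗ c ↦ c ⊗ b ⊗ a`. -/
noncomputable def reverse : H ⊗[k] (H ⊗[k] H) →ₗ[k] Cop H ⊗[k] (Cop H ⊗[k] Cop H) :=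
  TensorProduct.map (equiv k H).toLinearMap
    (TensorProduct.map (equiv k H).toLinearMap (equiv k H).toLinearMap) ∘ₗ
  (TensorProduct.assoc k H H H).toLinearMap ∘ₗ
  (TensorProduct.comm k H (H ⊗[k] H)).toLinearMap ∘ₗ
  (TensorProduct.comm k H H).toLinearMap.lTensor H

/-- With `lTensor_comulAux`, this reduces coassociativity of the co-opposite to that of `H` read
backwards. -/
theorem assoc_rTensor_comulAux (z : H ⊗[k] H) :
    TensorProduct.assoc k _ _ _ ((comulAux k H).rTensor (Cop H)
      (TensorProduct.map (equiv k H).toLinearMap (equiv k H).toLinearMap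
        (TensorProduct.comm k H H z))) = reverse (comul.lTensor H z) := by
  induction z with
  | zero => simp
  | add a b ha hb => simp only [map_add, ha, hb]
  | tmul a b =>
    change TensorProduct.assoc k _ _ _ ((TensorProduct.map (equiv k H).toLinearMap
      (equiv k H).toLinearMap (TensorProduct.comm k H H (comul b))) ⊗ₜ equiv k H a) =
      reverse (a ⊗ₜ comul b)
    induction comul (R := k) b with
    | zero => simp
    | add a b ha hb => simp only [map_add, add_tmul, tmul_add, ha, hb]
    | tmul a b => rfl

theorem lTensor_comulAux (z : H ⊗[k] H) :
    (comulAux k H).lTensor (Cop H)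
      (TensorProduct.map (equiv k H).toLinearMap (equiv k H).toLinearMap
        (TensorProduct.comm k H H z)) =
      reverse (TensorProduct.assoc k _ _ _ (comul.rTensor H z)) := by
  induction z with
  | zero => simp
  | add a b ha hb => simp only [map_add, ha, hb]
  | tmul a b =>
    change equiv k H b ⊗ₜ (TensorProduct.map (equiv k H).toLinearMap
      (equiv k H).toLinearMap (TensorProduct.comm k H H (comul a))) =
      reverse (TensorProduct.assoc k _ _ _ (comul a ⊗ₜ b))
    induction comul (R := k) a with
    | zero => simp
    | add a b ha hb => simp only [map_add, add_tmul, tmul_add, ha, hb]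
    | tmul a b => rfl

noncomputable instance : Coalgebra k (Cop H) where
  comul := comulAux k H
  counit := counitAux k H
  coassoc := by
    ext x
    obtain ⟨x, rfl⟩ := (equiv k H).surjective x
    refine (assoc_rTensor_comulAux (comul x)).trans ?_
    refine Eq.trans ?_ (lTensor_comulAux (comul x)).symm
    rw [Coalgebra.coassoc_apply]
  rTensor_counit_comp_comul := by
    have h : ∀ z : H ⊗[k] H, (counitAux k H).rTensor (Cop H)
        (TensorProduct.map (equiv k H).toLinearMap (equiv k H).toLinearMap
          (TensorProduct.comm k H H z)) =
        (equiv k H).toLinearMap.lTensor k (TensorProduct.comm k H k (counit.lTensor H z)) := by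
      intro z
      induction z with
      | zero => simp
      | add a b ha hb => simp only [map_add, ha, hb]
      | tmul a b => rfl
    ext x
    obtain ⟨x, rfl⟩ := (equiv k H).surjective x
    refine (h (comul x)).trans ?_
    rw [Coalgebra.lTensor_counit_comul]
    rfl
  lTensor_counit_comp_comul := by
    have h : ∀ z : H ⊗[k] H, (counitAux k H).lTensor (Cop H)
        (TensorProduct.map (equiv k H).toLinearMap (equiv k H).toLinearMap
          (TensorProduct.comm k H H z)) =
        (equiv k H).toLinearMap.rTensor k (TensorProduct.comm k k H (counit.rTensor H z)) := by
      intro z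
      induction z with
      | zero => simp
      | add a b ha hb => simp only [map_add, ha, hb]
      | tmul a b => rfl
    ext x
    obtain ⟨x, rfl⟩ := (equiv k H).surjective x
    refine (h (comul x)).trans ?_
    rw [Coalgebra.rTensor_counit_comul]
    rfl

theorem comul_equiv (x : H) : comul (R := k) (equiv k H x) =
    TensorProduct.map (equiv k H).toLinearMap (equiv k H).toLinearMap
      (TensorProduct.comm k H H (comul x)) := rfl

theorem counit_equiv (x : H) : counit (R := k) (equiv k H x) = counit (R := k) x := rfl

theorem map_comm_mul (z w : H ⊗[k] H) :
    TensorProduct.map (equiv k H).toLinearMap (equiv k H).toLinearMap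
      (TensorProduct.comm k H H (z * w)) =
    TensorProduct.map (equiv k H).toLinearMap (equiv k H).toLinearMap
      (TensorProduct.comm k H H z) *
    TensorProduct.map (equiv k H).toLinearMap (equiv k H).toLinearMap
      (TensorProduct.comm k H H w) := by
  induction z with
  | zero => simp
  | add a b ha hb => simp only [map_add, add_mul, ha, hb]
  | tmul a b =>
    induction w with
    | zero => simp
    | add a b ha hb => simp only [map_add, mul_add, ha, hb]
    | tmul c d =>
      simp only [Algebra.TensorProduct.tmul_mul_tmul, comm_tmul, TensorProduct.map_tmul]
      rfl

noncomputable instance : Bialgebra k (Cop H) :=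
  Bialgebra.mk' k (Cop H) (Bialgebra.counit_one (R := k) (A := H))
    (fun {a b} => Bialgebra.counit_mul (R := k) (A := H) a b)
    (by
      refine (congrArg (fun z => TensorProduct.map (equiv k H).toLinearMap
        (equiv k H).toLinearMap (TensorProduct.comm k H H z))
        (Bialgebra.comul_one (R := k) (A := H))).trans ?_
      rfl)
    (fun {a b} => (congrArg (fun z => TensorProduct.map (equiv k H).toLinearMap
      (equiv k H).toLinearMap (TensorProduct.comm k H H z))
      (Bialgebra.comul_mul (R := k) (A := H) a b)).trans (map_comm_mul _ _))

variable [hS : Fact (Function.Bijective (antipode k (A := H)))]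

/-- The antipode is `S⁻¹`; its axioms are `S⁻¹(x₂)x₁ = ε(x) = x₂S⁻¹(x₁)`. -/
noncomputable instance : HopfAlgebra k (Cop H) where
  antipode := (equiv k H).toLinearMap ∘ₗ (antipodeEquiv hS.out).symm.toLinearMap ∘ₗ
    (equiv k H).symm.toLinearMap
  mul_antipode_rTensor_comul := by
    ext x
    obtain ⟨x, rfl⟩ := (equiv k H).surjective x
    refine Eq.trans ?_ (congrArg (equiv k H) (mul_comm_rTensor_antipode_symm_comul hS.out x))
    change LinearMap.mul' k (Cop H) (LinearMap.rTensor _ _ (comul (equiv k H x))) = _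
    rw [comul_equiv]
    generalize comul (R := k) x = z
    induction z with
    | zero => simp
    | add a b ha hb => simp only [map_add, ha, hb]
    | tmul a b => rfl
  mul_antipode_lTensor_comul := by
    ext x
    obtain ⟨x, rfl⟩ := (equiv k H).surjective x
    refine Eq.trans ?_ (congrArg (equiv k H) (mul_comm_lTensor_antipode_symm_comul hS.out x))
    change LinearMap.mul' k (Cop H) (LinearMap.lTensor _ _ (comul (equiv k H x))) = _
    rw [comul_equiv]
    generalize comul (R := k) x = z
    induction z with
    | zero => simp
    | add a b ha hb => simp only [map_add, ha, hb]
    | tmul a b => rfl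

end Cop

end CoOpposite

/-! ### Passing subalgebras and factor coalgebras to the co-opposite. -/

section CoopEquiv

variable (k : Type u) (H H' : Type v) [Field k] [Ring H] [HopfAlgebra k H] [Ring H']
  [HopfAlgebra k H']

/-- An identification of `H'` with the co-opposite of `H`. The antipodes are then bijective and
inverse to each other. -/
structure CoopEquiv where
  equiv : H ≃ₐ[k] H'
  comul_apply : ∀ x, comul (R := k) (equiv x) =
    TensorProduct.map equiv.toLinearMap equiv.toLinearMap (TensorProduct.comm k H H (comul x))
  counit_apply : ∀ x, counit (R := k) (equiv x) = counit (R := k) x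
  antipode_apply : ∀ x, antipode k (equiv (antipode k x)) = equiv x
  antipode_symm_apply : ∀ y, antipode k (equiv.symm (antipode k y)) = equiv.symm y

variable {k H H'}

namespace CoopEquiv

variable (E : CoopEquiv k H H')

/-- The identity map from `H` to its co-opposite. -/
noncomputable def cop (k : Type u) (H : Type v) [Field k] [Ring H] [HopfAlgebra k H]
    [hS : Fact (Function.Bijective (antipode k (A := H)))] : CoopEquiv k H (Cop H) where
  equiv := Cop.equiv k H
  comul_apply := Cop.comul_equiv
  counit_apply := Cop.counit_equiv
  antipode_apply x := congrArg (Cop.equiv k H) (Takeuchi.symm_antipode_apply hS.out x)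
  antipode_symm_apply y := Takeuchi.antipode_symm_apply hS.out ((Cop.equiv k H).symm y)

/-- The inverse identification. -/
def symm : CoopEquiv k H' H where
  equiv := E.equiv.symm
  comul_apply y := by
    obtain ⟨x, rfl⟩ := E.equiv.surjective y
    rw [E.comul_apply, AlgEquiv.symm_apply_apply]
    generalize comul (R := k) x = z
    induction z with
    | zero => simp
    | add a b ha hb =>
      simp only [map_add]
      exact congrArg₂ (· + ·) ha hb
    | tmul a b => simp
  counit_apply y := by
    obtain ⟨x, rfl⟩ := E.equiv.surjective y
    rw [E.counit_apply, AlgEquiv.symm_apply_apply]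
  antipode_apply := E.antipode_symm_apply
  antipode_symm_apply := E.antipode_apply

theorem antipode_bijective (E : CoopEquiv k H H') : Function.Bijective (antipode k (A := H)) := by
  refine Function.bijective_iff_has_inverse.2
    ⟨fun x => E.equiv.symm (antipode k (E.equiv x)), fun x => ?_, fun x => ?_⟩
  · simp only [E.antipode_apply, AlgEquiv.symm_apply_apply]
  · simp only [E.antipode_symm_apply, AlgEquiv.symm_apply_apply]

theorem antipodeEquiv_symm_antipode (y : H') :
    (antipodeEquiv E.antipode_bijective).symm (antipode k (E.equiv.symm y)) = E.equiv.symm y :=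
  Takeuchi.symm_antipode_apply _ _

/-- The anti-isomorphism of algebras `S' ∘ e`, which is also comultiplicative. -/
theorem comul_antipode_equiv (x : H) : comul (R := k) (antipode k (E.equiv x)) =
    TensorProduct.map (antipode k ∘ₗ E.equiv.toLinearMap) (antipode k ∘ₗ E.equiv.toLinearMap)
      (comul x) := by
  rw [comul_antipode_apply, E.comul_apply]
  generalize comul (R := k) x = z
  induction z with
  | zero => simp
  | add a b ha hb => simp only [map_add, ha, hb]
  | tmul a b => simp

end CoopEquiv

namespace RightCoidealSubalgebra

/-- The right coideal subalgebra `S⁻¹(A)` of the co-opposite. -/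
def coop (E : CoopEquiv k H H') (A : RightCoidealSubalgebra k H) :
    RightCoidealSubalgebra k H' where
  carrier :=
    { carrier := {y | antipode k (E.equiv.symm y) ∈ A.carrier}
      mul_mem' := fun {x y} hx hy => by
        simp only [Set.mem_ofPred_eq] at hx hy ⊢
        rw [map_mul, antipode_mul_antidistrib]
        exact A.carrier.mul_mem hy hx
      add_mem' := fun {x y} hx hy => by
        simp only [Set.mem_ofPred_eq] at hx hy ⊢
        rw [map_add, map_add]
        exact A.carrier.add_mem hx hy
      algebraMap_mem' := fun r => by
        simp only [Set.mem_ofPred_eq]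
        rw [AlgEquiv.commutes, Algebra.algebraMap_eq_smul_one, map_smul, antipode_one]
        exact A.carrier.smul_mem A.carrier.one_mem r }
  comul_mem := fun y hy => by
    obtain ⟨x, rfl⟩ : ∃ x, y = antipode k (E.equiv x) :=
      ⟨antipode k (E.equiv.symm y), by
        have := E.antipode_apply (E.equiv.symm y)
        rw [AlgEquiv.apply_symm_apply] at this
        exact this.symm⟩
    replace hy : antipode k (E.equiv.symm (antipode k (E.equiv x))) ∈ A.carrier := hy
    rw [E.antipode_symm_apply, AlgEquiv.symm_apply_apply] at hy
    -- The flip from the antipode cancels the flip from the co-opposite, so `S' ∘ e` preserves the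
    -- order of the legs and carries `A ⊗ H` into `S⁻¹(A) ⊗ H'`.
    rw [E.comul_antipode_equiv]
    have h := A.comul_mem_span hy
    generalize comul (R := k) x = z at h ⊢
    induction h using Submodule.span_induction with
    | zero => simp
    | add x y _ _ hx hy =>
      rw [map_add]
      exact add_mem hx hy
    | smul c x _ hx =>
      rw [map_smul]
      exact Submodule.smul_mem _ _ hx
    | mem z hz =>
      obtain ⟨b, hb, h, rfl⟩ := hz
      have hb' : antipode k (E.equiv.symm (antipode k (E.equiv b))) ∈ A.carrier := by
        rwa [E.antipode_symm_apply, AlgEquiv.symm_apply_apply]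
      exact ⟨⟨antipode k (E.equiv b), hb'⟩ ⊗ₜ antipode k (E.equiv h), rfl⟩

variable (E : CoopEquiv k H H') (A : RightCoidealSubalgebra k H)

theorem mem_coop {y : H'} :
    y ∈ (A.coop E).carrier ↔ antipode k (E.equiv.symm y) ∈ A.carrier := Iff.rfl

theorem antipode_equiv_mem_coop {a : H} :
    antipode k (E.equiv a) ∈ (A.coop E).carrier ↔ a ∈ A.carrier := by
  rw [mem_coop, E.antipode_symm_apply, AlgEquiv.symm_apply_apply]

theorem coop_coop : (A.coop E).coop E.symm = A := by
  apply RightCoidealSubalgebra.ext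
  ext a
  exact A.antipode_equiv_mem_coop E

end RightCoidealSubalgebra

namespace LeftModuleFactorCoalgebra

/-- A left module factor coalgebra of `H`, regarded over the co-opposite. -/
def coop (E : CoopEquiv k H H') (C : LeftModuleFactorCoalgebra k H) :
    LeftModuleFactorCoalgebra k H' where
  ker := C.ker.comap E.equiv.symm
  isCoideal := by
    have hC := (Submodule.isCoideal_iff_comul_mem _).1 C.isCoideal
    rw [Submodule.isCoideal_iff_comul_mem]
    have hmem : ∀ z : C.ker.restrictScalars k,
        E.equiv z.1 ∈ (C.ker.comap E.equiv.symm).restrictScalars k := fun z => by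
      change E.equiv.symm (E.equiv z.1) ∈ C.ker
      rw [AlgEquiv.symm_apply_apply]
      exact z.2
    constructor
    · intro y hy
      rw [← E.equiv.apply_symm_apply y, E.counit_apply]
      exact hC.1 _ hy
    · intro y hy
      rw [← E.equiv.apply_symm_apply y, E.comul_apply]
      obtain ⟨a, ⟨a, rfl⟩, b, ⟨b, rfl⟩, h⟩ := Submodule.mem_sup.1 (hC.2 _ hy)
      -- The flip exchanges the summands `H ⊗ I` and `I ⊗ H`.
      rw [← h, map_add, map_add, add_comm]
      refine Submodule.add_mem_sup ?_ ?_
      · clear h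
        induction b with
        | zero => simp
        | add b c hb hc =>
          simp only [map_add]
          exact add_mem hb hc
        | tmul b c => exact ⟨E.equiv c ⊗ₜ ⟨_, hmem b⟩, rfl⟩
      · clear h
        induction a with
        | zero => simp
        | add b c hb hc =>
          simp only [map_add]
          exact add_mem hb hc
        | tmul b c => exact ⟨⟨_, hmem c⟩ ⊗ₜ E.equiv b, rfl⟩

variable (E : CoopEquiv k H H') (C : LeftModuleFactorCoalgebra k H)

theorem coop_coop : (C.coop E).coop E.symm = C := by
  apply LeftModuleFactorCoalgebra.ext
  ext x
  change E.equiv.symm (E.equiv x) ∈ C.ker ↔ x ∈ C.ker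
  rw [AlgEquiv.symm_apply_apply]

/-- The underlying linear isomorphism between a factor coalgebra and its co-opposite. -/
noncomputable def coopEquiv : C.Quot ≃ₗ[k] (C.coop E).Quot :=
  Submodule.Quotient.equiv _ _ E.equiv.toLinearEquiv (by
    ext y
    rw [Submodule.mem_map]
    constructor
    · rintro ⟨x, hx, rfl⟩
      change E.equiv.symm (E.equiv x) ∈ C.ker
      rwa [AlgEquiv.symm_apply_apply]
    · intro hy
      exact ⟨E.equiv.symm y, hy, E.equiv.apply_symm_apply y⟩)

theorem coopEquiv_mkQ (x : H) : C.coopEquiv E (C.mkQ x) = (C.coop E).mkQ (E.equiv x) := rfl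

theorem rTensor_mkQ_comul_equiv (x : H) :
    (C.coop E).mkQ.rTensor H' (comul (E.equiv x)) =
      TensorProduct.map (C.coopEquiv E).toLinearMap E.equiv.toLinearMap
        (TensorProduct.comm k H C.Quot (C.mkQ.lTensor H (comul x))) := by
  rw [E.comul_apply]
  generalize comul (R := k) x = z
  induction z with
  | zero => simp
  | add a b ha hb => simp only [map_add, ha, hb]
  | tmul a b => rfl

/-- If `S(y)` is left coinvariant, then `y = S⁻¹(S(y))` is right coinvariant, which is left
coinvariance over the co-opposite. -/
theorem coinvariants_coop_le :
    (C.coinvariants.coop E).carrier ≤ (C.coop E).coinvariants.carrier := by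
  intro y hy
  have h := C.lTensor_mkQ_comul_antipode_symm E.antipode_bijective hy
  rw [E.antipodeEquiv_symm_antipode] at h
  rw [mem_coinvariants]
  have h2 := C.rTensor_mkQ_comul_equiv E (E.equiv.symm y)
  rw [h, AlgEquiv.apply_symm_apply] at h2
  refine h2.trans ?_
  change C.coopEquiv E (C.mkQ 1) ⊗ₜ E.equiv (E.equiv.symm y) = _
  rw [coopEquiv_mkQ, AlgEquiv.apply_symm_apply, map_one]

/-- Being co-opposite is a symmetric relation, so the reverse inclusion is `coinvariants_coop_le`
for `E.symm`. -/
theorem coinvariants_coop : (C.coop E).coinvariants = C.coinvariants.coop E := by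
  apply RightCoidealSubalgebra.ext
  refine le_antisymm (fun y hy => ?_) (C.coinvariants_coop_le E)
  have h := (C.coop E).coinvariants_coop_le E.symm
  rw [coop_coop] at h
  apply h
  change antipode k (E.equiv (antipode k (E.equiv.symm y))) ∈ (C.coop E).coinvariants.carrier
  rwa [E.antipode_apply, AlgEquiv.apply_symm_apply]

end LeftModuleFactorCoalgebra

namespace RightCoidealSubalgebra

variable (E : CoopEquiv k H H') (A : RightCoidealSubalgebra k H)

/-- If `S(y) ∈ A`, then `π(y) = ε(S(y))π(1) = ε(y)π(1)` by `mkQ_antipode_symm`, so `y` lies in `HA⁺`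
when `ε(y) = 0`. As for coinvariants, equality follows by symmetry. -/
theorem ker_factor_coop_le : (A.coop E).factor.ker ≤ (A.factor.coop E).ker := by
  refine Ideal.span_le.2 ?_
  rintro y ⟨hy, hy0⟩
  have h := A.factor.mkQ_antipode_symm E.antipode_bijective (A.mem_coinvariants_factor hy)
  rw [E.antipodeEquiv_symm_antipode, counit_antipode, ← E.counit_apply,
    AlgEquiv.apply_symm_apply, hy0, zero_smul] at h
  exact A.factor.mkQ_eq_zero.1 h

theorem factor_coop : (A.coop E).factor = A.factor.coop E := by
  apply LeftModuleFactorCoalgebra.ext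
  refine le_antisymm (A.ker_factor_coop_le E) (fun y hy => ?_)
  have h := (A.coop E).ker_factor_coop_le E.symm
  rw [coop_coop] at h
  have h2 := h hy
  change E.equiv (E.equiv.symm y) ∈ (A.coop E).factor.ker at h2
  rwa [AlgEquiv.apply_symm_apply] at h2

end RightCoidealSubalgebra

end CoopEquiv

/-! ### Faithful flatness along an anti-isomorphism of algebras. -/

section FlatTransport

variable {k : Type u} {A A' : Type v} [Field k] [Ring A] [Algebra k A] [Ring A'] [Algebra k A']
  (θ : A ≃ₐ[k] A'ᵐᵒᵖ)
  {P : Type v} [AddCommGroup P] [Module k P] [Module Aᵐᵒᵖ P]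
  {P' : Type v} [AddCommGroup P'] [Module k P'] [Module A' P']
  (s : P ≃ₗ[k] P') (hs : ∀ (a : A) (p : P), s (MulOpposite.op a • p) = (θ a).unop • s p)
  {N : Type v} [AddCommGroup N] [Module k N] [Module A N] [Module A'ᵐᵒᵖ N]
  (hN : ∀ (a : A) (n : N), θ a • n = a • n)
  {N' : Type v} [AddCommGroup N'] [Module k N'] [Module A N'] [Module A'ᵐᵒᵖ N']
  (hN' : ∀ (a : A) (n : N'), θ a • n = a • n)

/-- The isomorphism `P ⊗_A N ≃ N ⊗_{A'} P'` along an anti-isomorphism `A ≃ A'`. -/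
noncomputable def TensorOver.flip : TensorOver k A P N ≃ₗ[k] TensorOver k A' N P' :=
  Submodule.Quotient.equiv _ _
    (TensorProduct.comm k P N ≪≫ₗ TensorProduct.congr (LinearEquiv.refl k N) s) (by
      rw [balancedRel, balancedRel, Submodule.map_span]
      refine le_antisymm (Submodule.span_le.2 ?_) (Submodule.span_le.2 ?_)
      · rintro _ ⟨_, ⟨p, a, n, rfl⟩, rfl⟩
        rw [SetLike.mem_coe, ← neg_mem_iff]
        refine Submodule.subset_span ⟨n, (θ a).unop, s p, ?_⟩
        rw [MulOpposite.op_unop, hN, ← hs]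
        simp
      · rintro _ ⟨n, a', p', rfl⟩
        obtain ⟨p, rfl⟩ := s.surjective p'
        obtain ⟨a, ha⟩ := θ.surjective (MulOpposite.op a')
        rw [SetLike.mem_coe, ← neg_mem_iff]
        refine Submodule.subset_span ⟨_, ⟨p, a, n, rfl⟩, ?_⟩
        rw [← ha, hN, ← MulOpposite.unop_op a', ← ha, ← hs]
        simp)

theorem TensorOver.flip_mapRight [IsScalarTower k A N] [IsScalarTower k A N']
    [IsScalarTower k A'ᵐᵒᵖ N] [IsScalarTower k A'ᵐᵒᵖ N'] (f : N →ₗ[A] N') (f' : N →ₗ[A'ᵐᵒᵖ] N')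
    (hf : ∀ n, f n = f' n) (t : TensorOver k A P N) :
    TensorOver.flip θ s hs hN' (TensorOver.mapRight k P f t) =
      TensorOver.mapLeft k P' f' (TensorOver.flip θ s hs hN t) := by
  obtain ⟨t, rfl⟩ := Submodule.mkQ_surjective _ t
  induction t with
  | zero => simp
  | add a b ha hb => simp only [map_add, ha, hb]
  | tmul p n =>
    change Submodule.mkQ _ (f n ⊗ₜ s p) = Submodule.mkQ _ (f' n ⊗ₜ s p)
    rw [hf]

/-- Restriction along `θ` turns right `A'`-modules into left `A`-modules, and `TensorOver.flip` is
then a natural isomorphism between the two tensor functors. The converse restricts along `θ.symm`.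
-/
theorem RightFaithfullyFlat.left_of_antiEquiv (θ : A ≃ₐ[k] A'ᵐᵒᵖ) (s : P ≃ₗ[k] P')
    (hs : ∀ (a : A) (p : P), s (MulOpposite.op a • p) = (θ a).unop • s p)
    (hP : RightFaithfullyFlat k A P) :
    LeftFaithfullyFlat k A' P' where
  exact N₁ N₂ N₃ _ _ _ _ _ _ _ _ _ _ _ _ f g hfg := by
    let := Module.compHom N₁ (θ : A →+* A'ᵐᵒᵖ)
    let := Module.compHom N₂ (θ : A →+* A'ᵐᵒᵖ)
    let := Module.compHom N₃ (θ : A →+* A'ᵐᵒᵖ)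
    have h₁ : ∀ (a : A) (n : N₁), θ a • n = a • n := fun _ _ => rfl
    have h₂ : ∀ (a : A) (n : N₂), θ a • n = a • n := fun _ _ => rfl
    have h₃ : ∀ (a : A) (n : N₃), θ a • n = a • n := fun _ _ => rfl
    have : IsScalarTower k A N₁ := ⟨fun c a n => by rw [← h₁, ← h₁, map_smul, smul_assoc]⟩
    have : IsScalarTower k A N₂ := ⟨fun c a n => by rw [← h₂, ← h₂, map_smul, smul_assoc]⟩
    have : IsScalarTower k A N₃ := ⟨fun c a n => by rw [← h₃, ← h₃, map_smul, smul_assoc]⟩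
    let f' : N₁ →ₗ[A] N₂ := { f.toAddMonoidHom with map_smul' := fun a n => f.map_smul (θ a) n }
    let g' : N₂ →ₗ[A] N₃ := { g.toAddMonoidHom with map_smul' := fun a n => g.map_smul (θ a) n }
    refine Function.Exact.of_ladder_linearEquiv_of_exact (e₁ := TensorOver.flip θ s hs h₁)
      (e₂ := TensorOver.flip θ s hs h₂) (e₃ := TensorOver.flip θ s hs h₃) ?_ ?_
      (hP.exact N₁ N₂ N₃ f' g' hfg)
    · refine LinearMap.ext fun t => ?_
      exact (TensorOver.flip_mapRight θ s hs h₁ h₂ f' f (fun _ => rfl) t).symm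
    · refine LinearMap.ext fun t => ?_
      exact (TensorOver.flip_mapRight θ s hs h₂ h₃ g' g (fun _ => rfl) t).symm
  nontrivial N _ _ _ _ hN := by
    let := Module.compHom N (θ : A →+* A'ᵐᵒᵖ)
    have h : ∀ (a : A) (n : N), θ a • n = a • n := fun _ _ => rfl
    have : IsScalarTower k A N := ⟨fun c a n => by rw [← h, ← h, map_smul, smul_assoc]⟩
    exact (TensorOver.flip θ s hs h).toEquiv.nontrivial_congr.1 (hP.nontrivial N hN)

theorem LeftFaithfullyFlat.right_of_antiEquiv (θ : A ≃ₐ[k] A'ᵐᵒᵖ) (s : P ≃ₗ[k] P')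
    (hs : ∀ (a : A) (p : P), s (MulOpposite.op a • p) = (θ a).unop • s p)
    (hP : LeftFaithfullyFlat k A' P') :
    RightFaithfullyFlat k A P where
  exact N₁ N₂ N₃ _ _ _ _ _ _ _ _ _ _ _ _ f g hfg := by
    let := Module.compHom N₁ (θ.symm : A'ᵐᵒᵖ →+* A)
    let := Module.compHom N₂ (θ.symm : A'ᵐᵒᵖ →+* A)
    let := Module.compHom N₃ (θ.symm : A'ᵐᵒᵖ →+* A)
    have h₁' : ∀ (a : A'ᵐᵒᵖ) (n : N₁), θ.symm a • n = a • n := fun _ _ => rfl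
    have h₂' : ∀ (a : A'ᵐᵒᵖ) (n : N₂), θ.symm a • n = a • n := fun _ _ => rfl
    have h₃' : ∀ (a : A'ᵐᵒᵖ) (n : N₃), θ.symm a • n = a • n := fun _ _ => rfl
    have h₁ : ∀ (a : A) (n : N₁), θ a • n = a • n := fun a n => by
      rw [← h₁', AlgEquiv.symm_apply_apply]
    have h₂ : ∀ (a : A) (n : N₂), θ a • n = a • n := fun a n => by
      rw [← h₂', AlgEquiv.symm_apply_apply]
    have h₃ : ∀ (a : A) (n : N₃), θ a • n = a • n := fun a n => by
      rw [← h₃', AlgEquiv.symm_apply_apply]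
    have : IsScalarTower k A'ᵐᵒᵖ N₁ := ⟨fun c a n => by rw [← h₁', ← h₁', map_smul, smul_assoc]⟩
    have : IsScalarTower k A'ᵐᵒᵖ N₂ := ⟨fun c a n => by rw [← h₂', ← h₂', map_smul, smul_assoc]⟩
    have : IsScalarTower k A'ᵐᵒᵖ N₃ := ⟨fun c a n => by rw [← h₃', ← h₃', map_smul, smul_assoc]⟩
    let f' : N₁ →ₗ[A'ᵐᵒᵖ] N₂ :=
      { f.toAddMonoidHom with map_smul' := fun a n => f.map_smul (θ.symm a) n }
    let g' : N₂ →ₗ[A'ᵐᵒᵖ] N₃ :=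
      { g.toAddMonoidHom with map_smul' := fun a n => g.map_smul (θ.symm a) n }
    refine Function.Exact.of_ladder_linearEquiv_of_exact
      (e₁ := (TensorOver.flip θ s hs h₁).symm) (e₂ := (TensorOver.flip θ s hs h₂).symm)
      (e₃ := (TensorOver.flip θ s hs h₃).symm) ?_ ?_ (hP.exact N₁ N₂ N₃ f' g' hfg)
    · refine LinearMap.ext fun t => ?_
      obtain ⟨t, rfl⟩ := (TensorOver.flip θ s hs h₁).surjective t
      simp only [LinearMap.comp_apply, LinearEquiv.coe_coe, LinearEquiv.symm_apply_apply]
      rw [← TensorOver.flip_mapRight θ s hs h₁ h₂ f f' (fun _ => rfl) t,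
        LinearEquiv.symm_apply_apply]
    · refine LinearMap.ext fun t => ?_
      obtain ⟨t, rfl⟩ := (TensorOver.flip θ s hs h₂).surjective t
      simp only [LinearMap.comp_apply, LinearEquiv.coe_coe, LinearEquiv.symm_apply_apply]
      rw [← TensorOver.flip_mapRight θ s hs h₂ h₃ g g' (fun _ => rfl) t,
        LinearEquiv.symm_apply_apply]
  nontrivial N _ _ _ _ hN := by
    let := Module.compHom N (θ.symm : A'ᵐᵒᵖ →+* A)
    have h' : ∀ (a : A'ᵐᵒᵖ) (n : N), θ.symm a • n = a • n := fun _ _ => rfl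
    have h : ∀ (a : A) (n : N), θ a • n = a • n := fun a n => by
      rw [← h', AlgEquiv.symm_apply_apply]
    have : IsScalarTower k A'ᵐᵒᵖ N := ⟨fun c a n => by rw [← h', ← h', map_smul, smul_assoc]⟩
    exact (TensorOver.flip θ s hs h).toEquiv.nontrivial_congr.2 (hP.nontrivial N hN)

end FlatTransport

namespace RightCoidealSubalgebra

variable {k : Type u} {H H' : Type v} [Field k] [Ring H] [HopfAlgebra k H] [Ring H']
  [HopfAlgebra k H'] (E : CoopEquiv k H H') (A : RightCoidealSubalgebra k H)

/-- The anti-isomorphism `S' ∘ e` from `H` to `H'`. -/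
noncomputable def antipodeCoop : H ≃ₗ[k] H' where
  toFun x := antipode k (E.equiv x)
  map_add' x y := by rw [map_add, map_add]
  map_smul' c x := by rw [map_smul, map_smul, RingHom.id_apply]
  invFun y := antipode k (E.equiv.symm y)
  left_inv x := by simp only [E.antipode_symm_apply, AlgEquiv.symm_apply_apply]
  right_inv y := by simp only [E.antipode_apply, AlgEquiv.apply_symm_apply]

theorem antipodeCoop_apply (x : H) : antipodeCoop E x = antipode k (E.equiv x) := rfl

theorem antipodeCoop_mul (x y : H) :
    antipodeCoop E (x * y) = antipodeCoop E y * antipodeCoop E x := by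
  simp only [antipodeCoop_apply, map_mul, antipode_mul_antidistrib]

/-- The anti-isomorphism between a right coideal subalgebra and its co-opposite. -/
noncomputable def coopAlgEquiv : A.carrier ≃ₐ[k] (A.coop E).carrierᵐᵒᵖ :=
  AlgEquiv.ofLinearEquiv
    { toFun := fun a => MulOpposite.op ⟨antipodeCoop E a, (A.antipode_equiv_mem_coop E).2 a.2⟩
      map_add' := fun a b => by
        apply MulOpposite.unop_injective
        exact Subtype.ext (map_add (antipodeCoop E) (a : H) b)
      map_smul' := fun c a => by
        apply MulOpposite.unop_injective
        exact Subtype.ext (map_smul (antipodeCoop E) c (a : H))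
      invFun := fun b => ⟨(antipodeCoop E).symm b.unop, b.unop.2⟩
      left_inv := fun a => Subtype.ext ((antipodeCoop E).symm_apply_apply a)
      right_inv := fun b => by
        apply MulOpposite.unop_injective
        exact Subtype.ext ((antipodeCoop E).apply_symm_apply b.unop) }
    (by
      apply MulOpposite.unop_injective
      refine Subtype.ext ?_
      change antipode k (E.equiv 1) = 1
      rw [map_one, antipode_one])
    (fun a b => by
      apply MulOpposite.unop_injective
      exact Subtype.ext (antipodeCoop_mul E (a : H) b))

/-- The anti-multiplicative bijection `S' ∘ e` turns right multiplication by `A` on `H` into left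
multiplication by `S⁻¹(A)` on `H'`. -/
theorem coop_isLeftFaithfullyFlat (hA : A.IsRightFaithfullyFlat) :
    (A.coop E).IsLeftFaithfullyFlat :=
  letI := A.rightModule
  RightFaithfullyFlat.left_of_antiEquiv (A.coopAlgEquiv E) (antipodeCoop E)
    (fun a p => antipodeCoop_mul E p (a : H)) hA

theorem isRightFaithfullyFlat_of_coop (hA : (A.coop E).IsLeftFaithfullyFlat) :
    A.IsRightFaithfullyFlat :=
  letI := A.rightModule
  LeftFaithfullyFlat.right_of_antiEquiv (A.coopAlgEquiv E) (antipodeCoop E)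
    (fun a p => antipodeCoop_mul E p (a : H)) hA

end RightCoidealSubalgebra

/-! ### Faithful coflatness along an anti-isomorphism of coalgebras. -/

section CoflatTransport

variable {k : Type u} {C C' : Type v} [Field k] [AddCommGroup C] [Module k C] [Coalgebra k C]
  [AddCommGroup C'] [Module k C'] [Coalgebra k C'] (ψ : C ≃ₗ[k] C')

section Flip

variable (hψ : ∀ c, comul (R := k) (ψ c) =
    TensorProduct.map ψ.toLinearMap ψ.toLinearMap (TensorProduct.comm k C C (comul c)))
  (hψ' : ∀ c, Coalgebra.counit (R := k) (ψ c) = Coalgebra.counit (R := k) c)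
  {V : Type v} [AddCommGroup V] [Module k V]

/-- A left comodule over `C` is a right comodule over a coalgebra anti-isomorphic to `C`. -/
noncomputable def LeftComodule.flip (ρ : LeftComodule k C V) : RightComodule k C' V where
  coact := ψ.toLinearMap.lTensor V ∘ₗ (TensorProduct.comm k C V).toLinearMap ∘ₗ ρ.coact
  coassoc := by
    let R : C ⊗[k] (C ⊗[k] V) →ₗ[k] V ⊗[k] (C' ⊗[k] C') :=
      TensorProduct.map LinearMap.id (TensorProduct.map ψ.toLinearMap ψ.toLinearMap) ∘ₗ
      (TensorProduct.assoc k V C C).toLinearMap ∘ₗ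
      (TensorProduct.comm k C (V ⊗[k] C)).toLinearMap ∘ₗ
      (TensorProduct.comm k C V).toLinearMap.lTensor C
    have h1 : ∀ z : C ⊗[k] V, TensorProduct.assoc k V C' C'
        ((ψ.toLinearMap.lTensor V ∘ₗ (TensorProduct.comm k C V).toLinearMap ∘ₗ ρ.coact).rTensor C'
          (ψ.toLinearMap.lTensor V (TensorProduct.comm k C V z))) = R (ρ.coact.lTensor C z) := by
      intro z
      induction z with
      | zero => simp
      | add a b ha hb => simp only [map_add, ha, hb]
      | tmul c v =>
        change TensorProduct.assoc k V C' C' (ψ.toLinearMap.lTensor V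
          (TensorProduct.comm k C V (ρ.coact v)) ⊗ₜ ψ c) = R (c ⊗ₜ ρ.coact v)
        induction ρ.coact v with
        | zero => simp
        | add a b ha hb => simp only [map_add, add_tmul, tmul_add, ha, hb]
        | tmul d v => rfl
    have h2 : ∀ z : C ⊗[k] V, (comul (R := k) (A := C')).lTensor V
        (ψ.toLinearMap.lTensor V (TensorProduct.comm k C V z)) =
        R (TensorProduct.assoc k C C V (comul.rTensor V z)) := by
      intro z
      induction z with
      | zero => simp
      | add a b ha hb => simp only [map_add, ha, hb]
      | tmul c v =>
        change v ⊗ₜ comul (ψ c) = R (TensorProduct.assoc k C C V (comul c ⊗ₜ v))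
        rw [hψ]
        induction comul (R := k) c with
        | zero => simp
        | add a b ha hb => simp only [map_add, add_tmul, tmul_add, ha, hb]
        | tmul d v => rfl
    ext v
    refine (h1 (ρ.coact v)).trans (Eq.trans ?_ (h2 (ρ.coact v)).symm)
    exact congrArg R (LinearMap.congr_fun ρ.coassoc v).symm
  counit := by
    have h : ∀ z : C ⊗[k] V, TensorProduct.rid k V ((Coalgebra.counit (R := k) (A := C')).lTensor V
        (ψ.toLinearMap.lTensor V (TensorProduct.comm k C V z))) =
        TensorProduct.lid k V ((Coalgebra.counit (R := k) (A := C)).rTensor V z) := by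
      intro z
      induction z with
      | zero => simp
      | add a b ha hb => simp only [map_add, ha, hb]
      | tmul c v => simp [hψ']
    ext v
    exact (h (ρ.coact v)).trans (LinearMap.congr_fun ρ.counit v)

/-- A right comodule over `C` is a left comodule over a coalgebra anti-isomorphic to `C`. -/
noncomputable def RightComodule.flip (ρ : RightComodule k C V) : LeftComodule k C' V where
  coact := ψ.toLinearMap.rTensor V ∘ₗ (TensorProduct.comm k V C).toLinearMap ∘ₗ ρ.coact
  coassoc := by
    let R : V ⊗[k] (C ⊗[k] C) →ₗ[k] C' ⊗[k] (C' ⊗[k] V) :=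
      TensorProduct.map ψ.toLinearMap (TensorProduct.map ψ.toLinearMap LinearMap.id) ∘ₗ
      (TensorProduct.assoc k C C V).toLinearMap ∘ₗ
      (TensorProduct.comm k V (C ⊗[k] C)).toLinearMap ∘ₗ
      (TensorProduct.comm k C C).toLinearMap.lTensor V
    have h1 : ∀ z : V ⊗[k] C, TensorProduct.assoc k C' C' V ((comul (R := k) (A := C')).rTensor V
        (ψ.toLinearMap.rTensor V (TensorProduct.comm k V C z))) = R (comul.lTensor V z) := by
      intro z
      induction z with
      | zero => simp
      | add a b ha hb => simp only [map_add, ha, hb]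
      | tmul v c =>
        change TensorProduct.assoc k C' C' V (comul (ψ c) ⊗ₜ v) = R (v ⊗ₜ comul c)
        rw [hψ]
        induction comul (R := k) c with
        | zero => simp
        | add a b ha hb => simp only [map_add, add_tmul, tmul_add, ha, hb]
        | tmul d v => rfl
    have h2 : ∀ z : V ⊗[k] C,
        (ψ.toLinearMap.rTensor V ∘ₗ (TensorProduct.comm k V C).toLinearMap ∘ₗ ρ.coact).lTensor C'
          (ψ.toLinearMap.rTensor V (TensorProduct.comm k V C z)) =
        R (TensorProduct.assoc k V C C (ρ.coact.rTensor C z)) := by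
      intro z
      induction z with
      | zero => simp
      | add a b ha hb => simp only [map_add, ha, hb]
      | tmul v c =>
        change ψ c ⊗ₜ (ψ.toLinearMap.rTensor V
          (TensorProduct.comm k V C (ρ.coact v))) =
          R (TensorProduct.assoc k V C C (ρ.coact v ⊗ₜ c))
        induction ρ.coact v with
        | zero => simp
        | add a b ha hb => simp only [map_add, add_tmul, tmul_add, ha, hb]
        | tmul d v => rfl
    ext v
    refine (h1 (ρ.coact v)).trans (Eq.trans ?_ (h2 (ρ.coact v)).symm)
    exact congrArg R (LinearMap.congr_fun ρ.coassoc v).symm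
  counit := by
    have h : ∀ z : V ⊗[k] C, TensorProduct.lid k V ((Coalgebra.counit (R := k) (A := C')).rTensor V
        (ψ.toLinearMap.rTensor V (TensorProduct.comm k V C z))) =
        TensorProduct.rid k V ((Coalgebra.counit (R := k) (A := C)).lTensor V z) := by
      intro z
      induction z with
      | zero => simp
      | add a b ha hb => simp only [map_add, ha, hb]
      | tmul c v => simp [hψ']
    ext v
    exact (h (ρ.coact v)).trans (LinearMap.congr_fun ρ.counit v)

end Flip

variable {M M' : Type v} [AddCommGroup M] [Module k M] [AddCommGroup M'] [Module k M']
  {V W : Type v} [AddCommGroup V] [Module k V] [AddCommGroup W] [Module k W]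
  {τ : RightComodule k C M} {τ' : LeftComodule k C' M'} (s : M ≃ₗ[k] M')
  (hs : ∀ m, τ'.coact (s m) =
    TensorProduct.map ψ.toLinearMap s.toLinearMap (TensorProduct.comm k M C (τ.coact m)))
  {ρ : LeftComodule k C V} {ρ' : RightComodule k C' V}
  (hρ : ∀ v, ρ'.coact v = ψ.toLinearMap.lTensor V (TensorProduct.comm k C V (ρ.coact v)))
  {σ : LeftComodule k C W} {σ' : RightComodule k C' W}
  (hσ : ∀ v, σ'.coact v = ψ.toLinearMap.lTensor W (TensorProduct.comm k C W (σ.coact v)))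

variable (V) in
/-- The isomorphism `M ⊗ V ≃ V ⊗ M'` induced by `M ≃ M'`. -/
noncomputable def commCongr : M ⊗[k] V ≃ₗ[k] V ⊗[k] M' :=
  TensorProduct.comm k M V ≪≫ₗ TensorProduct.congr (LinearEquiv.refl k V) s

/-- The reversal `m ⊗ c ⊗ v ↦ v ⊗ ψ(c) ⊗ s(m)` exchanges the two sides of the equation defining the
cotensor product. -/
theorem mem_cotensor_flip (ψ : C ≃ₗ[k] C') (s : M ≃ₗ[k] M')
    (hs : ∀ m, τ'.coact (s m) =
      TensorProduct.map ψ.toLinearMap s.toLinearMap (TensorProduct.comm k M C (τ.coact m)))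
    (hρ : ∀ v, ρ'.coact v = ψ.toLinearMap.lTensor V (TensorProduct.comm k C V (ρ.coact v)))
    (t : M ⊗[k] V) :
    t ∈ cotensor τ ρ ↔ commCongr V s t ∈ cotensor ρ' τ' := by
  let Θ : M ⊗[k] (C ⊗[k] V) ≃ₗ[k] V ⊗[k] (C' ⊗[k] M') :=
    TensorProduct.congr (LinearEquiv.refl k M) (TensorProduct.comm k C V) ≪≫ₗ
      TensorProduct.comm k M (V ⊗[k] C) ≪≫ₗ TensorProduct.assoc k V C M ≪≫ₗ
      TensorProduct.congr (LinearEquiv.refl k V) (TensorProduct.congr ψ s)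
  have h1 : ∀ t : M ⊗[k] V, Θ (TensorProduct.assoc k M C V (τ.coact.rTensor V t)) =
      τ'.coact.lTensor V (commCongr V s t) := by
    intro t
    induction t with
    | zero => simp
    | add a b ha hb => simp only [map_add, ha, hb]
    | tmul m v =>
      change Θ (TensorProduct.assoc k M C V (τ.coact m ⊗ₜ v)) = v ⊗ₜ τ'.coact (s m)
      rw [hs]
      induction τ.coact m with
      | zero => simp
      | add a b ha hb => simp only [map_add, add_tmul, tmul_add, ha, hb]
      | tmul a b => rfl
  have h2 : ∀ t : M ⊗[k] V, Θ (ρ.coact.lTensor M t) =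
      TensorProduct.assoc k V C' M' (ρ'.coact.rTensor M' (commCongr V s t)) := by
    intro t
    induction t with
    | zero => simp
    | add a b ha hb => simp only [map_add, ha, hb]
    | tmul m v =>
      change Θ (m ⊗ₜ ρ.coact v) = TensorProduct.assoc k V C' M' (ρ'.coact v ⊗ₜ s m)
      rw [hρ]
      induction ρ.coact v with
      | zero => simp
      | add a b ha hb => simp only [map_add, add_tmul, tmul_add, ha, hb]
      | tmul a b => rfl
  rw [mem_cotensor, mem_cotensor, ← h1, ← h2, Θ.injective.eq_iff, eq_comm]

/-- The isomorphism `M □_C V ≃ V □_{C'} M'` along an anti-isomorphism `C ≃ C'`. -/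
noncomputable def cotensorFlip : cotensor τ ρ ≃ₗ[k] cotensor ρ' τ' :=
  (commCongr V s).ofSubmodules _ _ (by
    ext t
    obtain ⟨t, rfl⟩ := (commCongr V s).surjective t
    rw [← mem_cotensor_flip ψ s hs hρ]
    simp)

theorem cotensorFlip_mapRight (f : V →ₗ[k] W) (hf : ρ.IsColinear σ f) (hf' : ρ'.IsColinear σ' f)
    (t : cotensor τ ρ) : cotensorFlip ψ s hs hσ (cotensorMapRight τ f hf t) =
      cotensorMapLeft τ' f hf' (cotensorFlip ψ s hs hρ t) := by
  have h : ∀ t : M ⊗[k] V, commCongr W s (f.lTensor M t) = f.rTensor M' (commCongr V s t) := by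
    intro t
    induction t with
    | zero => simp
    | add a b ha hb => simp only [map_add, ha, hb]
    | tmul m v => rfl
  exact Subtype.ext (h t)

theorem isColinear_flip_iff (ψ : C ≃ₗ[k] C')
    (hρ : ∀ v, ρ'.coact v = ψ.toLinearMap.lTensor V (TensorProduct.comm k C V (ρ.coact v)))
    (hσ : ∀ v, σ'.coact v = ψ.toLinearMap.lTensor W (TensorProduct.comm k C W (σ.coact v)))
    (f : V →ₗ[k] W) : ρ.IsColinear σ f ↔ ρ'.IsColinear σ' f := by
  have h : ∀ z : C ⊗[k] V, ψ.toLinearMap.lTensor W (TensorProduct.comm k C W (f.lTensor C z)) =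
      f.rTensor C' (ψ.toLinearMap.lTensor V (TensorProduct.comm k C V z)) := by
    intro z
    induction z with
    | zero => simp
    | add a b ha hb => simp only [map_add, ha, hb]
    | tmul m v => rfl
  have hinj : Function.Injective (TensorProduct.comm k C W ≪≫ₗ
      TensorProduct.congr (LinearEquiv.refl k W) ψ) := LinearEquiv.injective _
  constructor
  · intro hf
    ext v
    rw [LinearMap.comp_apply, LinearMap.comp_apply, hρ, hσ, ← h]
    exact congrArg (fun z => ψ.toLinearMap.lTensor W (TensorProduct.comm k C W z))
      (LinearMap.congr_fun hf v)
  · intro hf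
    ext v
    apply hinj
    refine (hσ (f v)).symm.trans ((LinearMap.congr_fun hf v).trans ?_)
    rw [LinearMap.comp_apply, hρ, ← h]
    rfl

theorem LeftComodule.FaithfullyCoflat.right_of_antiEquiv (ψ : C ≃ₗ[k] C') (s : M ≃ₗ[k] M')
    (hs : ∀ m, τ'.coact (s m) =
      TensorProduct.map ψ.toLinearMap s.toLinearMap (TensorProduct.comm k M C (τ.coact m)))
    (hψ : ∀ c, comul (R := k) (ψ c) =
      TensorProduct.map ψ.toLinearMap ψ.toLinearMap (TensorProduct.comm k C C (comul c)))
    (hψ' : ∀ c, Coalgebra.counit (R := k) (ψ c) = Coalgebra.counit (R := k) c)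
    (hτ : τ'.FaithfullyCoflat) :
    τ.FaithfullyCoflat where
  exact V₁ V₂ V₃ _ _ _ _ _ _ ρ₁ ρ₂ ρ₃ f g hf hg hfg := by
    have h₁ : ∀ v, (ρ₁.flip ψ hψ hψ').coact v =
      ψ.toLinearMap.lTensor V₁ (TensorProduct.comm k C V₁ (ρ₁.coact v)) := fun _ => rfl
    have h₂ : ∀ v, (ρ₂.flip ψ hψ hψ').coact v =
      ψ.toLinearMap.lTensor V₂ (TensorProduct.comm k C V₂ (ρ₂.coact v)) := fun _ => rfl
    have h₃ : ∀ v, (ρ₃.flip ψ hψ hψ').coact v =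
      ψ.toLinearMap.lTensor V₃ (TensorProduct.comm k C V₃ (ρ₃.coact v)) := fun _ => rfl
    have hf' := (isColinear_flip_iff ψ h₁ h₂ f).1 hf
    have hg' := (isColinear_flip_iff ψ h₂ h₃ g).1 hg
    refine Function.Exact.of_ladder_linearEquiv_of_exact
      (e₁ := (cotensorFlip ψ s hs h₁).symm) (e₂ := (cotensorFlip ψ s hs h₂).symm)
      (e₃ := (cotensorFlip ψ s hs h₃).symm) ?_ ?_
      (hτ.exact V₁ V₂ V₃ _ _ _ f g hf' hg' hfg)
    · refine LinearMap.ext fun t => ?_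
      obtain ⟨t, rfl⟩ := (cotensorFlip ψ s hs h₁).surjective t
      simp only [LinearMap.comp_apply, LinearEquiv.coe_coe, LinearEquiv.symm_apply_apply]
      rw [← cotensorFlip_mapRight ψ s hs h₁ h₂ f hf, LinearEquiv.symm_apply_apply]
    · refine LinearMap.ext fun t => ?_
      obtain ⟨t, rfl⟩ := (cotensorFlip ψ s hs h₂).surjective t
      simp only [LinearMap.comp_apply, LinearEquiv.coe_coe, LinearEquiv.symm_apply_apply]
      rw [← cotensorFlip_mapRight ψ s hs h₂ h₃ g hg, LinearEquiv.symm_apply_apply]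
  nontrivial V _ _ ρ hV :=
    (cotensorFlip ψ s hs (ρ := ρ) (ρ' := ρ.flip ψ hψ hψ')
      (fun _ => rfl)).toEquiv.nontrivial_congr.2 (hτ.nontrivial V _ hV)

theorem RightComodule.FaithfullyCoflat.left_of_antiEquiv (ψ : C ≃ₗ[k] C') (s : M ≃ₗ[k] M')
    (hs : ∀ m, τ'.coact (s m) =
      TensorProduct.map ψ.toLinearMap s.toLinearMap (TensorProduct.comm k M C (τ.coact m)))
    (hψ : ∀ c, comul (R := k) (ψ c) =
      TensorProduct.map ψ.toLinearMap ψ.toLinearMap (TensorProduct.comm k C C (comul c)))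
    (hψ' : ∀ c, Coalgebra.counit (R := k) (ψ c) = Coalgebra.counit (R := k) c)
    (hτ : τ.FaithfullyCoflat) :
    τ'.FaithfullyCoflat := by
  have hχ : ∀ c, comul (R := k) (ψ.symm c) = TensorProduct.map ψ.symm.toLinearMap
      ψ.symm.toLinearMap (TensorProduct.comm k C' C' (comul c)) := fun c => by
    obtain ⟨c, rfl⟩ := ψ.surjective c
    rw [hψ, LinearEquiv.symm_apply_apply]
    generalize comul (R := k) c = z
    induction z with
    | zero => simp
    | add a b ha hb =>
      simp only [map_add]
      exact congrArg₂ (· + ·) ha hb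
    | tmul a b => simp
  have hχ' : ∀ c, Coalgebra.counit (R := k) (ψ.symm c) = Coalgebra.counit (R := k) c := fun c => by
    rw [← hψ', LinearEquiv.apply_symm_apply]
  -- The test comodules are now over `C'`; they are carried back to `C` along `ψ.symm`, and flipping
  -- again returns the original coaction.
  have hflip : ∀ {V : Type v} [AddCommGroup V] [Module k V] (ρ : RightComodule k C' V) (v : V),
      ρ.coact v = ψ.toLinearMap.lTensor V (TensorProduct.comm k C V
        ((ρ.flip ψ.symm hχ hχ').coact v)) := by
    intro V _ _ ρ v
    change _ = ψ.toLinearMap.lTensor V (TensorProduct.comm k C V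
      (ψ.symm.toLinearMap.rTensor V (TensorProduct.comm k V C' (ρ.coact v))))
    generalize ρ.coact v = z
    induction z with
    | zero => simp
    | add a b ha hb =>
      simp only [map_add]
      exact congrArg₂ (· + ·) ha hb
    | tmul a b => simp
  constructor
  · intro V₁ V₂ V₃ _ _ _ _ _ _ ρ₁ ρ₂ ρ₃ f g hf hg hfg
    have h₁ := hflip ρ₁
    have h₂ := hflip ρ₂
    have h₃ := hflip ρ₃
    have hf' := (isColinear_flip_iff ψ h₁ h₂ f).2 hf
    have hg' := (isColinear_flip_iff ψ h₂ h₃ g).2 hg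
    refine Function.Exact.of_ladder_linearEquiv_of_exact
      (e₁ := cotensorFlip ψ s hs h₁) (e₂ := cotensorFlip ψ s hs h₂)
      (e₃ := cotensorFlip ψ s hs h₃) ?_ ?_ (hτ.exact V₁ V₂ V₃ _ _ _ f g hf' hg' hfg)
    · refine LinearMap.ext fun t => ?_
      exact (cotensorFlip_mapRight ψ s hs h₁ h₂ f hf' hf t).symm
    · refine LinearMap.ext fun t => ?_
      exact (cotensorFlip_mapRight ψ s hs h₂ h₃ g hg' hg t).symm
  · intro V _ _ ρ hV
    exact (cotensorFlip ψ s hs (hflip ρ)).toEquiv.nontrivial_congr.1 (hτ.nontrivial V _ hV)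

end CoflatTransport

namespace LeftModuleFactorCoalgebra

variable {k : Type u} {H H' : Type v} [Field k] [Ring H] [HopfAlgebra k H] [Ring H']
  [HopfAlgebra k H'] (E : CoopEquiv k H H') (C : LeftModuleFactorCoalgebra k H)

theorem comul_coopEquiv (c : C.Quot) : comul (R := k) (C.coopEquiv E c) =
    TensorProduct.map (C.coopEquiv E).toLinearMap (C.coopEquiv E).toLinearMap
      (TensorProduct.comm k C.Quot C.Quot (comul c)) := by
  obtain ⟨x, rfl⟩ := Submodule.mkQ_surjective _ c
  rw [C.coopEquiv_mkQ E x, comul_mkQ, comul_mkQ, E.comul_apply]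
  generalize comul (R := k) x = z
  induction z with
  | zero => simp
  | add a b ha hb => simp only [map_add, ha, hb]
  | tmul a b => rfl

theorem counit_coopEquiv (c : C.Quot) :
    Coalgebra.counit (R := k) (C.coopEquiv E c) = Coalgebra.counit (R := k) c := by
  obtain ⟨x, rfl⟩ := Submodule.mkQ_surjective _ c
  exact E.counit_apply x

theorem coop_isLeftFaithfullyCoflat (hC : C.IsRightFaithfullyCoflat) :
    (C.coop E).IsLeftFaithfullyCoflat :=
  RightComodule.FaithfullyCoflat.left_of_antiEquiv (τ := C.rightComodule) (C.coopEquiv E)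
    E.equiv.toLinearEquiv
    (C.rTensor_mkQ_comul_equiv E) (C.comul_coopEquiv E) (C.counit_coopEquiv E) hC

theorem isRightFaithfullyCoflat_of_coop (hC : (C.coop E).IsLeftFaithfullyCoflat) :
    C.IsRightFaithfullyCoflat :=
  LeftComodule.FaithfullyCoflat.right_of_antiEquiv (C.coopEquiv E) E.equiv.toLinearEquiv
    (C.rTensor_mkQ_comul_equiv E) (C.comul_coopEquiv E) (C.counit_coopEquiv E) hC

end LeftModuleFactorCoalgebra

/-! ### The right-handed statements, from the left-handed ones over the co-opposite. -/

section RightHanded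

variable {k : Type u} {H H' : Type v} [Field k] [Ring H] [HopfAlgebra k H] [Ring H']
  [HopfAlgebra k H']

theorem RightCoidealSubalgebra.factor_isRightFaithfullyCoflat (E : CoopEquiv k H H')
    {A : RightCoidealSubalgebra k H}
    (hA : A.IsRightFaithfullyFlat) : A.factor.IsRightFaithfullyCoflat := by
  apply A.factor.isRightFaithfullyCoflat_of_coop E
  rw [← A.factor_coop E]
  exact (A.coop E).factor_isLeftFaithfullyCoflat (A.coop_isLeftFaithfullyFlat E hA)

/-- Both assignments commute with `coop`, and `coop` along `E` is undone by `coop` along `E.symm`,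
so the left-handed identity for `A.coop E` transfers to `A`. -/
theorem RightCoidealSubalgebra.coinvariants_factor_of_right (E : CoopEquiv k H H')
    {A : RightCoidealSubalgebra k H}
    (hA : A.IsRightFaithfullyFlat) : A.factor.coinvariants = A := by
  rw [← A.factor.coinvariants.coop_coop E, ← A.factor.coinvariants_coop E, ← A.factor_coop E,
    (A.coop E).coinvariants_factor (A.coop_isLeftFaithfullyFlat E hA), A.coop_coop E]

theorem LeftModuleFactorCoalgebra.coinvariants_isRightFaithfullyFlat (E : CoopEquiv k H H')
    {C : LeftModuleFactorCoalgebra k H} (hC : C.IsRightFaithfullyCoflat) :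
    C.coinvariants.IsRightFaithfullyFlat := by
  apply C.coinvariants.isRightFaithfullyFlat_of_coop E
  rw [← C.coinvariants_coop E]
  exact (C.coop E).coinvariants_isLeftFaithfullyFlat E.symm.antipode_bijective
    (C.coop_isLeftFaithfullyCoflat E hC)

theorem LeftModuleFactorCoalgebra.factor_coinvariants_of_right (E : CoopEquiv k H H')
    {C : LeftModuleFactorCoalgebra k H} (hC : C.IsRightFaithfullyCoflat) :
    C.coinvariants.factor = C := by
  rw [← C.coinvariants.factor.coop_coop E, ← C.coinvariants.factor_coop E,
    ← C.coinvariants_coop E, (C.coop E).factor_coinvariants E.symm.antipode_bijective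
    (C.coop_isLeftFaithfullyCoflat E hC), C.coop_coop E]

end RightHanded

end Takeuchi


/-! ### Assembly of the two correspondences. -/

theorem theorem1p7 {k : Type u} {H : Type v} [Field k] [Ring H] [HopfAlgebra k H]
    (hS : Function.Bijective (HopfAlgebra.antipode k (A := H))) :
    (Set.BijOn (Takeuchi.RightCoidealSubalgebra.factor (k := k) (H := H))
        {A | A.IsLeftFaithfullyFlat} {C | C.IsLeftFaithfullyCoflat} ∧
      Set.BijOn (Takeuchi.LeftModuleFactorCoalgebra.coinvariants (k := k) (H := H))
        {C | C.IsLeftFaithfullyCoflat} {A | A.IsLeftFaithfullyFlat} ∧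
      Set.InvOn (Takeuchi.LeftModuleFactorCoalgebra.coinvariants (k := k) (H := H))
        (Takeuchi.RightCoidealSubalgebra.factor (k := k) (H := H))
        {A | A.IsLeftFaithfullyFlat} {C | C.IsLeftFaithfullyCoflat}) ∧
    (Set.BijOn (Takeuchi.RightCoidealSubalgebra.factor (k := k) (H := H))
        {A | A.IsRightFaithfullyFlat} {C | C.IsRightFaithfullyCoflat} ∧
      Set.BijOn (Takeuchi.LeftModuleFactorCoalgebra.coinvariants (k := k) (H := H))
        {C | C.IsRightFaithfullyCoflat} {A | A.IsRightFaithfullyFlat} ∧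
      Set.InvOn (Takeuchi.LeftModuleFactorCoalgebra.coinvariants (k := k) (H := H))
        (Takeuchi.RightCoidealSubalgebra.factor (k := k) (H := H))
        {A | A.IsRightFaithfullyFlat} {C | C.IsRightFaithfullyCoflat}) := by
  have : Fact (Function.Bijective (HopfAlgebra.antipode k (A := H))) := ⟨hS⟩
  let E := Takeuchi.CoopEquiv.cop k H
  have hl : Set.InvOn (Takeuchi.LeftModuleFactorCoalgebra.coinvariants (k := k) (H := H))
      (Takeuchi.RightCoidealSubalgebra.factor (k := k) (H := H))
      {A | A.IsLeftFaithfullyFlat} {C | C.IsLeftFaithfullyCoflat} :=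
    ⟨fun A hA => A.coinvariants_factor hA, fun C hC => C.factor_coinvariants hS hC⟩
  have hr : Set.InvOn (Takeuchi.LeftModuleFactorCoalgebra.coinvariants (k := k) (H := H))
      (Takeuchi.RightCoidealSubalgebra.factor (k := k) (H := H))
      {A | A.IsRightFaithfullyFlat} {C | C.IsRightFaithfullyCoflat} :=
    ⟨fun _ hA => Takeuchi.RightCoidealSubalgebra.coinvariants_factor_of_right E hA,
      fun _ hC => Takeuchi.LeftModuleFactorCoalgebra.factor_coinvariants_of_right E hC⟩
  have hfl : Set.MapsTo (Takeuchi.RightCoidealSubalgebra.factor (k := k) (H := H))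
      {A | A.IsLeftFaithfullyFlat} {C | C.IsLeftFaithfullyCoflat} :=
    fun A hA => A.factor_isLeftFaithfullyCoflat hA
  have hcl : Set.MapsTo (Takeuchi.LeftModuleFactorCoalgebra.coinvariants (k := k) (H := H))
      {C | C.IsLeftFaithfullyCoflat} {A | A.IsLeftFaithfullyFlat} :=
    fun C hC => C.coinvariants_isLeftFaithfullyFlat hS hC
  have hfr : Set.MapsTo (Takeuchi.RightCoidealSubalgebra.factor (k := k) (H := H))
      {A | A.IsRightFaithfullyFlat} {C | C.IsRightFaithfullyCoflat} :=
    fun _ hA => Takeuchi.RightCoidealSubalgebra.factor_isRightFaithfullyCoflat E hA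
  have hcr : Set.MapsTo (Takeuchi.LeftModuleFactorCoalgebra.coinvariants (k := k) (H := H))
      {C | C.IsRightFaithfullyCoflat} {A | A.IsRightFaithfullyFlat} :=
    fun _ hC => Takeuchi.LeftModuleFactorCoalgebra.coinvariants_isRightFaithfullyFlat E hC
  -- Maps that preserve the two classes and are mutually inverse on them are bijections in both
  -- directions.
  exact ⟨⟨hl.bijOn hfl hcl, hl.symm.bijOn hcl hfl, hl⟩,
    ⟨hr.bijOn hfr hcr, hr.symm.bijOn hcr hfr, hr⟩⟩
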